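/- Let $\mathbb F_q$ be the finite field with $q$ elements, let $\Lambda$ be an $\mathbb F_q$-algebra essentially of finite type, put $C=\operatorname{Spec}\Lambda$, and let all products be over $\mathbb F_q$. Let $X$ and $Y$ be Noetherian separated $\mathbb F_q$-schemes whose absolute $q$-power Frobenius endomorphisms $\sigma_X,\sigma_Y$ are finite. A *$\kappa$-sheaf* on $X$ over $\Lambda$ is a quasi-coherent sheaf $\mathcal V$ on $X\times C$ together with an $\mathcal O_{X\times C}$-linear map $\kappa\colon(\sigma_X\times\mathrm{id})_*\mathcal V\to\mathcal V$; morphisms are the $\mathcal O_{X\times C}$-linear maps commuting with $\kappa$. These form the abelian category $\mathbf{QCoh}_\kappa(X,\Lambda)$, in which kernels and cokernels are formed on underlying sheaves. A $\kappa$-sheaf is *coherent* if its underlying sheaf is coherent, *ind-coherent* if it is a union of coherent $\kappa$-subsheaves, *nilpotent* if $\kappa^n=0$ for some $n$, where $\kappa^0=\mathrm{id}$ and $\kappa^{n+1}=\kappa\circ(\sigma_X\times\mathrm{id})_*\kappa^n$, and *locally nilpotent* if it is a union of nilpotent $\kappa$-subsheaves. It is *locally nil-coherent* if it is ind-coherent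 and contains a coherent $\kappa$-subsheaf $\mathcal L$ such that the quotient by $\mathcal L$ is locally nilpotent; these form the full subcategory $\mathbf{LNilCoh}_\kappa(X,\Lambda)$. For $*\in\{b,+,-,\emptyset\}$ let $\mathbf D^*(\mathbf{LNilCoh}_\kappa(X,\Lambda))$ denote the class of objects of the derived category $\mathbf D(\mathbf{QCoh}_\kappa(X,\Lambda))$ that are isomorphic to a complex of locally nil-coherent $\kappa$-sheaves that is bounded ($*=b$), bounded below ($*=+$), bounded above ($*=-$), or arbitrary ($*=\emptyset$). Let $f\colon Y\to X$ be a morphism of finite type over $\mathbb F_q$. For a $\kappa$-sheaf $(\mathcal W,\kappa)$ on $Y$, the pushforward $f_*(\mathcal W,\kappa)$ is the sheaf $(f\times\mathrm{id})_*\mathcal W$ with the structure map $$(\sigma_X\times\mathrm{id})_*(f\times\mathrm{id})_*\mathcal W\cong(f\times\mathrm{id})_*(\sigma_Y\times\mathrm{id})_*\mathcal W\xrightarrow{(f\times\mathrm{id})_*\kappa}(f\times\mathrm{id})_*\mathcal W.$$ **Theorem.** The functor $f_*$ has a total right derived functor $Rf_*\colon\mathbf D(\mathbf{QCoh}_\kappa(Y,\Lambda))\to\mathbf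 D(\mathbf{QCoh}_\kappa(X,\Lambda))$, and for every $*\in\{b,-,+,\emptyset\}$ $$Rf_*\bigl(\mathbf D^*(\mathbf{LNilCoh}_\kappa(Y,\Lambda))\bigr)\subset\mathbf D^*(\mathbf{LNilCoh}_\kappa(X,\Lambda)).$$ -/

import Mathlib

open CategoryTheory Limits AlgebraicGeometry TopologicalSpace Opposite
universe u
noncomputable section
namespace CartierSheaves

/-- Sections of `M` over the locus `D = X_r ∩ U` where `r ∈ Γ(X, U)` is invertible are the
localization of the sections over `U`: the two elementwise conditions. -/
structure Localizes {X : Scheme.{u}} (M : X.Modules) (U D : X.Opens) (h : D ≤ U) (r : Γ(X, U)) :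
    Prop where
  eq_zero (t : Γ(M, U)) : M.presheaf.map (homOfLE h).op t = 0 → ∃ n : ℕ, r ^ n • t = 0
  surj (s : Γ(M, D)) : ∃ (n : ℕ) (t : Γ(M, U)),
    M.presheaf.map (homOfLE h).op t = (X.presheaf.map (homOfLE h).op r) ^ n • s

theorem localizes_congr {X : Scheme.{u}} (M : X.Modules) {U D U' D' : X.Opens} {h : D ≤ U}
    {h' : D' ≤ U'} {r : Γ(X, U)} {r' : Γ(X, U')} (e : U = U') (e' : D = D')
    (hr : r = X.presheaf.map (eqToHom e).op r') : Localizes M U D h r ↔ Localizes M U' D' h' r' := by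
  subst e e' hr
  simp

theorem localizes_restrict {X Y : Scheme.{u}} (φ : Y ⟶ X) [IsOpenImmersion φ] (M : X.Modules)
    {U D : Y.Opens} (h : D ≤ U) (r : Γ(Y, U)) : Localizes (M.restrict φ) U D h r ↔
      Localizes M (φ ''ᵁ U) (φ ''ᵁ D) (φ.image_mono h) ((φ.appIso U).inv r) := by
  have key : (φ.appIso D).inv (Y.presheaf.map (homOfLE h).op r) =
      X.presheaf.map (homOfLE (φ.image_mono h)).op ((φ.appIso U).inv r) := by
    exact congr($(φ.appIso_inv_naturality (homOfLE h).op) r)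
  constructor
  · intro H
    refine ⟨fun t ht => ?_, fun s => ?_⟩
    · obtain ⟨n, hn⟩ := H.eq_zero t ht
      refine ⟨n, ?_⟩
      rw [← map_pow]
      exact hn
    · obtain ⟨n, t, hn⟩ := H.surj s
      refine ⟨n, t, ?_⟩
      rw [← key, ← map_pow]
      exact hn
  · intro H
    refine ⟨fun t ht => ?_, fun s => ?_⟩
    · obtain ⟨n, hn⟩ := H.eq_zero t ht
      refine ⟨n, ?_⟩
      rw [← map_pow] at hn
      exact hn
    · obtain ⟨n, t, hn⟩ := H.surj s
      refine ⟨n, t, ?_⟩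
      rw [← key, ← map_pow] at hn
      exact hn

/-- The basic open subset `D(r)`, as an open subset of the scheme `Spec R`. -/
def specD {R : CommRingCat.{u}} (r : R) : (Spec R).Opens := PrimeSpectrum.basicOpen r

theorem isLocalizing_iff {R : CommRingCat.{u}} (M : (Spec R).Modules) :
    IsLocalizing (modulesSpecToSheaf.obj M) ↔ ∀ r : R, Localizes M ⊤ (specD r)
      le_top ((Scheme.ΓSpecIso R).inv r) := by
  have hs (r : R) (n : ℕ) (t : Γ(M, ⊤)) : ((Scheme.ΓSpecIso R).inv r) ^ n • t = r ^ n • t := by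
    rw [Scheme.Modules.smul_Spec_def, map_pow, ← map_pow]
    congr 1
  have hs' (r : R) (n : ℕ) (t : Γ(M, specD r)) :
      ((Spec R).presheaf.map (homOfLE (le_top : specD r ≤ ⊤)).op
        ((Scheme.ΓSpecIso R).inv r)) ^ n • t = r ^ n • t := by
    rw [Scheme.Modules.smul_Spec_def, map_pow, ← map_pow, map_pow]
    rfl
  let φ (f : R) := ((modulesSpecToSheaf.obj M).obj.map (PrimeSpectrum.basicOpen f).leTop.op).hom
  refine ⟨fun h r ↦ ⟨fun t ht => ?_, fun s => ?_⟩,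
    fun h f ↦ IsLocalizedModule.Away.mk_of_addCommGroup ?_ ?_ ?_⟩
  · have := h r
    obtain ⟨⟨_, n, rfl⟩, hn⟩ := (IsLocalizedModule.eq_zero_iff (.powers r) (φ r)).mp ht
    exact ⟨n, (hs _ _ _).trans hn⟩
  · have : IsLocalizedModule.Away r (φ r) := h r
    obtain ⟨n, y, hy⟩ := this.surj _ _ s
    exact ⟨n, y, hy.symm.trans (hs' _ _ _).symm⟩
  · exact Scheme.Modules.isUnit_algebraMap_end_of_le_basicOpen f le_rfl
  · intro x
    obtain ⟨n, t, ht⟩ := (h f).surj x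
    exact ⟨n, t, ((hs' _ _ _).symm.trans ht.symm)⟩
  · intro x hx
    obtain ⟨n, hn⟩ := (h f).eq_zero _ hx
    exact ⟨n, (hs _ _ _).symm.trans hn⟩

theorem localizes_fromSpec {X : Scheme.{u}} (M : X.Modules)
    {U : X.Opens} (hU : IsAffineOpen U) (r : Γ(X, U)) :
    Localizes (M.restrict hU.fromSpec) ⊤ (specD r)
      le_top ((Scheme.ΓSpecIso Γ(X, U)).inv r) ↔
    Localizes M U (X.basicOpen r) (X.basicOpen_le r) r := by
  rw [localizes_restrict]
  refine localizes_congr M ?_ (hU.fromSpec_image_basicOpen r) ?_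
  · simp
  · apply (ConcreteCategory.bijective_of_isIso (hU.fromSpec.appIso ⊤).hom).1
    rw [← ConcreteCategory.comp_apply, ← ConcreteCategory.comp_apply, Iso.inv_hom_id,
      Scheme.Hom.appIso_hom', ← ConcreteCategory.comp_apply, Scheme.Hom.map_appLE]
    have : hU.fromSpec.appLE U ⊤ hU.fromSpec_preimage_self.ge =
        (Scheme.ΓSpecIso Γ(X, U)).inv := by
      rw [Scheme.Hom.appLE, hU.fromSpec_app_self, Category.assoc, ← Functor.map_comp]
      exact (congrArg (_ ≫ ·) ((Spec Γ(X, U)).presheaf.map_id _)).trans (Category.comp_id _)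
    rw [this]
    rfl

theorem localizes_of_isAffineOpen {X : Scheme.{u}} (M : X.Modules) [M.IsQuasicoherent]
    {U : X.Opens} (hU : IsAffineOpen U) (r : Γ(X, U)) :
    Localizes M U (X.basicOpen r) (X.basicOpen_le r) r := by
  have h1 : (M.restrict hU.fromSpec).IsQuasicoherent := inferInstance
  rw [isQuasicoherent_iff_isIso_fromTildeΓ, isIso_fromTildeΓ_iff_isLocalizing,
    isLocalizing_iff] at h1
  exact (localizes_fromSpec M hU r).1 (h1 r)

def presOfIso {X : Scheme.{u}} {M N : X.Modules} (e : M ≅ N) (P : M.Presentation) :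
    N.Presentation :=
  @SheafOfModules.Presentation.ofIsIso.{u, u, u} _ _ _ _ _ _ _ _ e.hom
    ⟨e.inv, e.hom_inv_id, e.inv_hom_id⟩ P

def presOver {X : Scheme.{u}} (M : X.Modules) (U : X.Opens)
    (P : (M.restrict U.ι).Presentation) : (M.over U).Presentation := by
  let E := U.sheafOfModulesEquivOver X.ringCatSheaf
  have : PreservesColimitsOfSize.{u, u} E.inverse :=
    E.symm.toAdjunction.leftAdjoint_preservesColimits
  let P2 : SheafOfModules.Presentation (R := U.sheafRestrict.obj X.ringCatSheaf)
      (E.functor.obj (M.over U)) :=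
    presOfIso ((Scheme.Modules.overFunctorEquiv U).symm.app M) P
  exact SheafOfModules.Presentation.ofIsIso.{u, u, u} (E.unitIso.inv.app (M.over U))
    (P2.map E.inverse (U.sheafOfModulesEquivOverInverseUnit X.ringCatSheaf).symm)

def pres1 {X : Scheme.{u}} (M : X.Modules)
    {U : X.Opens} (hU : IsAffineOpen U) (h : IsIso (M.restrict hU.fromSpec).fromTildeΓ) :
    (M.restrict U.ι).Presentation := by
  let P : (M.restrict hU.fromSpec).Presentation := presOfIso (@asIso _ _ _ _ (M.restrict hU.fromSpec).fromTildeΓ h) (presentationTilde.{u} _ .univ (by simp) _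
    (Submodule.span_eq _))
  let P1 := Scheme.Modules.presentationRestrict hU.isoSpec.hom P
  exact presOfIso (((Scheme.Modules.restrictFunctorComp _ _).symm ≪≫
      Scheme.Modules.restrictFunctorCongr hU.isoSpec_hom_fromSpec).app M) P1

theorem isQuasicoherent_of_localizes {X : Scheme.{u}} (M : X.Modules)
    (h : ∀ (U : X.Opens) (_ : IsAffineOpen U) (r : Γ(X, U)),
      Localizes M U (X.basicOpen r) (X.basicOpen_le r) r) : M.IsQuasicoherent := by
  have h1 (U : X.Opens) (hU : IsAffineOpen U) : IsIso (M.restrict hU.fromSpec).fromTildeΓ := by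
    rw [isIso_fromTildeΓ_iff_isLocalizing,
      isLocalizing_iff]
    exact fun r => (localizes_fromSpec M hU r).2 (h U hU r)
  have h2 (U : X.affineOpens) : (M.over U.1).IsQuasicoherent :=
    (presOver M U.1 (pres1 M U.2 (h1 U.1 U.2))).isQuasicoherent
  exact SheafOfModules.IsQuasicoherent.of_coversTop M (fun U : X.affineOpens => U.1) (by
    rw [Opens.coversTop_iff]
    exact iSup_affineOpens_eq_top X)

/-- Restriction of sections of a module. -/
def res {X : Scheme.{u}} (M : X.Modules) {U V : X.Opens} (h : V ≤ U) : Γ(M, U) →+ Γ(M, V) :=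
  (M.presheaf.map (homOfLE h).op).hom

/-- Restriction of functions. -/
def resO {X : Scheme.{u}} {U V : X.Opens} (h : V ≤ U) : Γ(X, U) →+* Γ(X, V) :=
  (X.presheaf.map (homOfLE h).op).hom

theorem res_res {X : Scheme.{u}} (M : X.Modules) {U V W : X.Opens} (h : V ≤ U) (h' : W ≤ V)
    (t : Γ(M, U)) : res M h' (res M h t) = res M (h'.trans h) t := by
  change ((M.presheaf.map _ ≫ M.presheaf.map _)) t = _
  rw [← Functor.map_comp]
  rfl

theorem resO_resO {X : Scheme.{u}} {U V W : X.Opens} (h : V ≤ U) (h' : W ≤ V)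
    (t : Γ(X, U)) : resO h' (resO h t) = resO (h'.trans h) t := by
  change ((X.presheaf.map _ ≫ X.presheaf.map _)) t = _
  rw [← Functor.map_comp]
  rfl

theorem res_smul {X : Scheme.{u}} (M : X.Modules) {U V : X.Opens} (h : V ≤ U)
    (r : Γ(X, U)) (t : Γ(M, U)) : res M h (r • t) = resO h r • res M h t :=
  Scheme.Modules.map_smul _ _ _ _

theorem res_ext {X : Scheme.{u}} (M : X.Modules) {ι : Type u} {U : X.Opens} {V : ι → X.Opens}
    (hV : ∀ i, V i ≤ U) (hU : U ≤ iSup V) {s t : Γ(M, U)}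
    (h : ∀ i, res M (hV i) s = res M (hV i) t) : s = t :=
  TopCat.Sheaf.eq_of_locally_eq' ⟨_, M.isSheaf⟩ V U (fun i => homOfLE (hV i)) hU s t h

theorem res_glue {X : Scheme.{u}} (M : X.Modules) {ι : Type u} {U : X.Opens} {V : ι → X.Opens}
    (hV : ∀ i, V i ≤ U) (hU : U ≤ iSup V) (s : ∀ i, Γ(M, V i))
    (h : ∀ i j, res M (inf_le_left : V i ⊓ V j ≤ V i) (s i) = res M inf_le_right (s j)) :
    ∃ t, ∀ i, res M (hV i) t = s i :=
  (TopCat.Sheaf.existsUnique_gluing' ⟨_, M.isSheaf⟩ V U (fun i => homOfLE (hV i)) hU s h).exists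

theorem exists_affine_cover {X : Scheme.{u}} {U : X.Opens} (hU : IsCompact (U : Set X)) :
    ∃ (ι : Type u) (_ : Finite ι) (V : ι → X.Opens), (∀ i, IsAffineOpen (V i)) ∧ U = iSup V := by
  obtain ⟨s, hs, e⟩ := isCompact_iff_finite_and_eq_biUnion_affineOpens.mp hU
  refine ⟨s, hs, fun i => i.1.1, fun i => i.1.2, ?_⟩
  ext x
  simp [e]

theorem localizes_local {X : Scheme.{u}} (M : X.Modules) [M.IsQuasicoherent]
    {U V : X.Opens} (hV : IsAffineOpen V) (h : V ≤ U) (r : Γ(X, U)) :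
    Localizes M V (V ⊓ X.basicOpen r) inf_le_left (resO h r) :=
  (localizes_congr M rfl (Scheme.basicOpen_res _ _ _) (by simp)).1
    (localizes_of_isAffineOpen M hV (resO h r))

theorem localizes_eq_zero {X : Scheme.{u}} (M : X.Modules) [M.IsQuasicoherent]
    {U : X.Opens} (hU : IsCompact (U : Set X)) (r : Γ(X, U)) {D : X.Opens}
    (hD : D = X.basicOpen r) (hDU : D ≤ U) (t : Γ(M, U)) (ht : res M hDU t = 0) :
    ∃ n : ℕ, r ^ n • t = 0 := by
  subst hD
  obtain ⟨ι, hι, V, hV, e⟩ := exists_affine_cover hU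
  have hVU (i) : V i ≤ U := e ▸ le_iSup V i
  have H (i) : ∃ n : ℕ, resO (hVU i) r ^ n • res M (hVU i) t = 0 := by
    apply (localizes_local M (hV i) (hVU i) r).eq_zero
    change res M inf_le_left (res M (hVU i) t) = 0
    rw [res_res, ← res_res M hDU inf_le_right, ht, map_zero]
  choose n hn using H
  refine ⟨⨆ i, n i, res_ext M hVU e.le fun i => ?_⟩
  have hi : n i ≤ ⨆ i, n i := le_ciSup (Finite.bddAbove_range _) _
  rw [res_smul, map_pow, map_zero, ← Nat.sub_add_cancel hi, pow_add, mul_smul, hn, smul_zero]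

theorem localizes_of_qcqs {X : Scheme.{u}} (M : X.Modules) [M.IsQuasicoherent]
    {U : X.Opens} (hU : IsCompact (U : Set X)) (hU' : IsQuasiSeparated (U : Set X))
    (r : Γ(X, U)) : Localizes M U (X.basicOpen r) (X.basicOpen_le r) r := by
  refine ⟨localizes_eq_zero M hU r rfl _, fun s => ?_⟩
  obtain ⟨ι, hι, V, hV, e⟩ := exists_affine_cover hU
  have hVU (i) : V i ≤ U := e ▸ le_iSup V i
  have H (i) : ∃ (n : ℕ) (t : Γ(M, V i)), res M (inf_le_left : V i ⊓ X.basicOpen r ≤ V i) t =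
      resO (inf_le_left.trans (hVU i) : V i ⊓ X.basicOpen r ≤ U) r ^ n • res M inf_le_right s := by
    obtain ⟨n, t, h⟩ := (localizes_local M (hV i) (hVU i) r).surj (res M inf_le_right s)
    refine ⟨n, t, h.trans ?_⟩
    rw [← resO_resO (hVU i) inf_le_left]
    rfl
  choose n t hn using H
  let N := ⨆ i, n i
  let t' (i) : Γ(M, V i) := resO (hVU i) r ^ (N - n i) • t i
  have ht' (i) : res M (inf_le_left : V i ⊓ X.basicOpen r ≤ V i) (t' i) =
      resO (inf_le_left.trans (hVU i) : V i ⊓ X.basicOpen r ≤ U) r ^ N • res M inf_le_right s := by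
    have hi : n i ≤ N := le_ciSup (Finite.bddAbove_range _) _
    rw [res_smul, map_pow, resO_resO, hn, ← mul_smul, ← pow_add, Nat.sub_add_cancel hi]
  have H2 (i j) : ∃ m : ℕ, resO (inf_le_left.trans (hVU i) : V i ⊓ V j ≤ U) r ^ m •
      (res M (inf_le_left : V i ⊓ V j ≤ V i) (t' i) - res M inf_le_right (t' j)) = 0 := by
    refine localizes_eq_zero M ?_ _ (D := V i ⊓ V j ⊓ X.basicOpen r) ?_ inf_le_left _ ?_
    · exact hU' _ _ (hVU i) (V i).2 (hV i).isCompact (hVU j) (V j).2 (hV j).isCompact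
    · exact (Scheme.basicOpen_res _ _ _).symm
    · rw [map_sub, res_res, res_res,
        ← res_res M (inf_le_left : V i ⊓ X.basicOpen r ≤ V i)
          (le_inf (inf_le_left.trans inf_le_left) inf_le_right),
        ← res_res M (inf_le_left : V j ⊓ X.basicOpen r ≤ V j)
          (le_inf (inf_le_left.trans inf_le_right) inf_le_right), ht', ht']
      simp [res_smul, res_res, resO_resO]
  choose m hm using H2
  let K := ⨆ i, ⨆ j, m i j
  obtain ⟨w, hw⟩ := res_glue M hVU e.le (fun i => resO (hVU i) r ^ K • t' i) (fun i j => by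
    have hij : m i j ≤ K :=
      le_ciSup_of_le (Finite.bddAbove_range _) i (le_ciSup (Finite.bddAbove_range _) _)
    rw [← sub_eq_zero, res_smul (r := resO _ r ^ K) (t := t' i), res_smul (r := resO _ r ^ K) (t := t' j),
      map_pow, map_pow, resO_resO, resO_resO, ← smul_sub,
      ← Nat.sub_add_cancel hij, pow_add, mul_smul, hm, smul_zero])
  refine ⟨K + N, w, ?_⟩
  refine res_ext M (V := fun i => V i ⊓ X.basicOpen r) (fun i => inf_le_right) ?_ fun i => ?_
  · rw [← iSup_inf_eq, ← e]
    exact le_inf (X.basicOpen_le r) le_rfl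
  · change res M (inf_le_right : V i ⊓ X.basicOpen r ≤ X.basicOpen r) (res M (X.basicOpen_le r) w) =
      res M (inf_le_right : V i ⊓ X.basicOpen r ≤ X.basicOpen r) (resO (X.basicOpen_le r) r ^ _ • s)
    rw [res_res, ← res_res M (hVU i) inf_le_left, hw, res_smul, ht', res_smul, map_pow, map_pow,
      resO_resO, resO_resO, ← mul_smul, ← pow_add]

theorem isQuasicoherent_pushforward {X Y : Scheme.{u}} (f : Y ⟶ X) [QuasiCompact f]
    [QuasiSeparated f] (M : Y.Modules) [M.IsQuasicoherent]  :
    ((Scheme.Modules.pushforward f).obj M).IsQuasicoherent := by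
  apply isQuasicoherent_of_localizes
  intro U hU r
  have h := localizes_of_qcqs M (U := f ⁻¹ᵁ U) (f.isCompact_preimage hU.isCompact)
    (f.isQuasiSeparated_preimage hU.isQuasiSeparated) (f.app U r)
  have h' : Localizes M (f ⁻¹ᵁ U) (f ⁻¹ᵁ X.basicOpen r) (f.preimage_mono (X.basicOpen_le r))
    (f.app U r) := by
    refine (localizes_congr M rfl (Scheme.preimage_basicOpen f r).symm ?_).1 h
    simp
  have key : f.app _ (X.presheaf.map (homOfLE (X.basicOpen_le r)).op r) =
      Y.presheaf.map (homOfLE (f.preimage_mono (X.basicOpen_le r))).op (f.app U r) :=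
    congr($(f.naturality (homOfLE (X.basicOpen_le r)).op) r)
  refine ⟨fun t ht => ?_, fun s => ?_⟩
  · obtain ⟨n, hn⟩ := h'.eq_zero t ht
    refine ⟨n, ?_⟩
    rw [← map_pow] at hn
    exact hn
  · obtain ⟨n, t, hn⟩ := h'.surj s
    refine ⟨n, t, ?_⟩
    rw [← key, ← map_pow] at hn
    exact hn

variable {k : Type u} [Field k]

section Product

variable (Λ : Type u) [CommRing Λ] [Algebra k Λ]

/-- The product `X × C` over `k`, where `C = Spec Λ`. -/
abbrev prod (X : Over (Spec (.of k))) : Scheme.{u} :=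
  pullback X.hom (Spec.map (CommRingCat.ofHom (algebraMap k Λ)))

/-- The morphism `f × id : Y × C ⟶ X × C`. -/
def prodMap {X Y : Over (Spec (.of k))} (f : Y ⟶ X) : prod Λ Y ⟶ prod Λ X :=
  pullback.lift (pullback.fst _ _ ≫ f.left) (pullback.snd _ _) (by
    rw [Category.assoc, Over.w f, pullback.condition])

@[simp]
theorem prodMap_fst {X Y : Over (Spec (.of k))} (f : Y ⟶ X) :
    prodMap Λ f ≫ pullback.fst _ _ = pullback.fst _ _ ≫ f.left := by
  exact pullback.lift_fst _ _ _

@[simp]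
theorem prodMap_snd {X Y : Over (Spec (.of k))} (f : Y ⟶ X) :
    prodMap Λ f ≫ pullback.snd _ _ = pullback.snd _ _ := by
  exact pullback.lift_snd _ _ _

theorem prodMap_comp {X Y Z : Over (Spec (.of k))} (f : Y ⟶ X) (g : X ⟶ Z) :
    prodMap Λ f ≫ prodMap Λ g = prodMap Λ (f ≫ g) := by
  apply pullback.hom_ext
  · rw [Category.assoc, prodMap_fst, prodMap_fst, ← Category.assoc, prodMap_fst, Category.assoc,
      Over.comp_left]
  · rw [Category.assoc, prodMap_snd, prodMap_snd, prodMap_snd]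

theorem isPullback_prodMap {X Y : Over (Spec (.of k))} (f : Y ⟶ X) :
    IsPullback (pullback.fst _ _) (prodMap Λ f) f.left
      (pullback.fst X.hom (Spec.map (CommRingCat.ofHom (algebraMap k Λ)))) := by
  refine IsPullback.of_bot (h₃₁ := Spec.map (CommRingCat.ofHom (algebraMap k Λ)))
    (v₂₁ := pullback.snd _ _) (v₂₂ := X.hom) ?_ (prodMap_fst Λ f).symm
    (IsPullback.of_hasPullback _ _)
  rw [prodMap_snd, Over.w]
  exact IsPullback.of_hasPullback _ _

instance {X Y : Over (Spec (.of k))} (f : Y ⟶ X) [QuasiCompact f.left] :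
    QuasiCompact (prodMap Λ f) :=
  MorphismProperty.of_isPullback (isPullback_prodMap Λ f) ‹_›

instance {X Y : Over (Spec (.of k))} (f : Y ⟶ X) [QuasiSeparated f.left] :
    QuasiSeparated (prodMap Λ f) :=
  MorphismProperty.of_isPullback (isPullback_prodMap Λ f) ‹_›

end Product

/-- The ring endomorphism `x ↦ x ^ q`, `q = #k`, of an algebra over a finite field `k`. -/
def powCardHom {k A : Type*} [Field k] [Finite k] [CommRing A] (φ : k →+* A) : A →+* A where
  toFun x := x ^ Nat.card k
  map_one' := one_pow _
  map_mul' x y := mul_pow x y _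
  map_zero' := zero_pow Nat.card_pos.ne'
  map_add' x y := by
    let := Fintype.ofFinite k
    let := φ.toAlgebra
    have := (FiniteField.frobeniusAlgHom k A).map_add x y
    simpa [Nat.card_eq_fintype_card] using this

variable [Finite k]

/-- The `k`-algebra structure map of the ring of sections `Γ(X, U)` of a `k`-scheme. -/
def structureHom (X : Over (Spec (.of k))) (U : X.left.Opens) : k →+* Γ(X.left, U) :=
  (X.hom.appLE ⊤ U le_top).hom.comp (Scheme.ΓSpecIso (.of k)).inv.hom

/-- The absolute `q`-power Frobenius endomorphism of a `k`-scheme, `q = #k`: the identity on the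
underlying space and `s ↦ s ^ q` on functions. -/
def frobScheme (X : Over (Spec (.of k))) : X.left ⟶ X.left where
  base := 𝟙 _
  c := { app U := CommRingCat.ofHom (powCardHom (structureHom X U.unop))
         naturality U V i := by
          ext x
          exact (map_pow (X.left.presheaf.map i).hom x _).symm }
  prop x := by
    refine ⟨fun a ha => ?_⟩
    obtain ⟨U, hxU, s, rfl⟩ := X.left.presheaf.exists_germ_eq a
    erw [PresheafedSpace.stalkMap_germ_apply] at ha
    have h2 : IsUnit ((X.left.presheaf.germ U x hxU).hom s ^ Nat.card k) := by
      rw [← map_pow]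
      exact ha
    exact (isUnit_pow_iff Nat.card_pos.ne').1 h2

theorem frobScheme_app (X : Over (Spec (.of k))) (U : X.left.Opens) (s : Γ(X.left, U)) :
  (frobScheme X).app U s = s ^ Nat.card k := rfl

theorem frobScheme_naturality {X Y : Over (Spec (.of k))} (f : Y ⟶ X) :
    frobScheme Y ≫ f.left = f.left ≫ frobScheme X := by
  refine Scheme.Hom.ext rfl fun U => ?_
  ext x
  have h1 : ((f.left ≫ frobScheme X).app U) x = (f.left.app U).hom (x ^ Nat.card k) := rfl
  have h2 : ((frobScheme Y ≫ f.left).app U) x = (f.left.app U).hom x ^ Nat.card k := rfl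
  have h3 : (Y.left.presheaf.map (eqToHom (rfl : f.left ⁻¹ᵁ U = _)).op) = 𝟙 _ := by
    simp
  change (Y.left.presheaf.map (eqToHom (rfl : f.left ⁻¹ᵁ U = _)).op)
    ((frobScheme Y ≫ f.left).app U x) = (f.left ≫ frobScheme X).app U x
  rw [h3, h1, h2]
  exact (map_pow _ _ _).symm

/-- The absolute `q`-power Frobenius `σ_X` as an endomorphism of the `k`-scheme `X`. -/
def frob (X : Over (Spec (.of k))) : X ⟶ X := Over.homMk (frobScheme X) (by
  refine ext_of_isAffine ?_
  ext x
  obtain ⟨a, rfl⟩ : ∃ a : k, x = (Scheme.ΓSpecIso (.of k)).inv.hom a :=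
    ⟨(Scheme.ΓSpecIso (.of k)).hom.hom x, by simp⟩
  have ha : a ^ Nat.card k = a := by
    let := Fintype.ofFinite k
    rw [Nat.card_eq_fintype_card, FiniteField.pow_card]
  change (X.hom.appTop.hom _) ^ Nat.card k = X.hom.appTop.hom _
  rw [← map_pow, ← map_pow, ha])

variable (Λ : Type u) [CommRing Λ] [Algebra k Λ]

theorem prodMap_frob {X Y : Over (Spec (.of k))} (f : Y ⟶ X) :
    prodMap Λ (frob Y) ≫ prodMap Λ f = prodMap Λ f ≫ prodMap Λ (frob X) := by
  rw [prodMap_comp, prodMap_comp]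
  congr 1
  ext : 1
  exact frobScheme_naturality f

/-- A `κ`-sheaf on `X` over `Λ`: a quasi-coherent sheaf `V` on `X × C` with an `𝒪`-linear map
`κ : (σ_X × id)_* V ⟶ V`. -/
structure CartierSheaf (X : Over (Spec (.of k))) where
  sheaf : (prod Λ X).Modules
  isQuasicoherent : sheaf.IsQuasicoherent
  κ : (Scheme.Modules.pushforward (prodMap Λ (frob X))).obj sheaf ⟶ sheaf

variable {Λ}
namespace CartierSheaf
variable {X Y : Over (Spec (.of k))}

/-- A morphism of `κ`-sheaves: a morphism of sheaves commuting with `κ`. -/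
@[ext]
structure Hom (V W : CartierSheaf Λ X) where
  hom : V.sheaf ⟶ W.sheaf
  comm : (Scheme.Modules.pushforward (prodMap Λ (frob X))).map hom ≫ W.κ = V.κ ≫ hom

instance : Category (CartierSheaf Λ X) where
  Hom := Hom
  id V := ⟨𝟙 _, by simp⟩
  comp f g := ⟨f.hom ≫ g.hom, by
    rw [Functor.map_comp, Category.assoc, g.comm, ← Category.assoc, f.comm, Category.assoc]⟩

@[ext]
theorem hom_ext {V W : CartierSheaf Λ X} {f g : V ⟶ W} (h : f.hom = g.hom) : f = g := Hom.ext h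

@[simp] theorem id_hom (V : CartierSheaf Λ X) : Hom.hom (𝟙 V) = 𝟙 V.sheaf := rfl
@[simp] theorem comp_hom {V W Z : CartierSheaf Λ X} (f : V ⟶ W) (g : W ⟶ Z) :
    (f ≫ g).hom = f.hom ≫ g.hom := rfl

instance (V W : CartierSheaf Λ X) : Zero (V ⟶ W) := ⟨⟨0, by simp⟩⟩
instance (V W : CartierSheaf Λ X) : Add (V ⟶ W) :=
  ⟨fun f g => ⟨f.hom + g.hom, by simp [f.comm, g.comm]⟩⟩
instance (V W : CartierSheaf Λ X) : Neg (V ⟶ W) := ⟨fun f => ⟨-f.hom, by simp [f.comm]⟩⟩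

@[simp] theorem zero_hom (V W : CartierSheaf Λ X) : Hom.hom (0 : V ⟶ W) = 0 := rfl
@[simp] theorem add_hom {V W : CartierSheaf Λ X} (f g : V ⟶ W) : (f + g).hom = f.hom + g.hom := rfl
@[simp] theorem neg_hom {V W : CartierSheaf Λ X} (f : V ⟶ W) : Hom.hom (-f) = -f.hom := rfl

instance : Preadditive (CartierSheaf Λ X) where
  homGroup V W :=
    { add_assoc a b c := by ext1; simp [add_assoc]
      zero_add a := by ext1; simp
      add_zero a := by ext1; simp
      add_comm a b := by ext1; simp [add_comm]
      neg_add_cancel a := by ext1; simp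
      nsmul := nsmulRec
      zsmul := zsmulRec }

/-- The underlying sheaf of a `κ`-sheaf. -/
@[simps]
def forget : CartierSheaf Λ X ⥤ (prod Λ X).Modules where
  obj V := V.sheaf
  map f := f.hom

instance : (forget (Λ := Λ) (X := X)).Additive where

/-- The underlying sheaf of the source of the `n`-th iterate, `(σ × id)_*^n V`. -/
def iterSource (V : CartierSheaf Λ X) : ℕ → (prod Λ X).Modules
  | 0 => V.sheaf
  | n + 1 => (Scheme.Modules.pushforward (prodMap Λ (frob X))).obj (V.iterSource n)

/-- The `n`-th iterate `κ^n : (σ × id)_*^n V ⟶ V`, `κ^(n+1) = κ ∘ (σ × id)_* κ^n`. -/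
def iterκ (V : CartierSheaf Λ X) : (n : ℕ) → (V.iterSource n ⟶ V.sheaf)
  | 0 => 𝟙 _
  | n + 1 => (Scheme.Modules.pushforward (prodMap Λ (frob X))).map (V.iterκ n) ≫ V.κ

variable (Λ X) in
/-- Coherent `κ`-sheaves: the underlying (quasi-coherent) sheaf on the Noetherian scheme `X × C` is
of finite type. -/
def isCoherent : ObjectProperty (CartierSheaf Λ X) := fun V => V.sheaf.IsFiniteType

variable (Λ X) in
/-- Nilpotent `κ`-sheaves: `κ^n = 0` for some `n`. -/
def isNilpotent : ObjectProperty (CartierSheaf Λ X) := fun V => ∃ n, V.iterκ n = 0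

/-- `V` is a union of `κ`-subsheaves satisfying `P`: every section of `V` lies locally in some
`κ`-subsheaf satisfying `P`. -/
def isUnionOf (P : ObjectProperty (CartierSheaf Λ X)) : ObjectProperty (CartierSheaf Λ X) :=
  fun V => ∀ (U : (prod Λ X).Opens) (m : Γ(V.sheaf, U)), ∀ x ∈ U,
    ∃ (U' : (prod Λ X).Opens) (h : U' ≤ U), x ∈ U' ∧
      ∃ (L : CartierSheaf Λ X) (i : L ⟶ V), Mono i.hom ∧ P L ∧
        V.sheaf.presheaf.map (homOfLE h).op m ∈ Set.range (i.hom.app U')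

variable (Λ X) in
/-- Ind-coherent `κ`-sheaves: unions of coherent `κ`-subsheaves. -/
def isIndCoherent : ObjectProperty (CartierSheaf Λ X) := isUnionOf (isCoherent Λ X)

variable (Λ X) in
/-- Locally nilpotent `κ`-sheaves: unions of nilpotent `κ`-subsheaves. -/
def isLocallyNilpotent : ObjectProperty (CartierSheaf Λ X) := isUnionOf (isNilpotent Λ X)

variable (Λ X) in
/-- Locally nil-coherent `κ`-sheaves: ind-coherent `κ`-sheaves `V` with a coherent `κ`-subsheaf `L`
such that `N = V / L` is locally nilpotent. -/
def isLocallyNilCoherent : ObjectProperty (CartierSheaf Λ X) := fun V =>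
  isIndCoherent Λ X V ∧
    ∃ (L N : CartierSheaf Λ X) (i : L ⟶ V) (p : V ⟶ N) (w : i ≫ p = 0),
      ((ShortComplex.mk i p w).map forget).ShortExact ∧
        isCoherent Λ X L ∧ isLocallyNilpotent Λ X N

end CartierSheaf

section Pushforward

variable (Λ)
variable {X Y : Over (Spec (.of k))} (f : Y ⟶ X) [QuasiCompact f.left] [QuasiSeparated f.left]

/-- The canonical isomorphism `(σ_X × id)_* (f × id)_* ≅ (f × id)_* (σ_Y × id)_*`. -/
def pushforwardFrobIso :
    Scheme.Modules.pushforward (prodMap Λ f) ⋙ Scheme.Modules.pushforward (prodMap Λ (frob X)) ≅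
      Scheme.Modules.pushforward (prodMap Λ (frob Y)) ⋙ Scheme.Modules.pushforward (prodMap Λ f) :=
  Scheme.Modules.pushforwardComp _ _ ≪≫
    Scheme.Modules.pushforwardCongr (prodMap_frob Λ f).symm ≪≫
      (Scheme.Modules.pushforwardComp _ _).symm

/-- The pushforward `f_*` of `κ`-sheaves: the underlying sheaf is `(f × id)_* W`, and `κ` is
`(σ_X × id)_* (f × id)_* W ≅ (f × id)_* (σ_Y × id)_* W ⟶ (f × id)_* W`. -/
def pushforward : CartierSheaf Λ Y ⥤ CartierSheaf Λ X where
  obj W :=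
    { sheaf := (Scheme.Modules.pushforward (prodMap Λ f)).obj W.sheaf
      isQuasicoherent :=
        have := W.isQuasicoherent
        isQuasicoherent_pushforward (prodMap Λ f) W.sheaf
      κ := (pushforwardFrobIso Λ f).hom.app W.sheaf ≫
        (Scheme.Modules.pushforward (prodMap Λ f)).map W.κ }
  map φ :=
    { hom := (Scheme.Modules.pushforward (prodMap Λ f)).map φ.hom
      comm := by
        have h := (pushforwardFrobIso Λ f).hom.naturality φ.hom
        simp only [Functor.comp_map] at h
        rw [← Category.assoc, h, Category.assoc, Category.assoc, ← Functor.map_comp, φ.comm,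
          Functor.map_comp] }
  map_id W := by ext1; exact (Scheme.Modules.pushforward (prodMap Λ f)).map_id _
  map_comp φ ψ := by ext1; exact (Scheme.Modules.pushforward (prodMap Λ f)).map_comp _ _

instance : (pushforward Λ f).Additive where
  map_add := by
    intros
    ext1
    exact (Scheme.Modules.pushforward (prodMap Λ f)).map_add

end Pushforward

section Derived

variable (Λ)

/-- A morphism of complexes of `κ`-sheaves is a quasi-isomorphism if it induces isomorphisms on
cohomology, i.e. on the cohomology of the underlying complexes of sheaves. -/
def quasiIso (X : Over (Spec (.of k))) :
    MorphismProperty (CochainComplex (CartierSheaf Λ X) ℤ) :=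
  (HomologicalComplex.quasiIso (prod Λ X).Modules (.up ℤ)).inverseImage
    (CartierSheaf.forget.mapHomologicalComplex (.up ℤ))

/-- The derived category of `κ`-sheaves `D(QCoh_κ(X, Λ))`. -/
abbrev Derived (X : Over (Spec (.of k))) := (quasiIso Λ X).Localization

variable {X Y : Over (Spec (.of k))} (f : Y ⟶ X) [QuasiCompact f.left] [QuasiSeparated f.left]

/-- The functor induced by `f_*` on complexes, with values in the derived category. -/
def pushforwardDerived : CochainComplex (CartierSheaf Λ Y) ℤ ⥤ Derived Λ X :=
  (pushforward Λ f).mapHomologicalComplex (.up ℤ) ⋙ (quasiIso Λ X).Q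

/-- The total right derived functor `Rf_* : D(QCoh_κ(Y, Λ)) ⥤ D(QCoh_κ(X, Λ))`. -/
def rightDerivedPushforward [(pushforwardDerived Λ f).HasRightDerivedFunctor (quasiIso Λ Y)] :
    Derived Λ Y ⥤ Derived Λ X :=
  (pushforwardDerived Λ f).totalRightDerived (quasiIso Λ Y).Q (quasiIso Λ Y)

/-- The boundedness conditions `* ∈ {b, +, -, ∅}` on complexes. -/
inductive Boundedness
  | bounded | below | above | unbounded

variable {Λ} in
/-- The complex `K` satisfies the boundedness condition. -/
def Boundedness.Holds (K : CochainComplex (CartierSheaf Λ X) ℤ) : Boundedness → Prop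
  | bounded => (∃ n : ℤ, ∀ i < n, IsZero (K.X i)) ∧ ∃ n : ℤ, ∀ i > n, IsZero (K.X i)
  | below => ∃ n : ℤ, ∀ i < n, IsZero (K.X i)
  | above => ∃ n : ℤ, ∀ i > n, IsZero (K.X i)
  | unbounded => True

/-- The objects of `D(QCoh_κ(X, Λ))` lying in `D^*(LNilCoh_κ(X, Λ))`: those represented by a
`*`-bounded complex of locally nil-coherent `κ`-sheaves. -/
def derivedLocallyNilCoherent (b : Boundedness) (X : Over (Spec (.of k))) :
    ObjectProperty (Derived Λ X) := fun V =>
  ∃ K : CochainComplex (CartierSheaf Λ X) ℤ, b.Holds K ∧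
    (∀ n, CartierSheaf.isLocallyNilCoherent Λ X (K.X n)) ∧ Nonempty (V ≅ (quasiIso Λ X).Q.obj K)

end Derived

end CartierSheaves

end

/-!
# Derived pushforward of locally nil-coherent `κ`-sheaves

No injective resolutions are needed: on a Noetherian separated scheme, the derived pushforward of a
complex of `κ`-sheaves is computed by the Čech complex of a finite affine covering, and this complex
is visibly made of locally nil-coherent `κ`-sheaves if the original one is.

*Existence.* Let `Y` be covered by finitely many affine open subsets `U i`, and let `T i` be the
endofunctor `j_* j^*` of `κ`-sheaves for the inclusion `j` of `U i × C`, which exists since `σ × id`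
maps `U i × C` to itself. The Čech functor (`cech`, `sheafCech`) is an iterated homotopy pullback:
adding the open subset `U i` to a family with Čech functor `R` gives the mapping cocone of the
difference `T i K ⊞ R K ⟶ T i (R K)`. Its coaugmentation is a quasi-isomorphism
(`quasiIso_sheafCech_η`), because it is one over the open subsets of each `U j × C`, where `T j` is
the identity. After pushforward the Čech functor preserves quasi-isomorphisms
(`quasiIso_pushforward_sheafCech_map`): all intersections are affine, and a quasi-isomorphism of
complexes of quasi-coherent sheaves is one on sections over affine open subsets (`qIso_of_quasiIso`).
Finally, pushforward inverts the coaugmentation on Čech complexes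
(`quasiIso_pushforward_sheafCech_η`). These three facts make `f_*` of the Čech complex a right
derived functor (`exists_isRightDerivedFunctor`, `exists_hasRightDerivedFunctor`), for unbounded
complexes and without any hypothesis of the kind of enough injectives. Since the covering is finite,
the Čech complex is bounded on the same sides as `K` (`boundedness_pushforward_sheafCech`).

*Reduction to modules.* A `κ`-sheaf is locally nil-coherent if and only if, for every affine open
subset `U`, its sections over `U × C` form a nil-coherent module (`IsNilCoherent`,
`isNilCoherentOnAffines_iff`): every element lies in a finitely generated `κ`-stable submodule, and
there is a finitely generated `κ`-stable submodule into which some power of `κ` maps any given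
finitely generated submodule. To pass from modules to sheaves, finitely generated `κ`-stable modules
of sections over the members of an affine covering have to be extended to coherent `κ`-subsheaves.
For one affine open subset, the subsheaf of sections which are fractions with numerators in the given
module does this (`isKapStable_fracSubsheaf`, `isQC_fracSubsheaf`); intersecting such subsheaves
gives finite generation on all members (`exists_subsheaf_fg`, `exists_coherent`). Noetherianity of
the functions on `U × C` comes from `Λ` being essentially of finite type
(`isNoetherianRing_prodOpen`).

*Pushforward.* The terms of `f_*` of the Čech complex are built from `κ`-sheaves whose sections over
`O × C` are those of a locally nil-coherent `κ`-sheaf over `U × C`, with `U ⊆ f⁻¹ O` affine. So it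
remains to see that nil-coherence over the functions `B` on `U × C` implies nil-coherence over the
functions `A` on `O × C` (`IsNilCoherent.restrictScalars`). As an `A`-algebra, `B` is generated by
finitely many functions `x` pulled back from `U`, on which `σ` is `x ↦ x ^ q`. Filter the `B`-span of
elements `y j` by the degree in the `x`. The rule `κ (σ(b) n) = b κ(n)` shows that `κ` divides the
degree by `q`, up to a constant (`exists_map_box_le`); finiteness of `σ` on `A` takes care of the
coefficients. Hence, for large `d`, the elements of degree at most `d` form a finitely generated
`κ`-stable `A`-submodule, and powers of `κ` contract all of these into a single one of them
(`exists_stable_box`).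
-/

noncomputable section

/-! ### Short exact sequences and mapping cocones of complexes, seen by additive functors -/

namespace CartierSheaves

section Probes

universe w v' u'
variable {C : Type u'} [Category.{v'} C] (G : C ⥤ AddCommGrpCat.{w})

/-- The additive map induced by a morphism on the values of a functor to abelian groups. -/
def ev {X Y : C} (f : X ⟶ Y) : G.obj X →+ G.obj Y := (G.map f).hom

theorem ev_comp {X Y Z : C} {f : X ⟶ Y} {g : Y ⟶ Z} {h : X ⟶ Z} (e : f ≫ g = h) (z : G.obj X) :
    ev G g (ev G f z) = ev G h z := by
  subst e
  simp [ev]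

theorem ev_comm {X Y Y' Z : C} {f : X ⟶ Y} {g : Y ⟶ Z} {f' : X ⟶ Y'} {g' : Y' ⟶ Z}
    (e : f ≫ g = f' ≫ g') (z : G.obj X) : ev G g (ev G f z) = ev G g' (ev G f' z) :=
  (ev_comp G e z).trans (ev_comp G rfl z).symm

@[simp]
theorem ev_id (X : C) (z : G.obj X) : ev G (𝟙 X) z = z := by
  simp [ev]

variable [Preadditive C] [G.Additive]

@[simp]
theorem ev_zero (X Y : C) (z : G.obj X) : ev G (0 : X ⟶ Y) z = 0 := by
  simp [ev]

@[simp]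
theorem ev_add {X Y : C} (f g : X ⟶ Y) (z : G.obj X) : ev G (f + g) z = ev G f z + ev G g z := by
  simp [ev]

@[simp]
theorem ev_neg {X Y : C} (f : X ⟶ Y) (z : G.obj X) : ev G (-f) z = -ev G f z := by
  simp [ev, G.map_neg]

variable {K L M N K' L' M' N' : CochainComplex C ℤ}

/-- The chain map `φ` becomes a quasi-isomorphism after applying the additive functor `G`,
expressed on elements. -/
structure QIso (φ : K ⟶ L) : Prop where
  inj : ∀ p q : ℤ, p + 1 = q → ∀ z : G.obj (K.X q), (∀ r, ev G (K.d q r) z = 0) →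
    ∀ w, ev G (φ.f q) z = ev G (L.d p q) w → ∃ y, ev G (K.d p q) y = z
  surj : ∀ p q : ℤ, p + 1 = q → ∀ z : G.obj (L.X q), (∀ r, ev G (L.d q r) z = 0) →
    ∃ y, (∀ r, ev G (K.d q r) y = 0) ∧ ∃ w, ev G (φ.f q) y + ev G (L.d p q) w = z

/-- The sequence of complexes `L ⟶ M ⟶ N` becomes short exact after applying `G`. -/
structure GExact (i : L ⟶ M) (p : M ⟶ N) : Prop where
  zero : i ≫ p = 0
  inj : ∀ (n : ℤ) (z : G.obj (L.X n)), ev G (i.f n) z = 0 → z = 0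
  exact : ∀ (n : ℤ) (z : G.obj (M.X n)), ev G (p.f n) z = 0 → ∃ y, ev G (i.f n) y = z
  surj : ∀ (n : ℤ) (z : G.obj (N.X n)), ∃ y, ev G (p.f n) y = z

variable {G}

theorem ev_d_d (a b c : ℤ) (z : G.obj (K.X a)) :
    ev G (K.d b c) (ev G (K.d a b) z) = 0 := by
  rw [ev_comp G (K.d_comp_d a b c), ev_zero]

omit [G.Additive] in
theorem ev_d (φ : K ⟶ L) (a b : ℤ) (z : G.obj (K.X a)) :
    ev G (L.d a b) (ev G (φ.f a) z) = ev G (φ.f b) (ev G (K.d a b) z) :=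
  ev_comm G (φ.comm a b) z

omit [G.Additive] in
theorem ev_f {φ : K ⟶ L} {ψ : L ⟶ M} {φ' : K ⟶ L'} {ψ' : L' ⟶ M} (h : φ ≫ ψ = φ' ≫ ψ') (a : ℤ)
    (z : G.obj (K.X a)) : ev G (ψ.f a) (ev G (φ.f a) z) = ev G (ψ'.f a) (ev G (φ'.f a) z) :=
  ev_comm G (congr($(h).f a)) z

theorem GExact.zero_apply {i : L ⟶ M} {p : M ⟶ N} (h : GExact G i p) (n : ℤ)
    (z : G.obj (L.X n)) : ev G (p.f n) (ev G (i.f n) z) = 0 := by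
  rw [ev_comp G (congr($(h.zero).f n)), HomologicalComplex.zero_f, ev_zero]

omit [G.Additive] in
theorem GExact.inj' {i : L ⟶ M} {p : M ⟶ N} (h : GExact G i p) {n : ℤ}
    {y z : G.obj (L.X n)} (e : ev G (i.f n) y = ev G (i.f n) z) : y = z :=
  sub_eq_zero.1 (h.inj _ _ (by rw [map_sub, e, sub_self]))

/-- The five lemma for a morphism of short exact sequences of complexes. -/
theorem QIso.of_gExact {i : L ⟶ M} {p : M ⟶ N} {i' : L' ⟶ M'} {p' : M' ⟶ N'} (h : GExact G i p)
    (h' : GExact G i' p') {a : L ⟶ L'} {b : M ⟶ M'} {c : N ⟶ N'} (e : i ≫ b = a ≫ i')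
    (e' : p ≫ c = b ≫ p') (ha : QIso G a) (hc : QIso G c) : QIso G b := by
  constructor
  · intro m n hmn z hz w hw
    obtain ⟨y, hy⟩ := hc.inj m n hmn (ev G (p.f n) z) (fun r => by rw [ev_d, hz, map_zero])
      (ev G (p'.f m) w) (by rw [ev_f e', hw, ev_d])
    obtain ⟨y, rfl⟩ := h.surj _ y
    obtain ⟨l, hl⟩ := h.exact n (z - ev G (M.d m n) y) (by rw [map_sub, ← ev_d, hy, sub_self])
    have hl0 (r) : ev G (L.d n r) l = 0 := h.inj _ _ (by
      rw [← ev_d, hl, map_sub, hz, ev_d_d, sub_zero])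
    have h1 : ev G (b.f n) (ev G (i.f n) l) = ev G (M'.d m n) (w - ev G (b.f m) y) := by
      rw [hl, map_sub, map_sub, hw, ev_d]
    have h2 (r) : ev G (N'.d m r) (ev G (p'.f m) (w - ev G (b.f m) y)) = 0 := by
      by_cases hr : m + 1 = r
      · obtain rfl : r = n := by lia
        rw [ev_d, ← h1, ev_f e, h'.zero_apply]
      · rw [N'.shape _ _ hr, ev_zero]
    -- The class of `l` maps to zero in `L'` only after subtracting the image `l1` of a cocycle `n1`
    -- of `N` under the connecting homomorphism.
    obtain ⟨n1, hn1, n2, hn2⟩ := hc.surj (m - 1) m (by lia) _ h2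
    obtain ⟨m1, rfl⟩ := h.surj _ n1
    obtain ⟨m2, rfl⟩ := h'.surj _ n2
    obtain ⟨l', hl'⟩ := h'.exact m (w - ev G (b.f m) y - ev G (b.f m) m1 -
      ev G (M'.d (m - 1) m) m2) (by
        rw [map_sub, map_sub _ (w - _), ← hn2, ← ev_d, ← ev_f e']; abel)
    obtain ⟨l1, hl1⟩ := h.exact n (ev G (M.d m n) m1) (by rw [← ev_d, hn1])
    have hl1' (r) : ev G (L.d n r) l1 = 0 := h.inj _ _ (by rw [← ev_d, hl1, ev_d_d])
    have h3 : ev G (i'.f n) (ev G (a.f n) (l - l1)) = ev G (i'.f n) (ev G (L'.d m n) l') := by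
      rw [← ev_f e, map_sub, map_sub, h1, hl1, ← ev_d, ← ev_d, hl']
      simp only [map_sub, ev_d_d]
      abel
    obtain ⟨l2, hl2⟩ := ha.inj m n hmn (l - l1) (fun r => by rw [map_sub, hl0, hl1', sub_zero]) l'
      (h'.inj' h3)
    refine ⟨y + m1 + ev G (i.f m) l2, ?_⟩
    rw [map_add, map_add, ev_d (φ := i), hl2, map_sub, hl, hl1]
    abel
  · intro m n hmn z hz
    obtain ⟨x, hx, w, hw⟩ := hc.surj m n hmn (ev G (p'.f n) z) (fun r => by
      rw [ev_d, hz, map_zero])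
    obtain ⟨x, rfl⟩ := h.surj _ x
    obtain ⟨w, rfl⟩ := h'.surj _ w
    obtain ⟨l', hl'⟩ := h'.exact n (z - ev G (b.f n) x - ev G (M'.d m n) w) (by
      rw [map_sub, map_sub, ← hw, ← ev_d, ev_f e']; abel)
    -- The boundary of the lift `x` lies in `L` and bounds there, since its image in `L'` does.
    obtain ⟨l, hl⟩ := h.exact (n + 1) (ev G (M.d n (n + 1)) x) (by rw [← ev_d, hx])
    have hl0 (r) : ev G (L.d (n + 1) r) l = 0 := h.inj _ _ (by
      rw [← ev_d, hl, ev_d_d])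
    have h1 : ev G (i'.f (n + 1)) (ev G (a.f (n + 1)) l) =
        ev G (i'.f (n + 1)) (ev G (L'.d n (n + 1)) (-l')) := by
      rw [← ev_f e, hl, map_neg, map_neg, ← ev_d i', hl', ← ev_d]
      simp only [map_sub, ev_d_d, hz]
      abel
    obtain ⟨y, hy⟩ := ha.inj n (n + 1) rfl l hl0 (-l') (h'.inj' h1)
    have hx' (r) : ev G (M.d n r) (x - ev G (i.f n) y) = 0 := by
      by_cases hr : n + 1 = r
      · subst hr
        rw [map_sub, ev_d, hy, hl, sub_self]
      · rw [M.shape _ _ hr, ev_zero]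
    have h2 : ev G (i'.f n) (l' + ev G (a.f n) y) =
        z - ev G (M'.d m n) w - ev G (b.f n) (x - ev G (i.f n) y) := by
      rw [map_add, hl', ← ev_f e, map_sub]
      abel
    obtain ⟨y2, hy2, w2, hw2⟩ := ha.surj m n hmn (l' + ev G (a.f n) y) (fun r => h'.inj _ _ (by
      rw [← ev_d, h2, map_sub, map_sub, hz, ev_d_d, ev_d, hx', map_zero, sub_zero, sub_zero]))
    refine ⟨x - ev G (i.f n) y + ev G (i.f n) y2, fun r => ?_, w + ev G (i'.f m) w2, ?_⟩
    · rw [map_add, hx', ev_d, hy2, map_zero, add_zero]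
    · rw [← hw2, map_add, ← ev_f e, ← ev_d, eq_sub_iff_add_eq, eq_sub_iff_add_eq] at h2
      rw [← h2, map_add, map_add]
      abel

/-- The sign in the differential of the shifted complex does not affect cocycles or coboundaries. -/
theorem QIso.shift {φ : K ⟶ L} (h : QIso G φ) (n : ℤ) : QIso G (φ⟦n⟧') := by
  obtain ⟨ε, hε, hd⟩ : ∃ ε : ℤ, ε * ε = 1 ∧ ∀ (K : CochainComplex C ℤ) (p q : ℤ)
      (z : G.obj (K.X (p + n))),
      ev G ((K⟦n⟧).d p q) z = ev G (K.d (p + n) (q + n)) (ε • z) := by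
    rcases Int.even_or_odd n with hn | hn
    · refine ⟨1, rfl, fun K p q z => ?_⟩
      rw [one_smul, CochainComplex.shiftFunctor_obj_d', Int.negOnePow_even _ hn, one_smul]
      rfl
    · refine ⟨-1, rfl, fun K p q z => ?_⟩
      rw [neg_one_smul, CochainComplex.shiftFunctor_obj_d', Int.negOnePow_odd _ hn, Units.neg_smul,
        one_smul, map_neg]
      exact ev_neg G _ _
  have hεε {A : Type w} [AddCommGroup A] (z : A) : ε • ε • z = z := by
    rw [smul_smul, hε, one_smul]
  have hc (K : CochainComplex C ℤ) (p : ℤ) (z : G.obj (K.X (p + n))) :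
      (∀ r, ev G ((K⟦n⟧).d p r) z = 0) ↔ ∀ r, ev G (K.d (p + n) r) z = 0 := by
    constructor
    · intro hz r
      obtain ⟨r, rfl⟩ : ∃ s, r = s + n := ⟨r - n, by lia⟩
      have h1 : ev G (K.d (p + n) (r + n)) (ε • z) = 0 := (hd K p r z).symm.trans (hz r)
      rw [← hεε (ev G (K.d (p + n) (r + n)) z), ← map_zsmul, h1, smul_zero]
    · intro hz r
      refine (hd K p r z).trans ?_
      rw [map_zsmul, hz, smul_zero]
      rfl
  constructor
  · intro p q hpq z hz w hw
    obtain ⟨y, hy⟩ := h.inj (p + n) (q + n) (by lia) z ((hc K q z).1 hz) (ε • w)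
      (hw.trans (hd L p q w))
    exact ⟨(ε • y : G.obj (K.X (p + n))), (hd K p q _).trans (by rw [hεε, hy])⟩
  · intro p q hpq z hz
    obtain ⟨y, hy, w, hw⟩ := h.surj (p + n) (q + n) (by lia) z ((hc L q z).1 hz)
    refine ⟨y, (hc K q y).2 hy, (ε • w : G.obj (L.X (p + n))), ?_⟩
    refine Eq.trans ?_ hw
    exact congrArg (ev G (φ.f (q + n)) y + ·) ((hd L p q _).trans (by rw [hεε]))

omit [G.Additive] in
theorem QIso.of_bijective {φ : K ⟶ L} (h : ∀ n, Function.Bijective (ev G (φ.f n))) : QIso G φ := by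
  constructor
  · intro p q hpq z hz w hw
    obtain ⟨w, rfl⟩ := (h p).2 w
    exact ⟨w, (h q).1 (by rw [hw, ev_d])⟩
  · intro p q hpq z hz
    obtain ⟨z, rfl⟩ := (h q).2 z
    exact ⟨z, fun r => (h r).1 (by rw [← ev_d, hz, map_zero]), 0, by simp⟩

section Cocone

open CochainComplex

variable [HasBinaryBiproducts C]

omit [HasBinaryBiproducts C] in
theorem neg_units_smul {A : Type*} [AddCommGroup A] {ε : ℤˣ} (h : ε = -1) (x : A) :
    -(ε • x) = x := by
  rw [h, Units.neg_smul, one_smul, neg_neg]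

theorem mappingCocone_fst_f (φ : K ⟶ L) (p : ℤ) : (mappingCocone.fst φ).f p =
    (mappingCone.fst φ).1.v (p + -1) p (by lia) := by
  have h : (mappingCocone.fst φ).f p = -_ := congrArg (- ·)
    (HomComplex.Cochain.leftShift_v (mappingCone.fst φ).1 (-1) 0 (add_neg_cancel 1) p p
      (add_zero p) (p + -1) (by lia))
  exact h.trans ((neg_units_smul (Int.negOnePow_odd _ (by decide)) _).trans (Category.id_comp _))

theorem mappingCocone_snd_v (φ : K ⟶ L) (p : ℤ) :
    (mappingCocone.snd φ).v p (p + -1) rfl =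
      (mappingCone.snd φ).v (p + -1) (p + -1) (by lia) := by
  refine (HomComplex.Cochain.leftShift_v (mappingCone.snd φ) (-1) (-1) (zero_add _) p (p + -1)
    rfl (p + -1) (add_zero _)).trans ?_
  refine (congrArg (· • _) (Int.negOnePow_even _ (by decide))).trans ((one_smul _ _).trans ?_)
  exact Category.id_comp _

theorem mappingCocone_inr_v (φ : K ⟶ L) (p : ℤ) :
    (mappingCocone.inr φ).1.v (p + -1) p (by lia) =
      (mappingCone.inr φ).f (p + -1) := by
  refine (HomComplex.Cochain.rightShift_v (HomComplex.Cochain.ofHom (mappingCone.inr φ)) (-1) 1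
    (by lia) (p + -1) p (by lia) (p + -1) (add_zero _)).trans ?_
  exact (Category.comp_id _).trans (HomComplex.Cochain.ofHom_v _ _)

/-- The differential of the mapping cocone is `(x, y) ↦ (d x, -(φ x + d y))`. -/
theorem mappingCocone_d_snd (φ : K ⟶ L) (p p' q : ℤ) (h : p + 1 = p') (h' : p + -1 = q) :
    (mappingCocone φ).d p p' ≫ (mappingCocone.snd φ).v p' p (by lia) =
      -((mappingCocone.fst φ).f p ≫ φ.f p + (mappingCocone.snd φ).v p q h' ≫ L.d q p) := by
  subst h'
  obtain rfl : p = p' + -1 := by lia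
  rw [mappingCocone_snd_v, mappingCocone_snd_v, mappingCocone_fst_f]
  have hd : -((mappingCocone φ).d (p' + -1) p') =
      (mappingCone φ).d (p' + -1 + -1) (p' + -1) :=
    neg_units_smul (Int.negOnePow_odd (-1) (by decide)) _
  have key := mappingCone.d_snd_v φ (p' + -1 + -1) (p' + -1) (by lia)
  refine Eq.trans ?_ (congrArg (- ·) key)
  rw [← hd]
  exact (congrArg (· ≫ _) (neg_neg _).symm).trans (Preadditive.neg_comp _ _)

/-- The canonical morphism from the shifted target to the mapping cocone. -/
def coconeInr (φ : K ⟶ L) : L⟦(-1 : ℤ)⟧ ⟶ mappingCocone φ := (mappingCone.inr φ)⟦(-1 : ℤ)⟧'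

/-- The mapping cocone of `φ : K ⟶ L` is an extension of `K` by the shift of `L`. -/
theorem gExact_cocone (φ : K ⟶ L) : GExact G (coconeInr φ) (mappingCocone.fst φ) where
  zero := by
    ext n
    refine Eq.trans ?_ (mappingCone.inr_f_fst_v φ (n + -1) n (by lia))
    exact congr($(rfl) ≫ $(mappingCocone_fst_f φ n))
  inj n z hz := by
    have h1 : (mappingCone.inr φ).f (n + -1) ≫ (mappingCone.snd φ).v (n + -1) (n + -1) (by lia) =
      𝟙 _ := by simp
    have h2 := (ev_comp G h1 z).trans (ev_id G _ _)
    refine h2.symm.trans ?_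
    refine Eq.trans ?_ (map_zero (ev G ((mappingCone.snd φ).v (n + -1) (n + -1) (by lia))))
    exact congrArg _ hz
  exact n z hz := by
    have h1 := congr(ev G $(mappingCocone.id_X φ n (n + -1) rfl) z)
    rw [ev_id, ev_add, ← ev_comp G rfl, hz, map_zero, zero_add, ← ev_comp G rfl,
      mappingCocone_inr_v] at h1
    exact ⟨_, h1⟩
  surj n z := ⟨ev G ((mappingCocone.inl φ).v n n (by lia)) z, by
    rw [ev_comp G (mappingCocone.inl_v_fst_f φ n), ev_id]⟩

/-- Functoriality of the mapping cocone. -/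
def coconeMap (φ : K ⟶ L) (φ' : K' ⟶ L') (a : K ⟶ K') (b : L ⟶ L') (h : φ ≫ b = a ≫ φ') :
    mappingCocone φ ⟶ mappingCocone φ' := (mappingCone.map φ φ' a b h)⟦(-1 : ℤ)⟧'

theorem coconeMap_fst (φ : K ⟶ L) (φ' : K' ⟶ L') (a : K ⟶ K') (b : L ⟶ L') (h : φ ≫ b = a ≫ φ') :
    coconeMap φ φ' a b h ≫ mappingCocone.fst φ' = mappingCocone.fst φ ≫ a := by
  ext n
  have h1 : (mappingCone.map φ φ' a b h).f (n + -1) ≫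
      (mappingCone.fst φ').1.v (n + -1) n (by lia) =
        (mappingCone.fst φ).1.v (n + -1) n (by lia) ≫ a.f n := by
    simp [mappingCone.map, mappingCone.ext_from_iff _ n (n + -1) (by lia)]
  rw [HomologicalComplex.comp_f, HomologicalComplex.comp_f, mappingCocone_fst_f,
    mappingCocone_fst_f]
  exact h1

theorem coconeMap_snd (φ : K ⟶ L) (φ' : K' ⟶ L') (a : K ⟶ K') (b : L ⟶ L') (h : φ ≫ b = a ≫ φ')
    (p q : ℤ) (hpq : p + -1 = q) :
    (coconeMap φ φ' a b h).f p ≫ (mappingCocone.snd φ').v p q hpq =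
      (mappingCocone.snd φ).v p q hpq ≫ b.f q := by
  subst hpq
  have h1 : (mappingCone.map φ φ' a b h).f (p + -1) ≫
      (mappingCone.snd φ').v (p + -1) (p + -1) (by lia) =
        (mappingCone.snd φ).v (p + -1) (p + -1) (by lia) ≫ b.f (p + -1) := by
    simp [mappingCone.map, mappingCone.ext_from_iff _ p (p + -1) (by lia)]
  rw [mappingCocone_snd_v, mappingCocone_snd_v]
  exact h1

theorem coconeInr_coconeMap (φ : K ⟶ L) (φ' : K' ⟶ L') (a : K ⟶ K') (b : L ⟶ L')
    (h : φ ≫ b = a ≫ φ') :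
    coconeInr φ ≫ coconeMap φ φ' a b h = b⟦(-1 : ℤ)⟧' ≫ coconeInr φ' := by
  have : mappingCone.inr φ ≫ mappingCone.map φ φ' a b h = b ≫ mappingCone.inr φ' := by
    simp [mappingCone.map]
  refine ((CategoryTheory.shiftFunctor _ (-1 : ℤ)).map_comp _ _).symm.trans ?_
  rw [this]
  exact (CategoryTheory.shiftFunctor _ (-1 : ℤ)).map_comp _ _

theorem cocone_hom_ext (φ : K ⟶ L) {f g : M ⟶ mappingCocone φ}
    (h : f ≫ mappingCocone.fst φ = g ≫ mappingCocone.fst φ)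
    (h' : ∀ p, f.f p ≫ (mappingCocone.snd φ).v p (p + -1) rfl =
      g.f p ≫ (mappingCocone.snd φ).v p (p + -1) rfl) : f = g := by
  ext p
  rw [← Category.comp_id (f.f p), ← Category.comp_id (g.f p), ← mappingCocone.id_X φ p _ rfl,
    Preadditive.comp_add, Preadditive.comp_add, ← Category.assoc, ← Category.assoc,
    ← Category.assoc, ← Category.assoc, h', ← HomologicalComplex.comp_f,
    ← HomologicalComplex.comp_f, h]

theorem QIso.coconeMap {φ : K ⟶ L} {φ' : K' ⟶ L'} {a : K ⟶ K'} {b : L ⟶ L'} (ha : QIso G a)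
    (hb : QIso G b) (h : φ ≫ b = a ≫ φ') : QIso G (coconeMap φ φ' a b h) :=
  (hb.shift (-1)).of_gExact (gExact_cocone φ) (gExact_cocone φ')
    (coconeInr_coconeMap φ φ' a b h) (coconeMap_fst φ φ' a b h).symm ha

theorem cocone_decomp (φ : K ⟶ L) (p q : ℤ) (h : p + -1 = q) (z : G.obj ((mappingCocone φ).X p)) :
    ev G ((mappingCocone.inl φ).v p p (by lia)) (ev G ((mappingCocone.fst φ).f p) z) +
      ev G ((mappingCocone.inr φ).1.v q p (by lia)) (ev G ((mappingCocone.snd φ).v p q h) z) =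
        z := by
  have h1 := congr(ev G $(mappingCocone.id_X φ p q h) z)
  rwa [ev_id, ev_add, ← ev_comp G rfl, ← ev_comp G rfl] at h1

theorem cocone_ext (φ : K ⟶ L) (p q : ℤ) (h : p + -1 = q) {z w : G.obj ((mappingCocone φ).X p)}
    (h1 : ev G ((mappingCocone.fst φ).f p) z = ev G ((mappingCocone.fst φ).f p) w)
    (h2 : ev G ((mappingCocone.snd φ).v p q h) z = ev G ((mappingCocone.snd φ).v p q h) w) :
    z = w := by
  rw [← cocone_decomp φ p q h z, ← cocone_decomp φ p q h w, h1, h2]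

/-- An element of the mapping cocone is determined by its two components, which are arbitrary; this
is the existence part. -/
theorem cocone_mk (φ : K ⟶ L) (p q : ℤ) (h : p + -1 = q) (x : G.obj (K.X p)) (y : G.obj (L.X q)) :
    ∃ z, ev G ((mappingCocone.fst φ).f p) z = x ∧ ev G ((mappingCocone.snd φ).v p q h) z = y := by
  refine ⟨ev G ((mappingCocone.inl φ).v p p (by lia)) x +
    ev G ((mappingCocone.inr φ).1.v q p (by lia)) y, ?_, ?_⟩
  · rw [map_add, ev_comp G (mappingCocone.inl_v_fst_f φ p),
      ev_comp G (mappingCocone.inr_v_fst_f φ q p (by lia)), ev_id, ev_zero, add_zero]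
  · rw [map_add, ev_comp G (mappingCocone.inl_v_snd_v φ p q h),
      ev_comp G (mappingCocone.inr_v_snd_v φ q p (by lia)), ev_id, ev_zero, zero_add]

theorem cocone_snd_d (φ : K ⟶ L) (p p' q : ℤ) (h : p + 1 = p') (h' : p + -1 = q)
    (z : G.obj ((mappingCocone φ).X p)) :
    ev G ((mappingCocone.snd φ).v p' p (by lia)) (ev G ((mappingCocone φ).d p p') z) =
      -(ev G (φ.f p) (ev G ((mappingCocone.fst φ).f p) z) +
        ev G (L.d q p) (ev G ((mappingCocone.snd φ).v p q h') z)) := by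
  rw [ev_comp G (mappingCocone_d_snd φ p p' q h h'), ev_neg, ev_add, ← ev_comp G rfl,
    ← ev_comp G rfl]

/-- The mapping cocone preserves exactness. -/
theorem GExact.cocone {K₁ K₂ K₃ L₁ L₂ L₃ : CochainComplex C ℤ} {φ₁ : K₁ ⟶ L₁} {φ₂ : K₂ ⟶ L₂}
    {φ₃ : K₃ ⟶ L₃} {i : K₁ ⟶ K₂} {p : K₂ ⟶ K₃} {j : L₁ ⟶ L₂} {q : L₂ ⟶ L₃} (hK : GExact G i p)
    (hL : GExact G j q) (h : φ₁ ≫ j = i ≫ φ₂) (h' : φ₂ ≫ q = p ≫ φ₃) :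
    GExact G (coconeMap φ₁ φ₂ i j h) (coconeMap φ₂ φ₃ p q h') := by
  have e1 (n) (z : G.obj ((mappingCocone φ₁).X n)) := ev_f (coconeMap_fst φ₁ φ₂ i j h) n z
  have e2 (n) (z : G.obj ((mappingCocone φ₂).X n)) := ev_f (coconeMap_fst φ₂ φ₃ p q h') n z
  have s1 (n) (z : G.obj ((mappingCocone φ₁).X n)) :=
    ev_comm G (coconeMap_snd φ₁ φ₂ i j h n _ rfl) z
  have s2 (n) (z : G.obj ((mappingCocone φ₂).X n)) :=
    ev_comm G (coconeMap_snd φ₂ φ₃ p q h' n _ rfl) z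
  refine ⟨?_, ?_, ?_, ?_⟩
  · refine cocone_hom_ext _ ?_ fun n => ?_
    · rw [Category.assoc, coconeMap_fst, ← Category.assoc, coconeMap_fst, Category.assoc, hK.zero]
      simp
    · rw [HomologicalComplex.comp_f, Category.assoc, coconeMap_snd, ← Category.assoc,
        coconeMap_snd, Category.assoc, ← HomologicalComplex.comp_f, hL.zero]
      simp
  · intro n z hz
    refine cocone_ext _ n _ rfl (hK.inj' ?_) (hL.inj' ?_)
    · rw [← e1, hz]; simp
    · rw [← s1, hz]; simp
  · intro n z hz
    obtain ⟨x, hx⟩ := hK.exact n _ (by rw [← e2, hz, map_zero])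
    obtain ⟨y, hy⟩ := hL.exact _ _ (by rw [← s2, hz, map_zero])
    obtain ⟨w, rfl, rfl⟩ := cocone_mk φ₁ n _ rfl x y
    exact ⟨w, cocone_ext _ n _ rfl (by rw [e1, hx]) (by rw [s1, hy])⟩
  · intro n z
    obtain ⟨x, hx⟩ := hK.surj n (ev G ((mappingCocone.fst φ₃).f n) z)
    obtain ⟨y, hy⟩ := hL.surj _ (ev G ((mappingCocone.snd φ₃).v n _ rfl) z)
    obtain ⟨w, rfl, rfl⟩ := cocone_mk φ₂ n _ rfl x y
    exact ⟨w, cocone_ext _ n _ rfl (by rw [e2, hx]) (by rw [s2, hy])⟩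

/-- The lift to a mapping cocone of a chain map which composes to zero. -/
def coconeLift (φ : K ⟶ L) (a : M ⟶ K) (h : a ≫ φ = 0) : M ⟶ mappingCocone φ :=
  mappingCocone.lift φ a 0 (by simp [h])

theorem coconeLift_fst (φ : K ⟶ L) (a : M ⟶ K) (h : a ≫ φ = 0) :
    coconeLift φ a h ≫ mappingCocone.fst φ = a := by
  simp [coconeLift]

theorem coconeLift_snd (φ : K ⟶ L) (a : M ⟶ K) (h : a ≫ φ = 0) (p q : ℤ) (hpq : p + -1 = q) :
    (coconeLift φ a h).f p ≫ (mappingCocone.snd φ).v p q hpq = 0 := by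
  simp [coconeLift]

/-- If `A ⟶ K ⟶ B` is exact and `A ⟶ L`, `M ⟶ B` are quasi-isomorphisms, then so is the lift of
`M ⟶ K` to the cocone of `K ⟶ L`. -/
theorem QIso.coconeLift {A B : CochainComplex C ℤ} {i : A ⟶ K} {p : K ⟶ B} (hK : GExact G i p)
    {φ : K ⟶ L} {a : M ⟶ K} (h : a ≫ φ = 0) (h1 : QIso G (i ≫ φ)) (h2 : QIso G (a ≫ p)) :
    QIso G (coconeLift φ a h) := by
  have e1 (n) (z : G.obj (M.X n)) :
      ev G ((mappingCocone.fst φ).f n) (ev G ((CartierSheaves.coconeLift φ a h).f n) z) =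
        ev G (a.f n) z := ev_comp G congr($(coconeLift_fst φ a h).f n) z
  have s1 (n q hnq) (z : G.obj (M.X n)) := ev_comp G (coconeLift_snd φ a h n q hnq) z
  have ap (n) (z : G.obj (M.X n)) :
    ev G ((a ≫ p).f n) z = ev G (p.f n) (ev G (a.f n) z) := (ev_comp G rfl z).symm
  have iφ (n) (z : G.obj (A.X n)) :
    ev G ((i ≫ φ).f n) z = ev G (φ.f n) (ev G (i.f n) z) := (ev_comp G rfl z).symm
  have aφ (n) (z : G.obj (M.X n)) : ev G (φ.f n) (ev G (a.f n) z) = 0 := by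
    rw [ev_comp G congr($(h).f n)]
    exact ev_zero G _ _ _
  constructor
  · intro m n hmn z hz w hw
    refine h2.inj m n hmn z hz (ev G (p.f m) (ev G ((mappingCocone.fst φ).f m) w)) ?_
    rw [ap, ← e1, hw, ev_d, ev_d]
  · intro m n hmn z hz
    have hnm : n + -1 = m := by omega
    have hs := cocone_snd_d φ n (n + 1) m rfl hnm z
    rw [hz, map_zero, eq_comm, neg_eq_zero] at hs
    obtain ⟨x, hx⟩ : ∃ x, x = ev G ((mappingCocone.fst φ).f n) z := ⟨_, rfl⟩
    obtain ⟨s, hs'⟩ : ∃ s, s = ev G ((mappingCocone.snd φ).v n m hnm) z := ⟨_, rfl⟩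
    have hxc (r) : ev G (K.d n r) x = 0 := by rw [hx, ev_d, hz, map_zero]
    rw [← hx, ← hs'] at hs
    obtain ⟨y, hy, t, ht⟩ := h2.surj m n hmn (ev G (p.f n) x) (fun r => by
      rw [ev_d, hxc, map_zero])
    obtain ⟨t, rfl⟩ := hK.surj _ t
    obtain ⟨v, hv⟩ := hK.exact n (x - ev G (a.f n) y - ev G (K.d m n) t) (by
      rw [map_sub, map_sub, ← ht, ap, ← ev_d]; abel)
    have hv0 (r) : ev G (A.d n r) v = 0 := hK.inj _ _ (by
      rw [← ev_d, hv, map_sub, map_sub, hxc, ev_d, hy, ev_d_d, map_zero]; simp)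
    obtain ⟨v1, hv1⟩ := h1.inj m n hmn v hv0 (-(s + ev G (φ.f m) t)) (by
      rw [iφ, hv, map_sub, map_sub, aφ, ← ev_d, eq_neg_of_add_eq_zero_left hs, map_neg, map_add]
      abel)
    obtain ⟨v2, hv2, s2, hs2⟩ := h1.surj (m - 1) m (by omega)
      (s + ev G (φ.f m) t + ev G (φ.f m) (ev G (i.f m) v1)) (fun r => by
        by_cases hr : m + 1 = r
        · obtain rfl : r = n := by omega
          rw [map_add, map_add, ev_d, ev_d, ev_d, hv1, hv, ← hs, map_sub, map_sub, aφ]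
          abel
        · rw [L.shape _ _ hr, ev_zero])
    obtain ⟨w, hw1, hw2⟩ := cocone_mk φ m (m - 1) (by omega)
      (t + ev G (i.f m) v1 - ev G (i.f m) v2) (-s2)
    refine ⟨y, hy, w, cocone_ext φ n m hnm ?_ ?_⟩
    · rw [map_add, e1, ← ev_d, hw1, map_sub, map_add, ev_d i, hv1, hv, ev_d i, hv2, ← hx, map_zero]
      abel
    · rw [map_add, s1, cocone_snd_d φ m n (m - 1) hmn (by omega), hw1, hw2, ← hs', ev_zero, map_sub,
        map_add, map_neg]
      rw [iφ, ← eq_sub_iff_add_eq'] at hs2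
      rw [hs2]
      abel

theorem gExact_biprod (K L : CochainComplex C ℤ) :
    GExact G (biprod.inl : K ⟶ K ⊞ L) biprod.snd where
  zero := by simp
  inj n z hz := by
    have := ev_comp G congr($(biprod.inl_fst (X := K) (Y := L)).f n) z
    rw [hz, map_zero] at this
    exact (this.trans (ev_id G _ _)).symm
  exact n z hz := by
    refine ⟨ev G ((biprod.fst : K ⊞ L ⟶ K).f n) z, ?_⟩
    have h := congr(ev G $(congr($(biprod.total (X := K) (Y := L)).f n)) z)
    rw [HomologicalComplex.add_f_apply, ev_add, HomologicalComplex.comp_f,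
      HomologicalComplex.comp_f, ← ev_comp G rfl, ← ev_comp G rfl, hz, map_zero, add_zero] at h
    exact h.trans (ev_id G _ _)
  surj n z := ⟨ev G ((biprod.inr : L ⟶ K ⊞ L).f n) z,
    (ev_comp G congr($(biprod.inr_snd (X := K) (Y := L)).f n) z).trans (ev_id G _ _)⟩

theorem gExact_biprod' (K L : CochainComplex C ℤ) :
    GExact G (biprod.inr : L ⟶ K ⊞ L) biprod.fst where
  zero := by simp
  inj n z hz := by
    have := ev_comp G congr($(biprod.inr_snd (X := K) (Y := L)).f n) z
    rw [hz, map_zero] at this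
    exact (this.trans (ev_id G _ _)).symm
  exact n z hz := by
    refine ⟨ev G ((biprod.snd : K ⊞ L ⟶ L).f n) z, ?_⟩
    have h := congr(ev G $(congr($(biprod.total (X := K) (Y := L)).f n)) z)
    rw [HomologicalComplex.add_f_apply, ev_add, HomologicalComplex.comp_f,
      HomologicalComplex.comp_f, ← ev_comp G rfl, ← ev_comp G rfl, hz, map_zero, zero_add] at h
    exact h.trans (ev_id G _ _)
  surj n z := ⟨ev G ((biprod.inl : K ⟶ K ⊞ L).f n) z,
    (ev_comp G congr($(biprod.inl_fst (X := K) (Y := L)).f n) z).trans (ev_id G _ _)⟩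

theorem QIso.biprodMap {a : K ⟶ K'} {b : L ⟶ L'} (ha : QIso G a) (hb : QIso G b) :
    QIso G (biprod.map a b) :=
  ha.of_gExact (gExact_biprod K L) (gExact_biprod K' L') (by simp) (by simp) hb

theorem biprod_ext {n : ℤ} {z w : G.obj ((K ⊞ L).X n)}
    (h1 : ev G ((biprod.fst : K ⊞ L ⟶ K).f n) z = ev G ((biprod.fst : K ⊞ L ⟶ K).f n) w)
    (h2 : ev G ((biprod.snd : K ⊞ L ⟶ L).f n) z = ev G ((biprod.snd : K ⊞ L ⟶ L).f n) w) :
    z = w := by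
  obtain ⟨y, hy⟩ := (gExact_biprod K L).exact n (z - w) (by rw [map_sub, h2, sub_self])
  have h3 : y = 0 := by
    refine ((ev_comp G congr($(biprod.inl_fst (X := K) (Y := L)).f n) y).trans
      (ev_id G _ _)).symm.trans ?_
    rw [hy, map_sub, h1, sub_self]
  rw [h3, map_zero, eq_comm, sub_eq_zero] at hy
  exact hy

theorem biprod_mk {n : ℤ} (x : G.obj (K.X n)) (y : G.obj (L.X n)) : ∃ z,
    ev G ((biprod.fst : K ⊞ L ⟶ K).f n) z = x ∧ ev G ((biprod.snd : K ⊞ L ⟶ L).f n) z = y := by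
  refine ⟨ev G ((biprod.inl : K ⟶ K ⊞ L).f n) x + ev G ((biprod.inr : L ⟶ K ⊞ L).f n) y, ?_, ?_⟩
  · rw [map_add, (gExact_biprod' K L).zero_apply, add_zero]
    exact (ev_comp G congr($(biprod.inl_fst (X := K) (Y := L)).f n) x).trans (ev_id G _ _)
  · rw [map_add, (gExact_biprod K L).zero_apply, zero_add]
    exact (ev_comp G congr($(biprod.inr_snd (X := K) (Y := L)).f n) y).trans (ev_id G _ _)

theorem GExact.biprodMap {K₁ K₂ K₃ L₁ L₂ L₃ : CochainComplex C ℤ} {i : K₁ ⟶ K₂} {p : K₂ ⟶ K₃}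
    {j : L₁ ⟶ L₂} {q : L₂ ⟶ L₃} (hK : GExact G i p) (hL : GExact G j q) :
    GExact G (biprod.map i j) (biprod.map p q) := by
  have e1 (n) (z : G.obj ((K₁ ⊞ L₁).X n)) := ev_f (biprod.map_fst i j) n z
  have e2 (n) (z : G.obj ((K₂ ⊞ L₂).X n)) := ev_f (biprod.map_fst p q) n z
  have s1 (n) (z : G.obj ((K₁ ⊞ L₁).X n)) := ev_f (biprod.map_snd i j) n z
  have s2 (n) (z : G.obj ((K₂ ⊞ L₂).X n)) := ev_f (biprod.map_snd p q) n z
  refine ⟨?_, ?_, ?_, ?_⟩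
  · apply biprod.hom_ext <;> simp [hK.zero, hL.zero]
  · intro n z hz
    refine biprod_ext (hK.inj' ?_) (hL.inj' ?_)
    · rw [← e1, hz]; simp
    · rw [← s1, hz]; simp
  · intro n z hz
    obtain ⟨x, hx⟩ := hK.exact n _ (by rw [← e2, hz, map_zero])
    obtain ⟨y, hy⟩ := hL.exact _ _ (by rw [← s2, hz, map_zero])
    obtain ⟨w, rfl, rfl⟩ := biprod_mk x y
    exact ⟨w, biprod_ext (by rw [e1, hx]) (by rw [s1, hy])⟩
  · intro n z
    obtain ⟨x, hx⟩ := hK.surj n (ev G ((biprod.fst : K₃ ⊞ L₃ ⟶ _).f n) z)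
    obtain ⟨y, hy⟩ := hL.surj _ (ev G ((biprod.snd : K₃ ⊞ L₃ ⟶ _).f n) z)
    obtain ⟨w, rfl, rfl⟩ := biprod_mk x y
    exact ⟨w, biprod_ext (by rw [e2, hx]) (by rw [s2, hy])⟩

end Cocone

end Probes

end CartierSheaves

/-! ### Čech complexes of coaugmented endofunctors, and right derived functors -/

namespace CartierSheaves

section Cech

universe w v' u'
variable {C : Type u'} [Category.{v'} C] [Preadditive C]

/-- The functor induced on complexes by an additive endofunctor. -/
abbrev onComplexes (T : C ⥤ C) [T.Additive] : CochainComplex C ℤ ⥤ CochainComplex C ℤ :=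
  T.mapHomologicalComplex (ComplexShape.up ℤ)

/-- The natural transformation induced on complexes by a coaugmentation `𝟭 ⟶ T`. -/
def unitOnComplexes {T : C ⥤ C} [T.Additive] (u : 𝟭 C ⟶ T) :
    𝟭 (CochainComplex C ℤ) ⟶ onComplexes T where
  app K :=
    { f n := u.app (K.X n)
      comm' _ _ _ := (u.naturality _).symm }
  naturality _ _ f := by
    ext n
    exact u.naturality _

section

variable {G : C ⥤ AddCommGrpCat.{w}} [G.Additive] (T : C ⥤ C) [T.Additive]
  {K L M : CochainComplex C ℤ}

omit [G.Additive] in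
theorem QIso.onComplexes {φ : K ⟶ L} (h : QIso (T ⋙ G) φ) :
    QIso G ((onComplexes T).map φ) := ⟨h.inj, h.surj⟩

omit [G.Additive] in
theorem GExact.onComplexes {i : K ⟶ L} {p : L ⟶ M} (h : GExact (T ⋙ G) i p) :
    GExact G ((onComplexes T).map i) ((onComplexes T).map p) :=
  ⟨by rw [← Functor.map_comp, h.zero, Functor.map_zero], h.inj, h.exact, h.surj⟩

end

variable [HasBinaryBiproducts C]

variable (C) in
/-- A coaugmented endofunctor of the category of complexes. -/
structure Coaugmented where
  /-- The endofunctor. -/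
  ρ : CochainComplex C ℤ ⥤ CochainComplex C ℤ
  /-- The coaugmentation. -/
  η : 𝟭 _ ⟶ ρ

namespace Coaugmented

variable {T : C ⥤ C} [T.Additive] (u : 𝟭 C ⟶ T) (R : Coaugmented C)

/-- The difference `T M ⊞ R M ⟶ T (R M)` of the two coaugmentations. -/
def diff (M : CochainComplex C ℤ) :
    (onComplexes T).obj M ⊞ R.ρ.obj M ⟶ (onComplexes T).obj (R.ρ.obj M) :=
  biprod.desc ((onComplexes T).map (R.η.app M)) (-(unitOnComplexes u).app (R.ρ.obj M))

theorem diff_naturality {M N : CochainComplex C ℤ} (f : M ⟶ N) :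
    R.diff u M ≫ (onComplexes T).map (R.ρ.map f) =
      biprod.map ((onComplexes T).map f) (R.ρ.map f) ≫ R.diff u N := by
  have h1 := (unitOnComplexes u).naturality (R.ρ.map f)
  have h2 := R.η.naturality f
  rw [Functor.id_map] at h1 h2
  apply biprod.hom_ext'
  · rw [biprod.inl_map_assoc, diff, diff, biprod.inl_desc_assoc, biprod.inl_desc,
      ← Functor.map_comp, ← Functor.map_comp, h2]
  · rw [biprod.inr_map_assoc, diff, diff, biprod.inr_desc_assoc, biprod.inr_desc,
      Preadditive.neg_comp, Preadditive.comp_neg, h1]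

theorem lift_diff (M : CochainComplex C ℤ) :
    biprod.lift ((unitOnComplexes u).app M) (R.η.app M) ≫ R.diff u M = 0 := by
  have h := (unitOnComplexes u).naturality (R.η.app M)
  rw [Functor.id_map] at h
  rw [diff, biprod.lift_desc, Preadditive.comp_neg, ← sub_eq_add_neg, sub_eq_zero]
  exact h.symm

/-- The endofunctor underlying `Coaugmented.step`. -/
def stepFunctor : CochainComplex C ℤ ⥤ CochainComplex C ℤ where
  obj M := CochainComplex.mappingCocone (R.diff u M)
  map f := coconeMap _ _ _ _ (R.diff_naturality u f)
  map_id M := by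
    refine cocone_hom_ext _ ?_ fun p => ?_
    · rw [coconeMap_fst, Category.id_comp, CategoryTheory.Functor.map_id,
        CategoryTheory.Functor.map_id]
      exact (congrArg _ (by apply biprod.hom_ext <;> simp)).trans (Category.comp_id _)
    · rw [coconeMap_snd, HomologicalComplex.id_f, Category.id_comp, CategoryTheory.Functor.map_id,
        CategoryTheory.Functor.map_id, HomologicalComplex.id_f, Category.comp_id]
  map_comp f g := by
    refine cocone_hom_ext _ ?_ fun p => ?_
    · rw [Category.assoc, coconeMap_fst, coconeMap_fst, ← Category.assoc, coconeMap_fst,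
        Category.assoc, Functor.map_comp, Functor.map_comp]
      congr 1
      apply biprod.hom_ext <;> simp
    · rw [HomologicalComplex.comp_f, Category.assoc, coconeMap_snd, coconeMap_snd,
        ← Category.assoc, coconeMap_snd, Category.assoc, Functor.map_comp, Functor.map_comp,
        HomologicalComplex.comp_f]

theorem coconeLift_naturality {M N : CochainComplex C ℤ} (f : M ⟶ N) :
    f ≫ coconeLift _ _ (R.lift_diff u N) =
      coconeLift _ _ (R.lift_diff u M) ≫ coconeMap _ _ _ _ (R.diff_naturality u f) := by
  have h1 := (unitOnComplexes u).naturality f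
  have h2 := R.η.naturality f
  rw [Functor.id_map] at h1 h2
  refine cocone_hom_ext _ ?_ fun p => ?_
  · rw [Category.assoc, Category.assoc, coconeLift_fst, coconeMap_fst,
      ← Category.assoc, coconeLift_fst]
    apply biprod.hom_ext
    · rw [Category.assoc, biprod.lift_fst, Category.assoc, biprod.map_fst, biprod.lift_fst_assoc,
        h1]
    · rw [Category.assoc, biprod.lift_snd, Category.assoc, biprod.map_snd, biprod.lift_snd_assoc,
        h2]
  · rw [HomologicalComplex.comp_f, Category.assoc, coconeLift_snd,
      HomologicalComplex.comp_f, Category.assoc, coconeMap_snd, ← Category.assoc,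
      coconeLift_snd, comp_zero, zero_comp]

/-- The homotopy pullback of `T` and `R` over `T ∘ R`. If `T` and `R` are the Čech complexes of two
families of open subsets, this is the Čech complex of the union of both families
(Mayer-Vietoris). -/
def step : Coaugmented C where
  ρ := R.stepFunctor u
  η :=
    { app M := coconeLift _ _ (R.lift_diff u M)
      naturality _ _ f := R.coconeLift_naturality u f }

variable {R u}
variable {G : C ⥤ AddCommGrpCat.{w}} [G.Additive] {K L M : CochainComplex C ℤ}

theorem qIso_step_map {φ : K ⟶ L} (h₁ : QIso (T ⋙ G) φ) (h₂ : QIso G (R.ρ.map φ))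
    (h₃ : QIso (T ⋙ G) (R.ρ.map φ)) : QIso G ((R.step u).ρ.map φ) :=
  ((h₁.onComplexes T).biprodMap h₂).coconeMap (h₃.onComplexes T) _

theorem gExact_step_map {i : K ⟶ L} {p : L ⟶ M} (h₁ : GExact (T ⋙ G) i p)
    (h₂ : GExact G (R.ρ.map i) (R.ρ.map p)) (h₃ : GExact (T ⋙ G) (R.ρ.map i) (R.ρ.map p)) :
    GExact G ((R.step u).ρ.map i) ((R.step u).ρ.map p) :=
  ((h₁.onComplexes T).biprodMap h₂).cocone (h₃.onComplexes T) _ _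

/-- If `η : M ⟶ R M` is a quasi-isomorphism, also after applying `T`, then `T M ⟶ T (R M)` is one,
and so is `M ⟶ step M`, as in a homotopy pullback square. -/
theorem qIso_step_η (h₁ : QIso G (R.η.app M)) (h₂ : QIso (T ⋙ G) (R.η.app M)) :
    QIso G ((R.step u).η.app M) := by
  refine QIso.coconeLift (gExact_biprod _ _) (R.lift_diff u M) ?_ ?_
  · rw [diff, biprod.inl_desc]
    exact h₂.onComplexes T
  · rwa [biprod.lift_snd]

/-- If `u` is bijective on `M` and on `R M`, then `R M ⟶ T (R M)` is an isomorphism, so that the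
homotopy pullback is `T M`, which is `M`. -/
theorem qIso_step_η_of_bijective
    (h₁ : ∀ n, Function.Bijective (ev G (u.app (M.X n))))
    (h₂ : ∀ n, Function.Bijective (ev G (u.app ((R.ρ.obj M).X n)))) :
    QIso G ((R.step u).η.app M) := by
  refine QIso.coconeLift (gExact_biprod' _ _) (R.lift_diff u M) ?_ ?_
  · rw [diff, biprod.inr_desc]
    refine QIso.of_bijective fun n => ?_
    have h : ⇑(ev G ((-(unitOnComplexes u).app (R.ρ.obj M)).f n)) =
        ⇑(Equiv.neg _) ∘ ⇑(ev G (u.app ((R.ρ.obj M).X n))) := by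
      ext z
      exact ev_neg G _ z
    rw [h]
    exact (Equiv.neg _).bijective.comp (h₂ n)
  · rw [biprod.lift_fst]
    exact QIso.of_bijective h₁

end Coaugmented

/-- A property of objects is closed under direct sums, in the form that an object of which the
identity is a sum of two maps factoring through objects with the property has the property. -/
def ClosedUnderSums (P : ObjectProperty C) : Prop :=
  ∀ ⦃V W Z : C⦄ (p : Z ⟶ V) (i : V ⟶ Z) (q : Z ⟶ W) (j : W ⟶ Z), p ≫ i + q ≫ j = 𝟙 Z →
    P V → P W → P Z

omit [HasBinaryBiproducts C] in
theorem closedUnderSums_isZero [HasZeroObject C] :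
    ClosedUnderSums (fun X : C => IsZero X) := by
  intro V W Z p i q j h hV hW
  rw [IsZero.iff_id_eq_zero, ← h, hV.eq_of_src i 0, hW.eq_of_src j 0]
  simp

theorem ClosedUnderSums.step {P : ObjectProperty C} (hP : ClosedUnderSums P) {T : C ⥤ C}
    [T.Additive] {u : 𝟭 C ⟶ T} {R : Coaugmented C} {M : CochainComplex C ℤ} {n m : ℤ}
    (hnm : n + -1 = m) (h₁ : P (T.obj (M.X n))) (h₂ : P ((R.ρ.obj M).X n))
    (h₃ : P (T.obj ((R.ρ.obj M).X m))) : P (((R.step u).ρ.obj M).X n) := by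
  refine hP _ _ _ _ (CochainComplex.mappingCocone.id_X (R.diff u M) n m hnm) ?_ h₃
  refine hP ((biprod.fst : (onComplexes T).obj M ⊞ R.ρ.obj M ⟶ _).f n) ((biprod.inl : _ ⟶ (onComplexes T).obj M ⊞ R.ρ.obj M).f n)
    ((biprod.snd : (onComplexes T).obj M ⊞ R.ρ.obj M ⟶ _).f n)
    ((biprod.inr : _ ⟶ (onComplexes T).obj M ⊞ R.ρ.obj M).f n) ?_ h₁ h₂
  exact congr($(biprod.total (X := (onComplexes T).obj M) (Y := R.ρ.obj M)).f n)

variable [HasZeroObject C] {ι : Type*} (T : ι → C ⥤ C) [∀ i, (T i).Additive]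
  (u : ∀ i, 𝟭 C ⟶ T i)

/-- The (ordered) Čech complex of a list of coaugmented endofunctors. -/
def cech : List ι → Coaugmented C
  | [] => ⟨(Functor.const _).obj (HomologicalComplex.zero), { app _ := 0 }⟩
  | i :: l => (cech l).step (u i)

variable {T u}
variable {K L M N : CochainComplex C ℤ}

theorem isZero_cech_nil (M : CochainComplex C ℤ) (n : ℤ) :
    IsZero (((cech T u []).ρ.obj M).X n) := isZero_zero C

omit [HasBinaryBiproducts C] [HasZeroObject C] in
theorem ev_eq_of_isZero {G : C ⥤ AddCommGrpCat.{w}} [G.Additive] {X : C} (h : IsZero X)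
    (z : G.obj X) : z = 0 := by
  rw [← ev_id G X z, h.eq_of_src (𝟙 X) 0, ev_zero]

/-- The Čech complex inherits termwise properties from `M`. -/
theorem cech_property {P Q : ObjectProperty C} (hP : ClosedUnderSums P) (hQ : ClosedUnderSums Q)
    (hP0 : ∀ X, IsZero X → P X) (hQ0 : ∀ X, IsZero X → Q X)
    (hPT : ∀ i X, P X → P ((T i).obj X)) (hQT : ∀ i X, P X → Q ((T i).obj X)) (l : List ι)
    (hM : ∀ n, P (M.X n)) (n : ℤ) :
    P (((cech T u l).ρ.obj M).X n) ∧ Q (((cech T u l).ρ.obj M).X n) := by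
  induction l generalizing n with
  | nil => exact ⟨hP0 _ (isZero_cech_nil M n), hQ0 _ (isZero_cech_nil M n)⟩
  | cons i l ih =>
    exact ⟨hP.step rfl (hPT _ _ (hM n)) (ih n).1 (hPT _ _ (ih _).1),
      hQ.step rfl (hQT _ _ (hM n)) (ih n).2 (hQT _ _ (ih _).1)⟩

theorem cech_isZero_below {a : ℤ} (h : ∀ n < a, IsZero (M.X n)) (l : List ι) (n : ℤ) (hn : n < a) :
    IsZero (((cech T u l).ρ.obj M).X n) := by
  induction l generalizing n with
  | nil => exact isZero_cech_nil M n
  | cons i l ih =>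
    exact closedUnderSums_isZero.step (m := n + -1) rfl ((T i).map_isZero (h n hn)) (ih n hn)
      ((T i).map_isZero (ih _ (by lia)))

/-- Each member of the covering adds at most one degree. -/
theorem cech_isZero_above {a : ℤ} (h : ∀ n > a, IsZero (M.X n)) (l : List ι) (n : ℤ)
    (hn : n > a + l.length) : IsZero (((cech T u l).ρ.obj M).X n) := by
  induction l generalizing n with
  | nil => exact isZero_cech_nil M n
  | cons i l ih =>
    rw [List.length_cons, Nat.cast_add, Nat.cast_one] at hn
    exact closedUnderSums_isZero.step (m := n + -1) rfl ((T i).map_isZero (h n (by lia)))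
      (ih n (by lia)) ((T i).map_isZero (ih _ (by lia)))

variable {π : Type*} {Γ : π → C ⥤ AddCommGrpCat.{w}} [∀ p, (Γ p).Additive] {t : ι → π → π}

/-- The Čech complex preserves quasi-isomorphisms, with respect to a family of functors `Γ p`, if
it does so termwise. -/
theorem qIso_cech_map (ht : ∀ i p, T i ⋙ Γ p = Γ (t i p))
    (E : π → Prop) (φ : K ⟶ L)
    (hE : ∀ p i, E p → E (t i p)) (h : ∀ p i, E p → QIso (Γ (t i p)) φ)
    (l : List ι) (p : π) (hp : E p) : QIso (Γ p) ((cech T u l).ρ.map φ) := by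
  induction l generalizing p with
  | nil =>
    refine QIso.of_bijective fun n => ⟨fun z w _ => ?_, fun z => ⟨0, ?_⟩⟩
    · rw [ev_eq_of_isZero (isZero_cech_nil _ n) z, ev_eq_of_isZero (isZero_cech_nil _ n) w]
    · rw [ev_eq_of_isZero (isZero_cech_nil _ n) z, map_zero]
  | cons i l ih =>
    exact Coaugmented.qIso_step_map (ht i p ▸ h p i hp) (ih p hp)
      (ht i p ▸ ih (t i p) (hE p i hp))

/-- The Čech complex preserves sequences of complexes which are termwise split exact, i.e., stay
exact after applying any additive functor. -/
theorem gExact_cech_map {i : K ⟶ L} {p : L ⟶ M}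
    (h : ∀ (G : C ⥤ AddCommGrpCat.{w}) [G.Additive], GExact G i p) (l : List ι)
    (G : C ⥤ AddCommGrpCat.{w}) [G.Additive] :
    GExact G ((cech T u l).ρ.map i) ((cech T u l).ρ.map p) := by
  induction l generalizing G with
  | nil =>
    refine ⟨?_, fun n z _ => ?_, fun n z _ => ⟨0, ?_⟩, fun n z => ⟨0, ?_⟩⟩
    · ext n
      exact (isZero_cech_nil K n).eq_of_src _ _
    all_goals rw [ev_eq_of_isZero (isZero_cech_nil _ n) z]
    all_goals exact map_zero _
  | cons i l ih => exact Coaugmented.gExact_step_map (h (T i ⋙ G)) (ih G) (ih (T i ⋙ G))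

/-- If one of the functors `T j` does not change `M`, locally with respect to `Γ p`, then the
coaugmentation of the Čech complex is a quasi-isomorphism. -/
theorem qIso_cech_η (ht : ∀ i p, T i ⋙ Γ p = Γ (t i p))
    {j : ι} (E : π → C → Prop)
    (hE : ∀ p, ClosedUnderSums (E p)) (hE0 : ∀ p X, IsZero X → E p X)
    (hET : ∀ p i X, E p X → E p ((T i).obj X)) (htE : ∀ p i X, E p X → E (t i p) X)
    (hEj : ∀ p X, E p X → Function.Bijective (ev (Γ p) ((u j).app X))) {l : List ι} (hj : j ∈ l)
    (p : π) (hM : ∀ n, E p (M.X n)) : QIso (Γ p) ((cech T u l).η.app M) := by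
  induction l generalizing p with
  | nil => simp at hj
  | cons i l ih =>
    rcases List.mem_cons.1 hj with rfl | hj'
    · exact Coaugmented.qIso_step_η_of_bijective (fun n => hEj _ _ (hM n)) fun n =>
        hEj _ _ (cech_property (hE p) (hE p) (hE0 p) (hE0 p) (hET p) (hET p) l hM n).1
    · exact Coaugmented.qIso_step_η (ih hj' p hM)
        (ht i p ▸ ih hj' (t i p) fun n => htE _ _ _ (hM n))

theorem isZero_cech_of_isZero (h : ∀ n, IsZero (M.X n)) (l : List ι) (n : ℤ) :
    IsZero (((cech T u l).ρ.obj M).X n) :=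
  (cech_property closedUnderSums_isZero closedUnderSums_isZero (fun _ => id) (fun _ => id)
    (fun i _ h => (T i).map_isZero h) (fun i _ h => (T i).map_isZero h) l h n).1

/-- The coaugmentation of the Čech complex is a quasi-isomorphism on Čech complexes. -/
theorem qIso_cech_η_cech (ht : ∀ i p, T i ⋙ Γ p = Γ (t i p))
    (E : ι → π → C → Prop)
    (hE : ∀ j p, ClosedUnderSums (E j p)) (hE0 : ∀ j p X, IsZero X → E j p X)
    (hET : ∀ j p i X, E j p X → E j p ((T i).obj X)) (htE : ∀ j p i X, E j p X → E j (t i p) X)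
    (hEj : ∀ j p X, E j p X → Function.Bijective (ev (Γ p) ((u j).app X)))
    (p : π) (hp : ∀ j X, E j p ((T j).obj X))
    {l l' : List ι} (hl : ∀ j ∈ l', j ∈ l) (M : CochainComplex C ℤ) :
    QIso (Γ p) ((cech T u l).η.app ((cech T u l').ρ.obj M)) := by
  have key (j) (hj : j ∈ l) (N : CochainComplex C ℤ) (hN : ∀ n, E j p (N.X n)) :
      QIso (Γ p) ((cech T u l).η.app N) :=
    qIso_cech_η ht (E j) (hE j) (hE0 j) (hET j) (htE j) (hEj j) hj p hN
  induction l' with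
  | nil =>
    refine QIso.of_bijective fun n => ⟨fun z w _ => ?_, fun z => ⟨0, ?_⟩⟩
    · exact (ev_eq_of_isZero (isZero_cech_nil (T := T) (u := u) M n) z).trans
        (ev_eq_of_isZero (isZero_cech_nil (T := T) (u := u) M n) w).symm
    · rw [ev_eq_of_isZero (isZero_cech_of_isZero (isZero_cech_nil (T := T) (u := u) M) l n) z, map_zero]
  | cons i l' ih =>
    have hi : i ∈ l := hl i (by simp)
    -- All functors are additive, hence both sides map the short exact sequences defining `step` to
    -- short exact sequences, and the claim reduces to `T i N` and to the shorter Čech complex.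
    refine QIso.of_gExact (gExact_cocone ((cech T u l').diff (u i) M))
      (gExact_cech_map (fun G _ => gExact_cocone ((cech T u l').diff (u i) M)) l (Γ p))
      ((cech T u l).η.naturality _) ((cech T u l).η.naturality _)
      (key i hi _ fun n => hp i _) ?_
    exact QIso.of_gExact (gExact_biprod _ _) (gExact_cech_map (fun G _ => gExact_biprod _ _) l (Γ p))
      ((cech T u l).η.naturality _) ((cech T u l).η.naturality _)
      (key i hi _ fun n => hp i _) (ih fun j hj => hl j (by simp [hj]))

end Cech

section Derived

variable {C D D' : Type*} [Category* C] [Category* D] [Category* D'] (W : MorphismProperty C)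
  {F : C ⥤ D} {ρ : C ⥤ C} (η : 𝟭 C ⟶ ρ)

/-- A functor `F` has a right derived functor, computed by functorial resolutions `η : 𝟭 ⟶ ρ`, if
`F ∘ ρ` inverts weak equivalences and `F` inverts `η` on resolutions. -/
theorem exists_isRightDerivedFunctor (h : ∀ K, W (η.app K)) (h₁ : W.IsInvertedBy (ρ ⋙ F))
    (h₂ : ∀ K, IsIso (F.map (η.app (ρ.obj K)))) :
    ∃ (RF : W.Localization ⥤ D) (α : F ⟶ W.Q ⋙ RF), RF.IsRightDerivedFunctor α W ∧
      Nonempty (W.Q ⋙ RF ≅ ρ ⋙ F) := by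
  let RF := Localization.lift (ρ ⋙ F) h₁ W.Q
  let e : W.Q ⋙ RF ≅ ρ ⋙ F := Localization.fac _ h₁ W.Q
  let α : F ⟶ W.Q ⋙ RF := Functor.whiskerRight η F ≫ e.inv
  refine ⟨RF, α, ?_, ⟨e⟩⟩
  have hQ (G : W.Localization ⥤ D) (K : C) : IsIso (G.map (W.Q.map (η.app K))) := by
    have := Localization.inverts W.Q W _ (h K)
    infer_instance
  rw [Functor.isRightDerivedFunctor_iff_isLeftKanExtension]
  -- A transformation `β` factors through `ρ ⋙ F`, since its target inverts `η`.
  let γ (G : W.Localization ⥤ D) (β : F ⟶ W.Q ⋙ G) : ρ ⋙ F ⟶ W.Q ⋙ G :=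
    { app K := β.app (ρ.obj K) ≫ inv (G.map (W.Q.map (η.app K)))
      naturality K L f := by
        have h : G.map (W.Q.map f) ≫ G.map (W.Q.map (η.app L)) =
            G.map (W.Q.map (η.app K)) ≫ G.map (W.Q.map (ρ.map f)) := by
          rw [← G.map_comp, ← G.map_comp, ← W.Q.map_comp, ← W.Q.map_comp]
          exact congrArg (fun t => G.map (W.Q.map t)) (η.naturality f)
        have h' : F.map (ρ.map f) ≫ β.app (ρ.obj L) =
          β.app (ρ.obj K) ≫ G.map (W.Q.map (ρ.map f)) := β.naturality (ρ.map f)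
        rw [Functor.comp_map, Functor.comp_map, reassoc_of% h', Category.assoc]
        congr 1
        rw [IsIso.comp_inv_eq, Category.assoc, h, IsIso.inv_hom_id_assoc] }
  have hγ (G : W.Localization ⥤ D) (β : F ⟶ W.Q ⋙ G) (K : C) :
      F.map (η.app K) ≫ (γ G β).app K = β.app K := by
    have h : F.map (η.app K) ≫ β.app (ρ.obj K) = β.app K ≫ G.map (W.Q.map (η.app K)) :=
      β.naturality (η.app K)
    change F.map (η.app K) ≫ β.app (ρ.obj K) ≫ inv (G.map (W.Q.map (η.app K))) = β.app K
    rw [reassoc_of% h, IsIso.hom_inv_id, Category.comp_id]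
  -- The factorization is unique, since `F` inverts `η` on the image of `ρ`.
  have uniq (G : W.Localization ⥤ D) (δ δ' : ρ ⋙ F ⟶ W.Q ⋙ G)
      (hδ : ∀ K, F.map (η.app K) ≫ δ.app K = F.map (η.app K) ≫ δ'.app K) : δ = δ' := by
    ext K
    have h := δ.naturality (η.app K)
    have h' := δ'.naturality (η.app K)
    have := h₂ K
    have e' : δ.app (ρ.obj K) = δ'.app (ρ.obj K) := by
      rw [← cancel_epi (F.map (η.app (ρ.obj K))), hδ]
    have := hQ G K
    rw [e', h'] at h
    exact ((cancel_mono (G.map (W.Q.map (η.app K)))).1 h).symm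
  refine ⟨⟨IsInitial.ofUniqueHom (fun E => StructuredArrow.homMk
    (Localization.liftNatTrans W.Q W (W.Q ⋙ RF) (W.Q ⋙ E.right) RF E.right
      (e.hom ≫ γ E.right E.hom)) ?_) fun E m => ?_⟩⟩
  · ext K
    change (F.map (η.app K) ≫ e.inv.app K) ≫ (Localization.liftNatTrans W.Q W (W.Q ⋙ RF)
      (W.Q ⋙ E.right) RF E.right (e.hom ≫ γ E.right E.hom)).app (W.Q.obj K) = E.hom.app K
    rw [Localization.liftNatTrans_app, ← hγ]
    simp [Localization.Lifting.iso]
  · ext : 1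
    refine Localization.natTrans_ext W.Q W fun K => ?_
    let μ : RF ⟶ E.right := m.right
    have hm (K : C) : (F.map (η.app K) ≫ e.inv.app K) ≫ μ.app (W.Q.obj K) = E.hom.app K :=
      congr($(StructuredArrow.w m).app K)
    have key := uniq E.right (e.inv ≫ Functor.whiskerLeft W.Q μ) (γ E.right E.hom)
      fun K => by
        rw [hγ, ← hm, Category.assoc]
        rfl
    have hK : e.inv.app K ≫ μ.app (W.Q.obj K) = (γ E.right E.hom).app K :=
      congr($(key).app K)
    change μ.app (W.Q.obj K) = (Localization.liftNatTrans W.Q W (W.Q ⋙ RF)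
      (W.Q ⋙ E.right) RF E.right (e.hom ≫ γ E.right E.hom)).app (W.Q.obj K)
    rw [Localization.liftNatTrans_app]
    simp [Localization.Lifting.iso, ← hK]

end Derived

end CartierSheaves

/-! ### Sheaves of modules in terms of sections -/

namespace CartierSheaves

section Modules

variable {X : Scheme.{u}} {M N K : X.Modules}

theorem app_res (φ : M ⟶ N) {U V : X.Opens} (h : V ≤ U) (s : Γ(M, U)) :
    φ.app V (res M h s) = res N h (φ.app U s) :=
  congr($(φ.mapPresheaf.naturality (homOfLE h).op) s)

theorem comp_app_apply (φ : M ⟶ N) (ψ : N ⟶ K) (U : X.Opens) (s : Γ(M, U)) :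
    (φ ≫ ψ).app U s = ψ.app U (φ.app U s) := rfl

@[simp]
theorem res_self (M : X.Modules) {U : X.Opens} (h : U ≤ U) (s : Γ(M, U)) : res M h s = s :=
  congr($(M.presheaf.map_id _) s)

/-- A morphism of modules, from its action on sections. -/
def homOfApp (φ : ∀ U : X.Opens, Γ(M, U) →+ Γ(N, U))
    (hres : ∀ (U V : X.Opens) (h : V ≤ U) (s : Γ(M, U)), φ V (res M h s) = res N h (φ U s))
    (hsmul : ∀ (U : X.Opens) (r : Γ(X, U)) (s : Γ(M, U)), φ U (r • s) = r • φ U s) : M ⟶ N :=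
  ⟨PresheafOfModules.homMk
    { app U := AddCommGrpCat.ofHom (φ U.unop)
      naturality U V i := by
        ext s
        exact hres U.unop V.unop (leOfHom i.unop) s }
    fun U r s => hsmul U.unop r s⟩

theorem hom_ext_apply {φ ψ : M ⟶ N} (h : ∀ U s, φ.app U s = ψ.app U s) : φ = ψ := by
  ext U s
  exact h U s

theorem app_injective_of_mono (φ : M ⟶ N) [Mono φ] (U : X.Opens) :
    Function.Injective (φ.app U) := by
  have h1 : Mono ((Scheme.Modules.toPresheaf X).map φ) := inferInstance
  have h2 := (NatTrans.mono_iff_mono_app _).1 h1 (op U)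
  exact (AddCommGrpCat.mono_iff_injective _).1 h2

theorem mono_of_app_injective (φ : M ⟶ N) (h : ∀ U, Function.Injective (φ.app U)) : Mono φ :=
  ⟨fun f g e => hom_ext_apply fun U s => h U (by
    rw [← comp_app_apply, ← comp_app_apply, e])⟩

theorem app_bijective_of_isIso (φ : M ⟶ N) [IsIso φ] (U : X.Opens) :
    Function.Bijective (φ.app U) :=
  ConcreteCategory.bijective_of_isIso _

theorem res_ext' (M : X.Modules) {U : X.Opens} {s t : Γ(M, U)}
    (h : ∀ x ∈ U, ∃ (V : X.Opens) (hV : V ≤ U), x ∈ V ∧ res M hV s = res M hV t) : s = t := by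
  choose V hV hxV e using h
  exact res_ext M (ι := U) (V := fun x => V x.1 x.2) (fun x => hV x.1 x.2)
    (fun x hx => Opens.mem_iSup.2 ⟨⟨x, hx⟩, hxV x hx⟩) fun x => e x.1 x.2

/-- A subsheaf of modules, given by the submodules of its sections. -/
structure Subsheaf (M : X.Modules) where
  /-- The sections of the subsheaf. -/
  obj (U : X.Opens) : Submodule Γ(X, U) Γ(M, U)
  res_mem {U V : X.Opens} (h : V ≤ U) {s : Γ(M, U)} : s ∈ obj U → res M h s ∈ obj V
  mem_of_local {U : X.Opens} (s : Γ(M, U)) : (∀ x ∈ U, ∃ (V : X.Opens) (h : V ≤ U),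
    x ∈ V ∧ res M h s ∈ obj V) → s ∈ obj U

namespace Subsheaf

variable (S : Subsheaf M)

/-- The underlying presheaf of modules. -/
def presheafOfModules : PresheafOfModules X.ringCatSheaf.obj :=
  (PresheafOfModules.Submodule.mk (M := M.val) (fun U => S.obj U.unop)
    fun f _ hs => S.res_mem (leOfHom f.unop) hs).toPresheafOfModules

theorem isSheaf : TopCat.Presheaf.IsSheaf S.presheafOfModules.presheaf := by
  rw [TopCat.Presheaf.isSheaf_iff_isSheafUniqueGluing]
  intro ι U sf hsf
  obtain ⟨t, ht, ht'⟩ := TopCat.Sheaf.existsUnique_gluing ⟨_, M.isSheaf⟩ U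
    (fun i => (show S.obj (U i) from sf i).1)
    fun i j => congrArg (Subtype.val : S.obj (U i ⊓ U j) → Γ(M, U i ⊓ U j)) (hsf i j)
  have htm : (t : Γ(M, iSup U)) ∈ S.obj (iSup U) := by
    refine S.mem_of_local _ fun x hx => ?_
    obtain ⟨i, hi⟩ := Opens.mem_iSup.1 hx
    refine ⟨U i, le_iSup U i, hi, ?_⟩
    have h := ht i
    change res M (le_iSup U i) t = _ at h
    rw [h]
    exact (show S.obj (U i) from sf i).2
  refine ⟨(⟨t, htm⟩ : S.obj (iSup U)), fun i => Subtype.ext (ht i), fun s hs => ?_⟩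
  refine Subtype.ext (ht' (show S.obj (iSup U) from s).1 fun i => ?_)
  exact congrArg (Subtype.val : S.obj (U i) → Γ(M, U i)) (hs i)

/-- The sheaf of modules underlying a subsheaf. -/
def toModules : X.Modules := ⟨S.presheafOfModules, S.isSheaf⟩

/-- The inclusion of a subsheaf. -/
def ι : S.toModules ⟶ M :=
  homOfApp (M := S.toModules) (fun U => (S.obj U).subtype.toAddMonoidHom) (fun _ _ _ _ => rfl)
    fun _ _ _ => rfl

/-- A section of the subsheaf. -/
def toSection {U : X.Opens} (s : Γ(M, U)) (hs : s ∈ S.obj U) : Γ(S.toModules, U) :=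
  (⟨s, hs⟩ : S.obj U)

@[simp]
theorem ι_toSection {U : X.Opens} (s : Γ(M, U)) (hs : s ∈ S.obj U) : S.ι.app U (S.toSection s hs) = s := rfl

theorem ι_mem {U : X.Opens} (s : Γ(S.toModules, U)) : S.ι.app U s ∈ S.obj U :=
  (s : S.obj U).2

theorem ι_injective (U : X.Opens) : Function.Injective (S.ι.app U) :=
  fun _ _ h => Subtype.ext h

instance : Mono S.ι := mono_of_app_injective _ S.ι_injective

/-- The corestriction of a morphism to a subsheaf. -/
def lift (φ : N ⟶ M) (h : ∀ U s, φ.app U s ∈ S.obj U) : N ⟶ S.toModules :=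
  homOfApp (N := S.toModules)
    (fun U => AddMonoidHom.mk' (fun s => S.toSection (φ.app U s) (h U s))
      fun a b => S.ι_injective U (by simp))
    (fun U V hV s => S.ι_injective V (by
      rw [app_res]
      exact app_res φ hV s))
    fun U r s => S.ι_injective U (by
      rw [Scheme.Modules.Hom.app_smul]
      exact φ.app_smul r s)

@[simp]
theorem lift_ι (φ : N ⟶ M) (h : ∀ U s, φ.app U s ∈ S.obj U) : S.lift φ h ≫ S.ι = φ := rfl

end Subsheaf

/-- The subsheaf of sections annihilated by a morphism. -/
def kerSubsheaf (φ : M ⟶ N) : Subsheaf M where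
  obj U :=
    { carrier := {s | φ.app U s = 0}
      add_mem' := fun {a b} ha hb => by
        change φ.app U (a + b) = 0
        rw [map_add, show φ.app U a = 0 from ha, show φ.app U b = 0 from hb, add_zero]
      zero_mem' := map_zero _
      smul_mem' r s hs := by
        change φ.app U (r • s) = 0
        rw [φ.app_smul, show φ.app U s = 0 from hs, smul_zero] }
  res_mem {U V} h {s} hs := by
    change φ.app V (res M h s) = 0
    rw [app_res, show φ.app U s = 0 from hs, map_zero]
  mem_of_local {U} s hs := by
    refine res_ext' N fun x hx => ?_
    obtain ⟨V, hV, hxV, e⟩ := hs x hx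
    refine ⟨V, hV, hxV, ?_⟩
    rw [← app_res, map_zero]
    exact e

theorem mem_kerSubsheaf (φ : M ⟶ N) (U : X.Opens) (s : Γ(M, U)) :
    s ∈ (kerSubsheaf φ).obj U ↔ φ.app U s = 0 := Iff.rfl

/-- The image sheaf: the sections which locally lift. -/
def imageSubsheaf (φ : M ⟶ N) : Subsheaf N where
  obj U :=
    { carrier := {s | ∀ x ∈ U, ∃ (V : X.Opens) (h : V ≤ U), x ∈ V ∧ ∃ y, φ.app V y = res N h s}
      add_mem' := fun {a b} ha hb x hx => by
        obtain ⟨V, hV, hxV, y, hy⟩ := ha x hx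
        obtain ⟨W, hW, hxW, z, hz⟩ := hb x hx
        refine ⟨V ⊓ W, inf_le_left.trans hV, ⟨hxV, hxW⟩,
          res M inf_le_left y + res M inf_le_right z, ?_⟩
        rw [map_add, map_add, app_res, app_res, hy, hz, res_res, res_res]
      zero_mem' x hx := ⟨U, le_rfl, hx, 0, by rw [map_zero, map_zero]⟩
      smul_mem' r s hs x hx := by
        obtain ⟨V, hV, hxV, y, hy⟩ := hs x hx
        exact ⟨V, hV, hxV, resO hV r • y, by rw [φ.app_smul, hy, res_smul]⟩ }
  res_mem {U V} h {s} hs x hx := by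
    obtain ⟨W, hW, hxW, y, hy⟩ := hs x (h hx)
    refine ⟨V ⊓ W, inf_le_left, ⟨hx, hxW⟩, res M inf_le_right y, ?_⟩
    rw [app_res, hy, res_res, res_res]
  mem_of_local {U} s hs x hx := by
    obtain ⟨V, hV, hxV, h⟩ := hs x hx
    obtain ⟨W, hW, hxW, y, hy⟩ := h x hxV
    exact ⟨W, hW.trans hV, hxW, y, by rw [hy, res_res]⟩

theorem mem_imageSubsheaf (φ : M ⟶ N) (U : X.Opens) (s : Γ(N, U)) :
    s ∈ (imageSubsheaf φ).obj U ↔ ∀ x ∈ U, ∃ (V : X.Opens) (h : V ≤ U),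
      x ∈ V ∧ ∃ y, φ.app V y = res N h s := Iff.rfl

/-- Exactness of a sequence of sheaves of modules is local exactness on sections. -/
theorem exact_iff_sections (S : ShortComplex X.Modules) : S.Exact ↔
    ∀ (U : X.Opens) (z : Γ(S.X₂, U)), S.g.app U z = 0 → ∀ x ∈ U, ∃ (V : X.Opens) (h : V ≤ U),
      x ∈ V ∧ ∃ y, S.f.app V y = res S.X₂ h z := by
  constructor
  · intro h U z hz
    rw [← mem_imageSubsheaf]
    -- The image sheaf maps isomorphically to the kernel sheaf.
    let Z := kerSubsheaf S.g
    let I := imageSubsheaf S.f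
    have hI : ∀ U s, S.f.app U s ∈ I.obj U := fun U s x hx => ⟨U, le_rfl, hx, s, by simp⟩
    have hIZ : ∀ U s, I.ι.app U s ∈ Z.obj U := fun U s => by
      refine Z.mem_of_local _ fun x hx => ?_
      obtain ⟨V, hV, hxV, y, hy⟩ := I.ι_mem s x hx
      refine ⟨V, hV, hxV, ?_⟩
      rw [← hy, mem_kerSubsheaf, ← comp_app_apply, S.zero]
      rfl
    have hZ : Z.ι ≫ S.g = 0 := hom_ext_apply fun U s => Z.ι_mem s
    obtain ⟨A, π, hπ, x, hx⟩ := h.exact_up_to_refinements Z.ι hZ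
    have e : π = (x ≫ I.lift S.f hI) ≫ Z.lift I.ι hIZ := by
      rw [← cancel_mono Z.ι, hx]
      rfl
    have : Epi (Z.lift I.ι hIZ) := by
      rw [e] at hπ
      exact epi_of_epi (x ≫ I.lift S.f hI) _
    have : Mono (Z.lift I.ι hIZ) := by
      have : Mono (Z.lift I.ι hIZ ≫ Z.ι) := by
        rw [Z.lift_ι]
        infer_instance
      exact mono_of_mono _ Z.ι
    have := isIso_of_mono_of_epi (Z.lift I.ι hIZ)
    obtain ⟨w, hw⟩ := (app_bijective_of_isIso (Z.lift I.ι hIZ) U).2 (Z.toSection z hz)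
    have e' : I.ι.app U w = z := congrArg (Z.ι.app U) hw
    rw [← e']
    exact I.ι_mem w
  · intro h
    rw [ShortComplex.exact_iff_epi_kernel_lift]
    refine Preadditive.epi_of_cancel_zero _ fun {T} f hf => hom_ext_apply fun U z => ?_
    refine res_ext' T fun x hx => ?_
    obtain ⟨V, hV, hxV, y, hy⟩ := h U ((kernel.ι S.g).app U z) (by
      rw [← comp_app_apply, kernel.condition]
      rfl) x hx
    refine ⟨V, hV, hxV, ?_⟩
    have e : (kernel.lift S.g S.f S.zero).app V y = res _ hV z := by
      apply app_injective_of_mono (kernel.ι S.g) V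
      rw [← comp_app_apply, kernel.lift_ι, hy, app_res]
    rw [← app_res, ← e, ← comp_app_apply, hf]
    change 0 = res T hV 0
    rw [map_zero]

theorem app_zero_apply (U : X.Opens) (s : Γ(M, U)) : (0 : M ⟶ N).app U s = 0 := rfl

theorem app_add_apply (φ ψ : M ⟶ N) (U : X.Opens) (s : Γ(M, U)) :
    (φ + ψ).app U s = φ.app U s + ψ.app U s := rfl

theorem isQuasicoherent_of_isZero (hM : IsZero M) : M.IsQuasicoherent := by
  have h (U : X.Opens) (s : Γ(M, U)) : s = 0 := by
    change (𝟙 M : M ⟶ M).app U s = 0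
    rw [hM.eq_of_src (𝟙 M) 0]
    rfl
  exact isQuasicoherent_of_localizes M fun U hU r =>
    ⟨fun t _ => ⟨0, h _ _⟩, fun s => ⟨0, 0, (h _ _).trans (h _ _).symm⟩⟩

/-- Quasi-coherent sheaves are closed under direct sums. -/
theorem isQuasicoherent_of_sum {Z : X.Modules} (p : Z ⟶ M) (i : M ⟶ Z) (q : Z ⟶ N) (j : N ⟶ Z)
    (h : p ≫ i + q ≫ j = 𝟙 Z) [M.IsQuasicoherent] [N.IsQuasicoherent] : Z.IsQuasicoherent := by
  have key (U : X.Opens) (s : Γ(Z, U)) : i.app U (p.app U s) + j.app U (q.app U s) = s := by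
    rw [← comp_app_apply, ← comp_app_apply, ← app_add_apply, h]
    rfl
  refine isQuasicoherent_of_localizes Z fun U hU r => ?_
  have hM := localizes_of_isAffineOpen M hU r
  have hN := localizes_of_isAffineOpen N hU r
  refine ⟨fun t ht => ?_, fun s => ?_⟩
  · obtain ⟨n, hn⟩ := hM.eq_zero (p.app U t)
      ((app_res p (X.basicOpen_le r) t).symm.trans ((congrArg _ ht).trans (map_zero _)))
    obtain ⟨m, hm⟩ := hN.eq_zero (q.app U t)
      ((app_res q (X.basicOpen_le r) t).symm.trans ((congrArg _ ht).trans (map_zero _)))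
    refine ⟨n + m, ?_⟩
    rw [← key U (r ^ (n + m) • t), p.app_smul, q.app_smul, pow_add, mul_smul (r ^ n) (r ^ m) (q.app U t),
      hm, mul_comm, mul_smul, hn, smul_zero, smul_zero, map_zero, map_zero, add_zero]
  · obtain ⟨n, t, ht⟩ := hM.surj (p.app _ s)
    obtain ⟨m, t', ht'⟩ := hN.surj (q.app _ s)
    refine ⟨n + m, i.app U (r ^ m • t) + j.app U (r ^ n • t'), ?_⟩
    change res Z (X.basicOpen_le r) _ = resO (X.basicOpen_le r) r ^ (n + m) • s
    change res M (X.basicOpen_le r) t = resO (X.basicOpen_le r) r ^ n • _ at ht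
    change res N (X.basicOpen_le r) t' = resO (X.basicOpen_le r) r ^ m • _ at ht'
    rw [map_add, ← app_res, ← app_res, res_smul, res_smul, ht, ht', map_pow, map_pow, ← mul_smul,
      ← mul_smul, ← pow_add, ← pow_add, add_comm m n, i.app_smul, j.app_smul, ← smul_add, key]

/-- A sequence of quasi-coherent sheaves is exact on sections over an affine open subset if it is
exact locally. -/
theorem exact_of_isAffineOpen [M.IsQuasicoherent] [N.IsQuasicoherent] (φ : M ⟶ N)
    {U : X.Opens} (hU : IsAffineOpen U) (z : Γ(N, U))
    (h : ∀ x ∈ U, ∃ (V : X.Opens) (hV : V ≤ U), x ∈ V ∧ ∃ y, φ.app V y = res N hV z) :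
    ∃ y, φ.app U y = z := by
  let I : Ideal Γ(X, U) :=
    { carrier := {r | ∃ y, φ.app U y = r • z}
      add_mem' := by
        rintro a b ⟨y, hy⟩ ⟨w, hw⟩
        exact ⟨y + w, by rw [map_add, hy, hw, add_smul]⟩
      zero_mem' := ⟨0, by rw [map_zero, zero_smul]⟩
      smul_mem' := by
        rintro a b ⟨y, hy⟩
        exact ⟨a • y, by rw [φ.app_smul, hy, smul_eq_mul, mul_smul]⟩ }
  suffices hI : I.radical = ⊤ by
    obtain ⟨y, hy⟩ : (1 : Γ(X, U)) ∈ I := by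
      rw [Ideal.radical_eq_top.1 hI]
      trivial
    exact ⟨y, by rw [hy, one_smul]⟩
  rw [← Ideal.span_eq I.radical, ← hU.iSup_basicOpen_eq_self_iff]
  refine le_antisymm (iSup_le fun f => X.basicOpen_le _) fun x hx => ?_
  obtain ⟨V, hV, hxV, y, hy⟩ := h x hx
  obtain ⟨r, hr, hxr⟩ := hU.exists_basicOpen_le ⟨x, hxV⟩ hx
  refine Opens.mem_iSup.2 ⟨⟨r, ?_⟩, hxr⟩
  have hM := localizes_of_isAffineOpen M hU r
  have hN := localizes_of_isAffineOpen N hU r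
  obtain ⟨n, t, ht⟩ := hM.surj (res M hr y)
  obtain ⟨m, hm⟩ := hN.eq_zero (φ.app U t - r ^ n • z) (by
    change res N (X.basicOpen_le r) _ = 0
    change res M (X.basicOpen_le r) t = resO (X.basicOpen_le r) r ^ n • _ at ht
    rw [map_sub, ← app_res, ht, res_smul, map_pow, φ.app_smul, app_res, hy, res_res, sub_self])
  refine ⟨m + n, r ^ m • t, ?_⟩
  rw [φ.app_smul, pow_add, mul_smul, ← sub_eq_zero, ← smul_sub, hm]

end Modules

end CartierSheaves

/-! ### Sections of `κ`-sheaves, and restriction to `U × C` -/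

namespace CartierSheaves

variable {k : Type u} [Field k] [Finite k] {Λ : Type u} [CommRing Λ] [Algebra k Λ]
  {X Y : Over (Spec (.of k))}

section Opens

variable (Λ X) in
/-- The projection `X × C ⟶ X`. -/
abbrev prodFst : prod Λ X ⟶ X.left :=
  pullback.fst X.hom (Spec.map (CommRingCat.ofHom (algebraMap k Λ)))

variable (Λ) in
/-- The open subset `U × C` of `X × C`. -/
def prodOpen (U : X.left.Opens) : (prod Λ X).Opens := prodFst Λ X ⁻¹ᵁ U

omit [Finite k] in
theorem prodOpen_mono {U V : X.left.Opens} (h : V ≤ U) : prodOpen Λ V ≤ prodOpen Λ U :=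
  Scheme.Hom.preimage_mono (prodFst Λ X) h

variable (Λ X) in
/-- The `q`-power Frobenius `σ_X × id` of `X × C`. -/
abbrev prodFrob : prod Λ X ⟶ prod Λ X := prodMap Λ (frob X)

omit [Finite k] in
theorem prodMap_preimage_prodOpen (f : Y ⟶ X) (U : X.left.Opens) :
    prodMap Λ f ⁻¹ᵁ prodOpen Λ U = prodOpen Λ (f.left ⁻¹ᵁ U) := by
  rw [prodOpen, prodOpen, ← Scheme.Hom.comp_preimage, ← Scheme.Hom.comp_preimage, prodMap_fst]

theorem prodFrob_preimage_prodOpen (U : X.left.Opens) :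
    prodFrob Λ X ⁻¹ᵁ prodOpen Λ U = prodOpen Λ U :=
  prodMap_preimage_prodOpen (frob X) U

theorem prodFrob_preimage_prodMap_preimage (f : Y ⟶ X) (O : (prod Λ X).Opens) :
    prodFrob Λ Y ⁻¹ᵁ (prodMap Λ f ⁻¹ᵁ O) = prodMap Λ f ⁻¹ᵁ (prodFrob Λ X ⁻¹ᵁ O) := by
  rw [← Scheme.Hom.comp_preimage, ← Scheme.Hom.comp_preimage, prodMap_frob]

/-- The intersection `Ω ∩ O`, in the form in which it occurs in the pushforward of a restriction
to `Ω`. -/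
def cap {X : Scheme.{u}} (Ω O : X.Opens) : X.Opens := Ω.ι ''ᵁ Ω.ι ⁻¹ᵁ O

theorem cap_eq {X : Scheme.{u}} (Ω O : X.Opens) : cap Ω O = Ω ⊓ O := by
  rw [cap, Scheme.Hom.image_preimage_eq_opensRange_inf, Scheme.Opens.opensRange_ι]

theorem cap_le {X : Scheme.{u}} (Ω O : X.Opens) : cap Ω O ≤ O := Scheme.Hom.image_preimage_le _ _

theorem cap_mono {X : Scheme.{u}} (Ω : X.Opens) {O O' : X.Opens} (h : O' ≤ O) :
    cap Ω O' ≤ cap Ω O := by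
  rw [cap_eq, cap_eq]
  exact inf_le_inf_left _ h

theorem cap_prodFrob_preimage (U : X.left.Opens) (O : (prod Λ X).Opens) :
    cap (prodOpen Λ U) (prodFrob Λ X ⁻¹ᵁ O) = prodFrob Λ X ⁻¹ᵁ cap (prodOpen Λ U) O := by
  rw [cap_eq, cap_eq, Scheme.Hom.preimage_inf, prodFrob_preimage_prodOpen]

end Opens

section Extend

variable {Z : Scheme.{u}} (Ω : Z.Opens)

/-- The restriction of a sheaf of modules to an open subset, pushed forward again. -/
def extend : Z.Modules ⥤ Z.Modules :=
  Scheme.Modules.restrictFunctor Ω.ι ⋙ Scheme.Modules.pushforward Ω.ι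

instance (M : Z.Modules) [M.IsQuasicoherent] [QuasiCompact Ω.ι] :
    ((extend Ω).obj M).IsQuasicoherent :=
  isQuasicoherent_pushforward Ω.ι (M.restrict Ω.ι)

/-- The unit of the adjunction between restriction and pushforward. -/
def toExtend (M : Z.Modules) : M ⟶ (extend Ω).obj M :=
  (Scheme.Modules.restrictAdjunction Ω.ι).unit.app M

theorem toExtend_naturality {M N : Z.Modules} (φ : M ⟶ N) :
    φ ≫ toExtend Ω N = toExtend Ω M ≫ (extend Ω).map φ :=
  (Scheme.Modules.restrictAdjunction Ω.ι).unit.naturality φ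

variable {Ω} {M N : Z.Modules}

/-- Sections of `extend Ω M` over `O` are sections of `M` over `Ω ∩ O`. -/
def extendSections {O : Z.Opens} : Γ((extend Ω).obj M, O) ≃+ Γ(M, cap Ω O) := AddEquiv.refl _

theorem extendSections_res {O O' : Z.Opens} (h : O' ≤ O) (s : Γ((extend Ω).obj M, O)) :
    extendSections (res ((extend Ω).obj M) h s) = res M (cap_mono Ω h) (extendSections s) := rfl

theorem extendSections_smul {O : Z.Opens} (r : Γ(Z, O)) (s : Γ((extend Ω).obj M, O)) :
    extendSections (r • s) = resO (cap_le Ω O) r • extendSections s := by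
  change @HSMul.hSMul Γ(Z, cap Ω O) Γ(M, cap Ω O) Γ(M, cap Ω O) instHSMul
    ((Ω.ι.appIso _).inv (Ω.ι.app O r)) (extendSections s) = _
  congr 1
  rw [Scheme.Opens.ι_appIso]
  rfl

theorem extendSections_map (φ : M ⟶ N) {O : Z.Opens} (s : Γ((extend Ω).obj M, O)) :
    extendSections (((extend Ω).map φ).app O s) = φ.app (cap Ω O) (extendSections s) := rfl

theorem extendSections_toExtend {O : Z.Opens} (s : Γ(M, O)) :
    extendSections ((toExtend Ω M).app O s) = res M (cap_le Ω O) s := rfl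

end Extend

section Swap

variable {X₁ X₂ X₃ Y₂ : Scheme.{u}} (f : X₁ ⟶ X₂) (g : X₂ ⟶ X₃) (f' : X₁ ⟶ Y₂) (g' : Y₂ ⟶ X₃)
  (h : f' ≫ g' = f ≫ g) {M : X₁.Modules} {N : Y₂.Modules}

theorem pushforward_swap_app (κ : (Scheme.Modules.pushforward f').obj M ⟶ N) (O : X₃.Opens)
    (s : Γ(M, f ⁻¹ᵁ (g ⁻¹ᵁ O))) :
    ((Scheme.Modules.pushforwardComp f g ≪≫ Scheme.Modules.pushforwardCongr h.symm ≪≫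
      (Scheme.Modules.pushforwardComp f' g').symm).hom.app M ≫
        (Scheme.Modules.pushforward g').map κ).app O s =
    κ.app (g' ⁻¹ᵁ O) (res M (by
      rw [← Scheme.Hom.comp_preimage, ← Scheme.Hom.comp_preimage, h]) s) := rfl

end Swap

namespace CartierSheaf

section Kappa

variable (V W : CartierSheaf Λ X)

/-- The action of `κ` on sections. -/
def kap (O : (prod Λ X).Opens) : Γ(V.sheaf, prodFrob Λ X ⁻¹ᵁ O) →+ Γ(V.sheaf, O) :=
  (V.κ.app O).hom

theorem kap_res {O O' : (prod Λ X).Opens} (h : O' ≤ O)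
    (s : Γ(V.sheaf, prodFrob Λ X ⁻¹ᵁ O)) :
    V.kap O' (res V.sheaf (Scheme.Hom.preimage_mono _ h) s) = res V.sheaf h (V.kap O s) :=
  app_res V.κ h s

theorem kap_smul {O : (prod Λ X).Opens} (r : Γ(prod Λ X, O))
    (s : Γ(V.sheaf, prodFrob Λ X ⁻¹ᵁ O)) :
    V.kap O ((prodFrob Λ X).app O r • s) = r • V.kap O s :=
  V.κ.app_smul r s

variable {V W}

theorem hom_kap (φ : V ⟶ W) (O : (prod Λ X).Opens) (s : Γ(V.sheaf, prodFrob Λ X ⁻¹ᵁ O)) :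
    W.kap O (φ.hom.app _ s) = φ.hom.app O (V.kap O s) :=
  congr(($(φ.comm).app O) s)

/-- A morphism of `κ`-sheaves from its action on sections. -/
def homOfKap (φ : V.sheaf ⟶ W.sheaf) (h : ∀ (O : (prod Λ X).Opens)
    (s : Γ(V.sheaf, prodFrob Λ X ⁻¹ᵁ O)), W.kap O (φ.app _ s) = φ.app O (V.kap O s)) : V ⟶ W :=
  ⟨φ, hom_ext_apply h⟩

/-- The morphism `κ` from its action on sections. -/
def mkκ (M : (prod Λ X).Modules)
    (κ : ∀ O : (prod Λ X).Opens, Γ(M, prodFrob Λ X ⁻¹ᵁ O) →+ Γ(M, O))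
    (hres : ∀ (O O' : (prod Λ X).Opens) (h : O' ≤ O) (s : Γ(M, prodFrob Λ X ⁻¹ᵁ O)),
      κ O' (res M (Scheme.Hom.preimage_mono _ h) s) = res M h (κ O s))
    (hsmul : ∀ (O : (prod Λ X).Opens) (r : Γ(prod Λ X, O)) (s : Γ(M, prodFrob Λ X ⁻¹ᵁ O)),
      κ O ((prodFrob Λ X).app O r • s) = r • κ O s) :
    (Scheme.Modules.pushforward (prodFrob Λ X)).obj M ⟶ M :=
  homOfApp (M := (Scheme.Modules.pushforward (prodFrob Λ X)).obj M) κ hres hsmul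

theorem pushforward_kap (f : Y ⟶ X) [QuasiCompact f.left] [QuasiSeparated f.left]
    (W : CartierSheaf Λ Y) (O : (prod Λ X).Opens)
    (s : Γ(W.sheaf, prodMap Λ f ⁻¹ᵁ (prodFrob Λ X ⁻¹ᵁ O))) :
    ((pushforward Λ f).obj W).kap O s = W.kap (prodMap Λ f ⁻¹ᵁ O)
      (res W.sheaf (prodFrob_preimage_prodMap_preimage f O).le s) :=
  pushforward_swap_app (prodMap Λ f) (prodFrob Λ X) (prodFrob Λ Y) (prodMap Λ f) (prodMap_frob Λ f)
    W.κ O s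

end Kappa

instance : HasZeroObject (CartierSheaf Λ X) := by
  obtain ⟨Z, hZ⟩ := HasZeroObject.zero (C := (prod Λ X).Modules)
  refine ⟨⟨Z, isQuasicoherent_of_isZero hZ, 0⟩, ⟨fun W => ⟨⟨⟨0⟩, fun f => ?_⟩⟩, fun W => ⟨⟨⟨0⟩, fun f => ?_⟩⟩⟩⟩
  · ext1
    exact hZ.eq_of_src _ _
  · ext1
    exact hZ.eq_of_tgt _ _

/-- The direct sum of two `κ`-sheaves. -/
def sum (V W : CartierSheaf Λ X) : CartierSheaf Λ X where
  sheaf := V.sheaf ⊞ W.sheaf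
  isQuasicoherent :=
    have := V.isQuasicoherent
    have := W.isQuasicoherent
    isQuasicoherent_of_sum _ _ _ _ (biprod.total (X := V.sheaf) (Y := W.sheaf))
  κ := (Scheme.Modules.pushforward (prodFrob Λ X)).map biprod.fst ≫ V.κ ≫ biprod.inl +
    (Scheme.Modules.pushforward (prodFrob Λ X)).map biprod.snd ≫ W.κ ≫ biprod.inr

instance : HasBinaryBiproducts (CartierSheaf Λ X) where
  has_binary_biproduct V W := by
    refine hasBinaryBiproduct_of_total
      { pt := sum V W
        fst := ⟨biprod.fst, by simp [sum]⟩
        snd := ⟨biprod.snd, by simp [sum]⟩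
        inl := ⟨biprod.inl, by simp [sum, ← Functor.map_comp_assoc]⟩
        inr := ⟨biprod.inr, by simp [sum, ← Functor.map_comp_assoc]⟩
        inl_fst := hom_ext biprod.inl_fst
        inl_snd := hom_ext biprod.inl_snd
        inr_fst := hom_ext biprod.inr_fst
        inr_snd := hom_ext biprod.inr_snd } (hom_ext biprod.total)

/-- The abelian group of sections over `O`. -/
def sectionsFunctor (O : (prod Λ X).Opens) : CartierSheaf Λ X ⥤ AddCommGrpCat.{u} :=
  forget ⋙ Scheme.Modules.toPresheaf _ ⋙ (evaluation _ _).obj (op O)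

instance (O : (prod Λ X).Opens) : (sectionsFunctor (Λ := Λ) O).Additive where
  map_add := rfl

section Extend

instance quasiCompact_prodOpen_ι [IsNoetherian X.left] (U : X.left.Opens) :
    QuasiCompact (prodOpen Λ U).ι :=
  MorphismProperty.of_isPullback (P := @QuasiCompact)
    (isPullback_morphismRestrict (prodFst Λ X) U) inferInstance

/-- The action of `κ` on the sections of `extend (prodOpen Λ U) V`. -/
def extendKap (U : X.left.Opens) (V : CartierSheaf Λ X) (O : (prod Λ X).Opens) :
    Γ((extend (prodOpen Λ U)).obj V.sheaf, prodFrob Λ X ⁻¹ᵁ O) →+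
      Γ((extend (prodOpen Λ U)).obj V.sheaf, O) :=
  extendSections.symm.toAddMonoidHom.comp ((V.kap (cap (prodOpen Λ U) O)).comp
    ((res V.sheaf (cap_prodFrob_preimage U O).ge).comp extendSections.toAddMonoidHom))

theorem extendSections_extendKap (U : X.left.Opens) (V : CartierSheaf Λ X) (O : (prod Λ X).Opens)
    (s : Γ((extend (prodOpen Λ U)).obj V.sheaf, prodFrob Λ X ⁻¹ᵁ O)) :
    extendSections (extendKap U V O s) = V.kap (cap (prodOpen Λ U) O)
      (res V.sheaf (cap_prodFrob_preimage U O).ge (extendSections s)) :=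
  extendSections.apply_symm_apply _

theorem extendKap_res (U : X.left.Opens) (V : CartierSheaf Λ X) (O O' : (prod Λ X).Opens)
    (h : O' ≤ O) (s : Γ((extend (prodOpen Λ U)).obj V.sheaf, prodFrob Λ X ⁻¹ᵁ O)) :
    extendKap U V O' (res _ (Scheme.Hom.preimage_mono _ h) s) =
      res _ h (extendKap U V O s) := by
  apply extendSections.injective
  rw [extendSections_res, extendSections_extendKap, extendSections_extendKap, ← kap_res, res_res,
    extendSections_res, res_res]

theorem resO_app {Z Z' : Scheme.{u}} (f : Z ⟶ Z') {O O' : Z'.Opens} (h : O' ≤ O) (r : Γ(Z', O)) :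
    resO (f.preimage_mono h) (f.app O r) = f.app O' (resO h r) :=
  congr($(f.naturality (homOfLE h).op) r).symm

theorem extendKap_smul (U : X.left.Opens) (V : CartierSheaf Λ X) (O : (prod Λ X).Opens)
    (r : Γ(prod Λ X, O)) (s : Γ((extend (prodOpen Λ U)).obj V.sheaf, prodFrob Λ X ⁻¹ᵁ O)) :
    extendKap U V O ((prodFrob Λ X).app O r • s) = r • extendKap U V O s := by
  apply extendSections.injective
  rw [extendSections_extendKap, extendSections_smul, extendSections_smul,
    extendSections_extendKap, res_smul, resO_resO, ← kap_smul, ← resO_app]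

theorem extendKap_map (U : X.left.Opens) {V W : CartierSheaf Λ X} (φ : V ⟶ W)
    (O : (prod Λ X).Opens) (s : Γ((extend (prodOpen Λ U)).obj V.sheaf, prodFrob Λ X ⁻¹ᵁ O)) :
    extendKap U W O (((extend (prodOpen Λ U)).map φ.hom).app _ s) =
      ((extend (prodOpen Λ U)).map φ.hom).app O (extendKap U V O s) := by
  apply extendSections.injective
  rw [extendSections_map, extendSections_extendKap, extendSections_extendKap, ← hom_kap, app_res,
    extendSections_map]

theorem extendKap_toExtend (U : X.left.Opens) (V : CartierSheaf Λ X) (O : (prod Λ X).Opens)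
    (s : Γ(V.sheaf, prodFrob Λ X ⁻¹ᵁ O)) :
    extendKap U V O ((toExtend (prodOpen Λ U) V.sheaf).app _ s) =
      (toExtend (prodOpen Λ U) V.sheaf).app O (V.kap O s) := by
  apply extendSections.injective
  rw [extendSections_extendKap, extendSections_toExtend, extendSections_toExtend, ← kap_res,
    res_res]

variable [IsNoetherian X.left]

/-- The restriction of a `κ`-sheaf to `U × C`, pushed forward to `X × C`. -/
def extendObj (U : X.left.Opens) (V : CartierSheaf Λ X) : CartierSheaf Λ X where
  sheaf := (extend (prodOpen Λ U)).obj V.sheaf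
  isQuasicoherent :=
    have := V.isQuasicoherent
    inferInstance
  κ := mkκ _ (extendKap U V) (extendKap_res U V) (extendKap_smul U V)

/-- The functor `V ↦ j_* j^* V` on `κ`-sheaves, `j` the inclusion of `U × C` into `X × C`. -/
def extendFunctor (U : X.left.Opens) : CartierSheaf Λ X ⥤ CartierSheaf Λ X where
  obj V := extendObj U V
  map φ := homOfKap ((extend (prodOpen Λ U)).map φ.hom) (extendKap_map U φ)
  map_id V := by
    ext1
    exact (extend (prodOpen Λ U)).map_id _
  map_comp φ ψ := by
    ext1
    exact (extend (prodOpen Λ U)).map_comp _ _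

instance (U : X.left.Opens) : (extendFunctor (Λ := Λ) U).Additive where
  map_add := by
    intros
    ext1
    exact hom_ext_apply fun O s => rfl

/-- The unit `V ⟶ j_* j^* V`: the restriction of sections. -/
def extendUnit (U : X.left.Opens) : 𝟭 (CartierSheaf Λ X) ⟶ extendFunctor U where
  app V := homOfKap (V := V) (W := extendObj U V) (toExtend _ V.sheaf) (extendKap_toExtend U V)
  naturality V W φ := by
    ext1
    exact toExtend_naturality _ φ.hom

/-- Sections of `j_* j^* V` over `O` are sections of `V` over `(U × C) ∩ O`; the equality of
functors holds by definition. -/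
theorem extendFunctor_sections (U : X.left.Opens) (O : (prod Λ X).Opens) :
    extendFunctor U ⋙ sectionsFunctor O = sectionsFunctor (Λ := Λ) (cap (prodOpen Λ U) O) := rfl

end Extend

end CartierSheaf

end CartierSheaves

/-! ### Quasi-isomorphisms of complexes of quasi-coherent sheaves -/

namespace CartierSheaves

section Cone

open CochainComplex

universe w v' u'
variable {C : Type u'} [Category.{v'} C] [Preadditive C] {G : C ⥤ AddCommGrpCat.{w}} [G.Additive]
  {K L : CochainComplex C ℤ}

theorem ev_d_eq_zero {q r : ℤ} (h : q + 1 = r) {z : G.obj (K.X q)} (hz : ev G (K.d q r) z = 0)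
    (s : ℤ) : ev G (K.d q s) z = 0 := by
  by_cases hs : q + 1 = s
  · obtain rfl := h.symm.trans hs
    exact hz
  · rw [K.shape q s hs, ev_zero]

variable [HasBinaryBiproducts C]

omit [G.Additive] in
theorem cocone_fst_d (φ : K ⟶ L) (p q : ℤ) (z : G.obj ((mappingCocone φ).X p)) :
    ev G ((mappingCocone.fst φ).f q) (ev G ((mappingCocone φ).d p q) z) =
      ev G (K.d p q) (ev G ((mappingCocone.fst φ).f p) z) :=
  (ev_d (mappingCocone.fst φ) p q z).symm

/-- The cocone of a quasi-isomorphism is acyclic, on elements. -/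
theorem QIso.exact_cocone {φ : K ⟶ L} (h : QIso G φ) {p q r : ℤ} (hpq : p + 1 = q)
    (hqr : q + 1 = r) (z : G.obj ((mappingCocone φ).X q))
    (hz : ev G ((mappingCocone φ).d q r) z = 0) : ∃ y, ev G ((mappingCocone φ).d p q) y = z := by
  obtain ⟨o, ho⟩ : ∃ o : ℤ, o + 1 = p := ⟨p - 1, by omega⟩
  have hq : q + -1 = p := by omega
  have hp : p + -1 = o := by omega
  have h1 : ev G (K.d q r) (ev G ((mappingCocone.fst φ).f q) z) = 0 := by
    rw [← cocone_fst_d, hz, map_zero]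
  have h2 := cocone_snd_d φ q r p hqr hq z
  rw [hz, map_zero, eq_comm, neg_eq_zero] at h2
  set x := ev G ((mappingCocone.fst φ).f q) z with hx
  set y := ev G ((mappingCocone.snd φ).v q p hq) z with hy
  obtain ⟨w, hw⟩ := h.inj p q hpq x (ev_d_eq_zero hqr h1) (-y) (by
    rw [map_neg]
    exact eq_neg_of_add_eq_zero_left h2)
  obtain ⟨c, hc, e, he⟩ := h.surj o p ho (y + ev G (φ.f p) w) (ev_d_eq_zero hpq (by
    rw [map_add, ev_d, hw, add_comm, h2]))
  obtain ⟨v, hv1, hv2⟩ := cocone_mk φ p o hp (w - c) (-e)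
  refine ⟨v, cocone_ext φ q p hq ?_ ?_⟩
  · rw [cocone_fst_d, hv1, map_sub, hw, hc, sub_zero]
  · rw [cocone_snd_d φ p q o hpq hp, hv1, hv2, map_sub, map_neg, ← hy]
    have : ev G (φ.f p) w = ev G (φ.f p) c + ev G (L.d o p) e - y := by
      rw [he]
      abel
    rw [this]
    abel

/-- A chain map with acyclic cocone is a quasi-isomorphism, on elements. -/
theorem QIso.of_exact_cocone {φ : K ⟶ L} (h : ∀ p q r : ℤ, p + 1 = q → q + 1 = r →
    ∀ z : G.obj ((mappingCocone φ).X q), ev G ((mappingCocone φ).d q r) z = 0 →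
      ∃ y, ev G ((mappingCocone φ).d p q) y = z) : QIso G φ := by
  refine ⟨fun p q hpq z hz w hw => ?_, fun p q hpq z hz => ?_⟩
  · have hq : q + -1 = p := by omega
    obtain ⟨v, hv1, hv2⟩ := cocone_mk φ q p hq z (-w)
    obtain ⟨y, hy⟩ := h p q (q + 1) hpq rfl v (by
      refine cocone_ext φ _ q (by omega) ?_ ?_
      · rw [cocone_fst_d, hv1, hz, map_zero]
      · rw [cocone_snd_d φ q (q + 1) p rfl hq, hv1, hv2, hw, map_neg, add_neg_cancel, neg_zero,
          map_zero])
    exact ⟨ev G ((mappingCocone.fst φ).f p) y, by rw [← cocone_fst_d, hy, hv1]⟩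
  · obtain ⟨v, hv1, hv2⟩ := cocone_mk φ (q + 1) q (by omega) 0 z
    obtain ⟨y, hy⟩ := h q (q + 1) (q + 1 + 1) rfl rfl v (by
      refine cocone_ext φ _ (q + 1) (by omega) ?_ ?_
      · rw [cocone_fst_d, hv1, map_zero, map_zero]
      · rw [cocone_snd_d φ (q + 1) _ q rfl (by omega), hv1, hv2, hz, map_zero, add_zero, neg_zero,
          map_zero])
    have hp : q + -1 = p := by omega
    refine ⟨-ev G ((mappingCocone.fst φ).f q) y, ev_d_eq_zero rfl ?_,
      -ev G ((mappingCocone.snd φ).v q p hp) y, ?_⟩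
    · rw [map_neg, ← cocone_fst_d, hy, hv1, neg_zero]
    · rw [← hv2, ← hy, cocone_snd_d φ q (q + 1) p rfl hp, map_neg, map_neg, neg_add]

end Cone

section Abelian

universe v' u'
variable {C : Type u'} [Category.{v'} C] [Abelian C] {K L : CochainComplex C ℤ}

/-- A chain map is a quasi-isomorphism if and only if its mapping cocone is acyclic. -/
theorem quasiIso_iff_exactAt_cocone (φ : K ⟶ L) :
    HomologicalComplex.quasiIso C (.up ℤ) φ ↔
      ∀ n, (CochainComplex.mappingCocone φ).ExactAt n := by
  have h0 : HomologicalComplex.quasiIso C (.up ℤ) φ ↔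
      HomotopyCategory.quasiIso C (.up ℤ) ((HomotopyCategory.quotient C (.up ℤ)).map φ) :=
    (HomotopyCategory.quotient_map_mem_quasiIso_iff φ).symm
  rw [h0, HomotopyCategory.quasiIso_eq_trW_subcategoryAcyclic]
  have h1 := ObjectProperty.trW_iff_of_distinguished (HomotopyCategory.subcategoryAcyclic C) _
    (HomotopyCategory.mappingCone_triangleh_distinguished φ)
  refine h1.trans ?_
  rw [← HomotopyCategory.quotient_obj_mem_subcategoryAcyclic_iff_exactAt]
  have h2 := ObjectProperty.prop_shift_iff_of_isStableUnderShift
    (HomotopyCategory.subcategoryAcyclic C)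
    ((HomotopyCategory.quotient C (.up ℤ)).obj (CochainComplex.mappingCone φ)) (-1 : ℤ)
  refine h2.symm.trans ?_
  exact (HomotopyCategory.subcategoryAcyclic C).prop_iff_of_iso
    (((HomotopyCategory.quotient C (.up ℤ)).commShiftIso (-1 : ℤ)).app _).symm

end Abelian

section Modules

variable {X : Scheme.{u}} {K L : CochainComplex X.Modules ℤ}

/-- The abelian group of sections of a sheaf of modules over `O`. -/
def moduleSections (O : X.Opens) : X.Modules ⥤ AddCommGrpCat.{u} :=
  Scheme.Modules.toPresheaf _ ⋙ (evaluation _ _).obj (op O)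

instance (O : X.Opens) : (moduleSections O).Additive where
  map_add := rfl

theorem exactAt_iff_sections (n m p : ℤ) (h : n + 1 = m) (h' : m + 1 = p) : K.ExactAt m ↔
    ∀ (U : X.Opens) (z : (moduleSections U).obj (K.X m)), ev (moduleSections U) (K.d m p) z = 0 →
      ∀ x ∈ U, ∃ (V : X.Opens) (hV : V ≤ U), x ∈ V ∧
        ∃ y, ev (moduleSections V) (K.d n m) y = res (K.X m) hV z := by
  rw [K.exactAt_iff' n m p (by simp; omega) (by simp; omega), exact_iff_sections]
  rfl

/-- A chain map inducing quasi-isomorphisms on sections over arbitrarily small open subsets is a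
quasi-isomorphism. -/
theorem quasiIso_of_sections (φ : K ⟶ L) (h : ∀ (U : X.Opens), ∀ x ∈ U, ∃ V ≤ U, x ∈ V ∧
    QIso (moduleSections V) φ) : HomologicalComplex.quasiIso X.Modules (.up ℤ) φ := by
  rw [quasiIso_iff_exactAt_cocone]
  intro n
  rw [exactAt_iff_sections (n - 1) n (n + 1) (by omega) rfl]
  intro U z hz x hx
  obtain ⟨V, hV, hxV, hφ⟩ := h U x hx
  refine ⟨V, hV, hxV, hφ.exact_cocone (by omega) rfl _ ?_⟩
  have := app_res ((CochainComplex.mappingCocone φ).d n (n + 1)) hV z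
  refine Eq.trans this ?_
  exact (congrArg _ hz).trans (map_zero _)

/-- A quasi-isomorphism of complexes of quasi-coherent sheaves is a quasi-isomorphism on sections
over affine open subsets. -/
theorem qIso_of_quasiIso (φ : K ⟶ L) (h : HomologicalComplex.quasiIso X.Modules (.up ℤ) φ)
    (hK : ∀ n, (K.X n).IsQuasicoherent) (hL : ∀ n, (L.X n).IsQuasicoherent) {U : X.Opens}
    (hU : IsAffineOpen U) : QIso (moduleSections U) φ := by
  rw [quasiIso_iff_exactAt_cocone] at h
  have hQ (n : ℤ) : ((CochainComplex.mappingCocone φ).X n).IsQuasicoherent := by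
    have := hK n
    have := hL (n + -1)
    exact isQuasicoherent_of_sum _ _ _ _ (CochainComplex.mappingCocone.id_X φ n (n + -1) rfl)
  refine QIso.of_exact_cocone fun p q r hpq hqr z hz => ?_
  have := hQ p
  have := hQ q
  exact exact_of_isAffineOpen ((CochainComplex.mappingCocone φ).d p q) hU z
    ((exactAt_iff_sections p q r hpq hqr).1 (h q) U z hz)

end Modules

end CartierSheaves

/-! ### The Čech resolution and the derived pushforward -/

namespace CartierSheaves

section Local

variable {X : Scheme.{u}}

theorem res_bijective_of_eq (M : X.Modules) {O O' : X.Opens} (h : O' ≤ O) (e : O = O') :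
    Function.Bijective (res M h) := by
  subst e
  have : ⇑(res M h) = id := funext fun s => res_self M h s
  rw [this]
  exact Function.bijective_id

/-- The sections of `M` over open subsets of `V` only depend on their restrictions to `Ω`. -/
def IsLocalOn (Ω V : X.Opens) (M : X.Modules) : Prop :=
  ∀ (O O' : X.Opens) (h : O' ≤ O), O ≤ V → O' = Ω ⊓ O → Function.Bijective (res M h)

theorem IsLocalOn.mono {Ω V V' : X.Opens} (h : V' ≤ V) {M : X.Modules} (hM : IsLocalOn Ω V M) :
    IsLocalOn Ω V' M :=
  fun O O' hO hV => hM O O' hO (hV.trans h)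

theorem isLocalOn_of_le {Ω V : X.Opens} (h : V ≤ Ω) (M : X.Modules) : IsLocalOn Ω V M :=
  fun O O' hO hV e => res_bijective_of_eq M hO (by rw [e, inf_eq_right.2 (hV.trans h)])

theorem IsLocalOn.sum {Ω V : X.Opens} {M N Z : X.Modules} {p : Z ⟶ M} {i : M ⟶ Z} {q : Z ⟶ N}
    {j : N ⟶ Z} (h : p ≫ i + q ≫ j = 𝟙 Z) (hM : IsLocalOn Ω V M) (hN : IsLocalOn Ω V N) :
    IsLocalOn Ω V Z := by
  have key (U : X.Opens) (s : Γ(Z, U)) : i.app U (p.app U s) + j.app U (q.app U s) = s := by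
    rw [← comp_app_apply, ← comp_app_apply, ← app_add_apply, h]
    rfl
  intro O O' hO hV e
  refine ⟨fun s t hst => ?_, fun s => ?_⟩
  · have h1 := (hM O O' hO hV e).1 (show res M hO (p.app O s) = res M hO (p.app O t) by
      rw [← app_res, hst, app_res])
    have h2 := (hN O O' hO hV e).1 (show res N hO (q.app O s) = res N hO (q.app O t) by
      rw [← app_res, hst, app_res])
    rw [← key O s, ← key O t, h1, h2]
  · obtain ⟨a, ha⟩ := (hM O O' hO hV e).2 (p.app O' s)
    obtain ⟨b, hb⟩ := (hN O O' hO hV e).2 (q.app O' s)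
    exact ⟨i.app O a + j.app O b, by rw [map_add, ← app_res, ← app_res, ha, hb, key]⟩

theorem isLocalOn_of_isZero {Ω V : X.Opens} {M : X.Modules} (hM : IsZero M) :
    IsLocalOn Ω V M := by
  have h (U : X.Opens) (s : Γ(M, U)) : s = 0 := by
    change (𝟙 M : M ⟶ M).app U s = 0
    rw [hM.eq_of_src (𝟙 M) 0]
    rfl
  exact fun O O' hO _ _ => ⟨fun s t _ => (h _ s).trans (h _ t).symm, fun s => ⟨0, by rw [h _ s,
    map_zero]⟩⟩

theorem IsLocalOn.extend {Ω Ω' V : X.Opens} {M : X.Modules} (hM : IsLocalOn Ω V M) :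
    IsLocalOn Ω V ((extend Ω').obj M) :=
  fun O O' h hV e => hM (cap Ω' O) (cap Ω' O') (cap_mono _ h) ((cap_le _ _).trans hV) (by
    rw [e, cap_eq, cap_eq, inf_left_comm])

theorem isLocalOn_extend (Ω V : X.Opens) (M : X.Modules) : IsLocalOn Ω V ((extend Ω).obj M) :=
  fun O O' h _ e => res_bijective_of_eq M (cap_mono Ω h) (by
    rw [e, cap_eq, cap_eq, inf_left_idem])

end Local

section Affine

/-- The morphism from an affine scheme to a separated scheme is affine. -/
theorem isAffineOpen_cap_preimage {X Y : Scheme.{u}} [X.IsSeparated] (g : Y ⟶ X) {U : Y.Opens}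
    (hU : IsAffineOpen U) {O : X.Opens} (hO : IsAffineOpen O) : IsAffineOpen (cap U (g ⁻¹ᵁ O)) := by
  have : IsAffine U := hU
  have : IsAffineHom ((U.ι ≫ g) ≫ terminal.from X) := inferInstance
  have : IsAffineHom (U.ι ≫ g) := IsAffineHom.of_comp _ (terminal.from X)
  have h : IsAffineOpen ((U.ι ≫ g) ⁻¹ᵁ O) := hO.preimage _
  exact h.image_of_isOpenImmersion U.ι

variable {k : Type u} [Field k] {Λ : Type u} [CommRing Λ] [Algebra k Λ]
  {X : Over (Spec (.of k))}

instance isSeparated_prod [IsSeparated X.hom] : (prod Λ X).IsSeparated := by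
  refine ⟨?_⟩
  have : IsSeparated (pullback.snd X.hom (Spec.map (CommRingCat.ofHom (algebraMap k Λ))) ≫
    terminal.from _) := inferInstance
  rwa [terminal.comp_from] at this

theorem isAffineOpen_prodOpen {U : X.left.Opens} (hU : IsAffineOpen U) :
    IsAffineOpen (prodOpen Λ U) := by
  have : IsAffineHom (prodFst Λ X) :=
    MorphismProperty.of_isPullback (IsPullback.of_hasPullback X.hom
      (Spec.map (CommRingCat.ofHom (algebraMap k Λ)))).flip inferInstance
  exact hU.preimage (prodFst Λ X)

end Affine

namespace CartierSheaf

variable {k : Type u} [Field k] [Finite k] {Λ : Type u} [CommRing Λ] [Algebra k Λ]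
  {X Y : Over (Spec (.of k))}

variable (Λ) in
/-- The Čech complex of a complex of `κ`-sheaves with respect to the open subsets `U i × C`. -/
abbrev sheafCech [IsNoetherian X.left] {ι : Type*} (U : ι → X.left.Opens) (l : List ι) :
    Coaugmented (CartierSheaf Λ X) :=
  cech (fun i => extendFunctor (U i)) (fun i => extendUnit (U i)) l

section

variable [IsNoetherian X.left] {ι : Type*} {U : ι → X.left.Opens}

theorem bijective_extendUnit {j : ι} {p : (prod Λ X).Opens} {V : CartierSheaf Λ X}
    (h : IsLocalOn (prodOpen Λ (U j)) p V.sheaf) :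
    Function.Bijective (ev (sectionsFunctor p) ((extendUnit (U j)).app V)) :=
  h p _ (cap_le (prodOpen Λ (U j)) p) le_rfl (cap_eq _ _)

omit [AlgebraicGeometry.IsNoetherian X.left] in
theorem closedUnderSums_isLocalOn (Ω p : (prod Λ X).Opens) :
    ClosedUnderSums fun V : CartierSheaf Λ X => IsLocalOn Ω p V.sheaf :=
  fun _ _ _ _ _ _ _ h hV hW => IsLocalOn.sum (congrArg Hom.hom h) hV hW

omit [AlgebraicGeometry.IsNoetherian X.left] in
theorem isZero_sheaf {V : CartierSheaf Λ X} (h : IsZero V) : IsZero V.sheaf := by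
  rw [IsZero.iff_id_eq_zero]
  exact congrArg Hom.hom (h.eq_of_src (𝟙 V) 0)

omit [AlgebraicGeometry.IsNoetherian X.left] in
theorem quasiIso_of_qIso {K L : CochainComplex (CartierSheaf Λ X) ℤ} (φ : K ⟶ L)
    (h : ∀ (O : (prod Λ X).Opens), ∀ x ∈ O, ∃ V ≤ O, x ∈ V ∧ QIso (sectionsFunctor V) φ) :
    quasiIso Λ X φ := by
  refine quasiIso_of_sections _ fun O x hx => ?_
  obtain ⟨V, hV, hxV, hφ⟩ := h O x hx
  exact ⟨V, hV, hxV, ⟨hφ.inj, hφ.surj⟩⟩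

omit [AlgebraicGeometry.IsNoetherian X.left] in
theorem qIso_of_isAffineOpen {K L : CochainComplex (CartierSheaf Λ X) ℤ} {φ : K ⟶ L}
    (h : quasiIso Λ X φ) {O : (prod Λ X).Opens} (hO : IsAffineOpen O) :
    QIso (sectionsFunctor O) φ := by
  have := qIso_of_quasiIso _ h (fun n => (K.X n).isQuasicoherent)
    (fun n => (L.X n).isQuasicoherent) hO
  exact ⟨this.inj, this.surj⟩

/-- Over open subsets of a member `U j × C` of the covering, the restriction to `U j × C` is the
identity, so that the Čech complex is contractible there. -/
theorem qIso_sheafCech_η {j : ι} {l : List ι} (hj : j ∈ l) {p : (prod Λ X).Opens}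
    (hp : p ≤ prodOpen Λ (U j)) (K : CochainComplex (CartierSheaf Λ X) ℤ) :
    QIso (sectionsFunctor p) ((sheafCech Λ U l).η.app K) := by
  have hM : ∀ n, IsLocalOn (prodOpen Λ (U j)) p (K.X n).sheaf :=
    fun n => isLocalOn_of_le hp (K.X n).sheaf
  refine qIso_cech_η (j := j) (Γ := sectionsFunctor) (t := fun i p => cap (prodOpen Λ (U i)) p)
    (fun i p => extendFunctor_sections (U i) p)
    (fun p V => IsLocalOn (prodOpen Λ (U j)) p V.sheaf) ?_ ?_ ?_ ?_ ?_ hj p hM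
  · exact fun p => closedUnderSums_isLocalOn _ p
  · exact fun _ _ h => isLocalOn_of_isZero (isZero_sheaf h)
  · exact fun _ _ _ h => h.extend
  · exact fun _ _ _ h => h.mono (cap_le _ _)
  · exact fun _ _ h => bijective_extendUnit h

/-- The Čech complex of a covering is a resolution. -/
theorem quasiIso_sheafCech_η (l : List ι) (hl : ∀ x, ∃ i ∈ l, x ∈ U i)
    (K : CochainComplex (CartierSheaf Λ X) ℤ) : quasiIso Λ X ((sheafCech Λ U l).η.app K) := by
  apply quasiIso_of_qIso
  intro O x hx
  obtain ⟨j, hj, hxj⟩ := hl (prodFst Λ X x)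
  have hxj' : x ∈ prodOpen Λ (U j) := hxj
  exact ⟨prodOpen Λ (U j) ⊓ O, inf_le_right, ⟨hxj', hx⟩, qIso_sheafCech_η hj inf_le_left K⟩

end

section Pushforward

variable [IsNoetherian Y.left] [IsSeparated X.hom] [IsSeparated Y.hom]
  (f : Y ⟶ X) [QuasiCompact f.left] [QuasiSeparated f.left] {ι : Type*} {U : ι → Y.left.Opens}

/-- The functor on complexes induced by `f_*`. -/
abbrev pushforwardComplexes :
    CochainComplex (CartierSheaf Λ Y) ℤ ⥤ CochainComplex (CartierSheaf Λ X) ℤ :=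
  (pushforward Λ f).mapHomologicalComplex (.up ℤ)

omit [AlgebraicGeometry.IsNoetherian Y.left] [IsSeparated X.hom] [IsSeparated Y.hom] in
theorem quasiIso_pushforward_of_qIso {K L : CochainComplex (CartierSheaf Λ Y) ℤ} (φ : K ⟶ L)
    (h : ∀ O, IsAffineOpen O → QIso (sectionsFunctor (prodMap Λ f ⁻¹ᵁ O)) φ) :
    quasiIso Λ X ((pushforwardComplexes f).map φ) := by
  refine quasiIso_of_qIso _ fun O x hx => ?_
  obtain ⟨V, hV, hxV, hVO⟩ := exists_isAffineOpen_mem_and_subset (U := O) hx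
  exact ⟨V, hVO, hxV, ⟨(h V hV).inj, (h V hV).surj⟩⟩

/-- The pushforward of the Čech complex of an affine covering preserves quasi-isomorphisms. -/
theorem quasiIso_pushforward_sheafCech_map (hU : ∀ i, IsAffineOpen (U i)) (l : List ι)
    {K L : CochainComplex (CartierSheaf Λ Y) ℤ} {φ : K ⟶ L} (hφ : quasiIso Λ Y φ) :
    quasiIso Λ X ((pushforwardComplexes f).map ((sheafCech Λ U l).ρ.map φ)) := by
  refine quasiIso_pushforward_of_qIso f _ fun O hO => ?_
  refine qIso_cech_map (Γ := sectionsFunctor) (t := fun i p => cap (prodOpen Λ (U i)) p)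
    (fun i p => extendFunctor_sections (U i) p)
    (fun p => ∀ i, IsAffineOpen (cap (prodOpen Λ (U i)) p)) φ (fun p i hp j => ?_)
    (fun p i hp => qIso_of_isAffineOpen hφ (hp i)) l _ fun i => ?_
  · rw [cap_eq]
    exact (isAffineOpen_prodOpen (hU j)).inf (hp i)
  · exact isAffineOpen_cap_preimage (prodMap Λ f) (isAffineOpen_prodOpen (hU i)) hO

omit [IsSeparated X.hom] [IsSeparated Y.hom] in
/-- The pushforward inverts the coaugmentation of the Čech complex on Čech complexes. -/
theorem quasiIso_pushforward_sheafCech_η (l : List ι) (K : CochainComplex (CartierSheaf Λ Y) ℤ) :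
    quasiIso Λ X ((pushforwardComplexes f).map
      ((sheafCech Λ U l).η.app ((sheafCech Λ U l).ρ.obj K))) := by
  refine quasiIso_pushforward_of_qIso f _ fun O hO => ?_
  exact qIso_cech_η_cech (Γ := sectionsFunctor) (t := fun i p => cap (prodOpen Λ (U i)) p)
    (fun i p => extendFunctor_sections (U i) p)
    (fun j p V => IsLocalOn (prodOpen Λ (U j)) p V.sheaf)
    (fun j p => closedUnderSums_isLocalOn _ p) (fun _ _ _ h => isLocalOn_of_isZero (isZero_sheaf h))
    (fun _ _ _ _ h => h.extend) (fun _ _ _ _ h => h.mono (cap_le _ _))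
    (fun _ _ _ h => bijective_extendUnit h) _ (fun j V => isLocalOn_extend _ _ _)
    (fun _ h => h) K

/-- The derived pushforward exists and is computed by Čech complexes of affine coverings. -/
theorem exists_hasRightDerivedFunctor (hU : ∀ i, IsAffineOpen (U i)) (l : List ι)
    (hl : ∀ x, ∃ i ∈ l, x ∈ U i) :
    ∃ _ : (pushforwardDerived Λ f).HasRightDerivedFunctor (quasiIso Λ Y),
      Nonempty ((quasiIso Λ Y).Q ⋙ rightDerivedPushforward Λ f ≅
        (sheafCech Λ U l).ρ ⋙ pushforwardDerived Λ f) := by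
  obtain ⟨RF, α, h, ⟨e⟩⟩ := exists_isRightDerivedFunctor (quasiIso Λ Y)
    (F := pushforwardDerived Λ f) (sheafCech Λ U l).η (quasiIso_sheafCech_η l hl)
    (fun K L φ hφ => Localization.inverts (quasiIso Λ X).Q (quasiIso Λ X) _
      (quasiIso_pushforward_sheafCech_map f hU l hφ))
    (fun K => Localization.inverts (quasiIso Λ X).Q (quasiIso Λ X) _ (quasiIso_pushforward_sheafCech_η f (U := U) l K))
  have h' : (pushforwardDerived Λ f).HasRightDerivedFunctor (quasiIso Λ Y) :=
    Functor.HasRightDerivedFunctor.mk' RF α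
  have : (rightDerivedPushforward Λ f).IsRightDerivedFunctor
      ((pushforwardDerived Λ f).totalRightDerivedUnit (quasiIso Λ Y).Q (quasiIso Λ Y))
      (quasiIso Λ Y) := inferInstanceAs (((pushforwardDerived Λ f).totalRightDerived
        (quasiIso Λ Y).Q (quasiIso Λ Y)).IsRightDerivedFunctor _ _)
  refine ⟨h', ⟨Functor.isoWhiskerLeft _ ?_ ≪≫ e⟩⟩
  exact Functor.rightDerivedUnique _ _ ((pushforwardDerived Λ f).totalRightDerivedUnit
    (quasiIso Λ Y).Q (quasiIso Λ Y)) α (quasiIso Λ Y)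

end Pushforward

end CartierSheaf

end CartierSheaves

/-! ### Nil-coherent modules, and restriction of scalars -/

namespace CartierSheaves

section NilCoherent

variable {A N M Z : Type*} [CommRing A] [AddCommGroup N] [Module A N] [AddCommGroup M] [Module A M]
  [AddCommGroup Z] [Module A Z]

/-- The module analogue of a locally nil-coherent `κ`-sheaf: every element lies in a finitely
generated `κ`-stable submodule, and there is a finitely generated `κ`-stable submodule `L` such that
some power of `κ` maps the submodule generated by a given element into `L`. -/
structure IsNilCoherent (A : Type*) {N : Type*} [CommRing A] [AddCommGroup N] [Module A N]
    (κ : N →+ N) : Prop where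
  exists_mem (x : N) : ∃ P : Submodule A N, P.FG ∧ (∀ y ∈ P, κ y ∈ P) ∧ x ∈ P
  exists_iterate : ∃ L : Submodule A N, L.FG ∧ (∀ y ∈ L, κ y ∈ L) ∧
    ∀ x, ∃ m : ℕ, ∀ a : A, κ^[m] (a • x) ∈ L

theorem iterate_mem_of_le {κ : N →+ N} {L : Submodule A N} (hL : ∀ y ∈ L, κ y ∈ L) {m n : ℕ}
    (h : m ≤ n) {x : N} (hx : κ^[m] x ∈ L) : κ^[n] x ∈ L := by
  obtain ⟨e, rfl⟩ := Nat.exists_eq_add_of_le' h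
  rw [Function.iterate_add_apply]
  induction e with
  | zero => exact hx
  | succ e ih =>
    rw [Function.iterate_succ_apply']
    exact hL _ (ih (Nat.le_add_left _ _))

/-- The exponent can be chosen uniformly on a finitely generated submodule. The power of `κ` is not
linear, so the hypothesis has to concern all multiples of the given element. -/
theorem exists_iterate_mem_of_fg {κ : N →+ N} {L : Submodule A N} (hL : ∀ y ∈ L, κ y ∈ L)
    (h : ∀ x, ∃ m : ℕ, ∀ a : A, κ^[m] (a • x) ∈ L) {Q : Submodule A N} (hQ : Q.FG) :
    ∃ m : ℕ, ∀ y ∈ Q, κ^[m] y ∈ L := by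
  obtain ⟨t, rfl⟩ := hQ
  choose m hm using h
  refine ⟨t.sup m, fun y hy => ?_⟩
  rw [← one_smul A y]
  generalize (1 : A) = a
  induction hy using Submodule.span_induction generalizing a with
  | mem w hw => exact iterate_mem_of_le hL (Finset.le_sup hw) (hm w a)
  | zero => rw [smul_zero, iterate_map_zero]; exact zero_mem _
  | add u v _ _ hu hv => rw [smul_add, iterate_map_add]; exact add_mem (hu a) (hv a)
  | smul b u _ hu => rw [smul_smul]; exact hu _

theorem map_stable {κ : N →+ N} {κ' : M →+ M} {f : N →ₗ[A] M} (hf : Function.Semiconj f κ κ')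
    {L : Submodule A N} (hL : ∀ y ∈ L, κ y ∈ L) : ∀ y ∈ L.map f, κ' y ∈ L.map f := by
  rintro _ ⟨y, hy, rfl⟩
  exact ⟨κ y, hL y hy, hf y⟩

theorem sup_stable {κ : N →+ N} {L L' : Submodule A N} (hL : ∀ y ∈ L, κ y ∈ L)
    (hL' : ∀ y ∈ L', κ y ∈ L') : ∀ y ∈ L ⊔ L', κ y ∈ L ⊔ L' := by
  intro y hy
  obtain ⟨a, ha, b, hb, rfl⟩ := Submodule.mem_sup.1 hy
  rw [map_add]
  exact Submodule.add_mem_sup (hL a ha) (hL' b hb)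

/-- Nil-coherence of a direct sum, in the form used for `ClosedUnderSums`. -/
theorem IsNilCoherent.sum {κN : N →+ N} {κM : M →+ M} {κ : Z →+ Z} (hN : IsNilCoherent A κN)
    (hM : IsNilCoherent A κM) {p : Z →ₗ[A] N} {i : N →ₗ[A] Z} {q : Z →ₗ[A] M} {j : M →ₗ[A] Z}
    (h : ∀ z, i (p z) + j (q z) = z) (hi : Function.Semiconj i κN κ)
    (hj : Function.Semiconj j κM κ) : IsNilCoherent A κ := by
  refine ⟨fun x => ?_, ?_⟩
  · obtain ⟨P, hP, hP', hx⟩ := hN.exists_mem (p x)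
    obtain ⟨Q, hQ, hQ', hx'⟩ := hM.exists_mem (q x)
    exact ⟨P.map i ⊔ Q.map j, (hP.map i).sup (hQ.map j),
      sup_stable (map_stable hi hP') (map_stable hj hQ'), by
        rw [← h x]
        exact Submodule.add_mem_sup ⟨_, hx, rfl⟩ ⟨_, hx', rfl⟩⟩
  · obtain ⟨P, hP, hP', hx⟩ := hN.exists_iterate
    obtain ⟨Q, hQ, hQ', hx'⟩ := hM.exists_iterate
    refine ⟨P.map i ⊔ Q.map j, (hP.map i).sup (hQ.map j),
      sup_stable (map_stable hi hP') (map_stable hj hQ'), fun x => ?_⟩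
    obtain ⟨m, hm⟩ := hx (p x)
    obtain ⟨n, hn⟩ := hx' (q x)
    refine ⟨m ⊔ n, fun a => ?_⟩
    rw [← h (a • x), iterate_map_add κ]
    refine Submodule.add_mem_sup ?_ ?_
    · rw [← (hi.iterate_right _) _, map_smul]
      exact ⟨_, iterate_mem_of_le hP' le_sup_left (hm a), rfl⟩
    · rw [← (hj.iterate_right _) _, map_smul]
      exact ⟨_, iterate_mem_of_le hQ' le_sup_right (hn a), rfl⟩

theorem IsNilCoherent.of_equiv {κN : N →+ N} {κM : M →+ M} (hN : IsNilCoherent A κN)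
    (e : N ≃ₗ[A] M) (he : Function.Semiconj e κN κM) : IsNilCoherent A κM := by
  refine hN.sum hN (p := (e.symm : M →ₗ[A] N)) (i := (e : N →ₗ[A] M)) (q := (e.symm : M →ₗ[A] N))
    (j := 0) (fun z => by simp) he fun x => by simp

theorem isNilCoherent_of_subsingleton [Subsingleton N] (κ : N →+ N) : IsNilCoherent A κ :=
  ⟨fun _ => ⟨⊥, Submodule.fg_bot, fun y _ => (Subsingleton.elim _ _ : κ y = 0), Subsingleton.elim _ _⟩,
    ⊥, Submodule.fg_bot, fun y _ => (Subsingleton.elim _ _ : κ y = 0),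
      fun x => ⟨0, fun a => (Subsingleton.elim _ _ : a • x = 0)⟩⟩

end NilCoherent

section Box

variable {A B N : Type*} [CommRing A] [CommRing B] [Algebra A B] [AddCommGroup N] [Module A N]
  [Module B N] [IsScalarTower A B N] {ι J : Type*} [Fintype ι]

/-- The monomial with exponent `α`. -/
def monom (x : ι → B) (α : ι → ℕ) : B := ∏ i, x i ^ α i

theorem monom_add (x : ι → B) (α β : ι → ℕ) : monom x (α + β) = monom x α * monom x β := by
  simp [monom, pow_add, Finset.prod_mul_distrib]

theorem monom_zero (x : ι → B) : monom x 0 = 1 := by simp [monom]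

theorem monom_single [DecidableEq ι] (x : ι → B) (i : ι) : monom x (Pi.single i 1) = x i := by
  rw [monom, Finset.prod_eq_single i]
  · simp
  · intro j _ hj
    simp [hj]
  · simp

/-- The submodule generated by the products of a monomial with all exponents at most `d` and one
of the elements `y j`. -/
def box (A : Type*) {B N : Type*} [CommRing A] [CommRing B] [Algebra A B] [AddCommGroup N]
    [Module A N] [Module B N] (x : ι → B) (y : J → N) (d : ℕ) : Submodule A N :=
  Submodule.span A (Set.image2 (fun α j => monom x α • y j) (Set.Iic fun _ => d) Set.univ)

omit [IsScalarTower A B N] in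
theorem box_fg [Finite J] (x : ι → B) (y : J → N) (d : ℕ) : (box A x y d).FG := by
  classical
  exact Submodule.fg_span (Set.Finite.image2 _ (Set.finite_Iic _) Set.finite_univ)

omit [IsScalarTower A B N] in
theorem box_mono (x : ι → B) (y : J → N) {d e : ℕ} (h : d ≤ e) : box A x y d ≤ box A x y e :=
  Submodule.span_mono (Set.image2_subset_right (Set.Iic_subset_Iic.2 fun _ => h))

theorem monom_smul_mem_box (x : ι → B) (y : J → N) {α : ι → ℕ} {c d : ℕ} (hα : ∀ i, α i ≤ c) {z : N}
    (hz : z ∈ box A x y d) : monom x α • z ∈ box A x y (c + d) := by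
  induction hz using Submodule.span_induction with
  | mem z hz =>
    obtain ⟨β, hβ, j, -, rfl⟩ := hz
    refine Submodule.subset_span ⟨α + β, fun i => add_le_add (hα i) (hβ i), j, trivial, ?_⟩
    simp only [monom_add, mul_smul]
  | zero => rw [smul_zero]; exact zero_mem _
  | add u v _ _ hu hv => rw [smul_add]; exact add_mem hu hv
  | smul a u _ hu => rw [smul_comm]; exact Submodule.smul_mem _ _ hu

theorem exists_mem_box (x : ι → B) (hx : Algebra.adjoin A (Set.range x) = ⊤) (y : J → N) {z : N}
    (hz : z ∈ Submodule.span B (Set.range y)) : ∃ d, z ∈ box A x y d := by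
  classical
  induction hz using Submodule.span_induction with
  | mem z hz =>
    obtain ⟨j, rfl⟩ := hz
    refine ⟨0, Submodule.subset_span ⟨0, fun i => le_rfl, j, trivial, ?_⟩⟩
    simp only [monom_zero, one_smul]
  | zero => exact ⟨0, zero_mem _⟩
  | add u v _ _ hu hv =>
    obtain ⟨d, hd⟩ := hu
    obtain ⟨e, he⟩ := hv
    exact ⟨d ⊔ e, add_mem (box_mono x y le_sup_left hd) (box_mono x y le_sup_right he)⟩
  | smul b u _ hu =>
    have hb : b ∈ Algebra.adjoin A (Set.range x) := hx ▸ trivial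
    induction hb using Algebra.adjoin_induction generalizing u with
    | mem b hb =>
      obtain ⟨i, rfl⟩ := hb
      obtain ⟨d, hd⟩ := hu
      refine ⟨1 + d, ?_⟩
      rw [← monom_single x i]
      refine monom_smul_mem_box x y (fun k => ?_) hd
      by_cases h : k = i
      · subst h; simp
      · simp [h]
    | algebraMap a =>
      obtain ⟨d, hd⟩ := hu
      exact ⟨d, by rw [algebraMap_smul]; exact Submodule.smul_mem _ _ hd⟩
    | add b c _ _ hb hc =>
      obtain ⟨d, hd⟩ := hb u ‹_› hu
      obtain ⟨e, he⟩ := hc u ‹_› hu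
      exact ⟨d ⊔ e, by
        rw [add_smul]
        exact add_mem (box_mono x y le_sup_left hd) (box_mono x y le_sup_right he)⟩
    | mul b c _ _ hb hc =>
      rw [mul_smul]
      exact hb _ (Submodule.smul_mem _ _ ‹_›) (hc u ‹_› hu)

theorem exists_le_box (x : ι → B) (hx : Algebra.adjoin A (Set.range x) = ⊤) (y : J → N)
    {Q : Submodule A N} (hQ : Q.FG) (h : ∀ z ∈ Q, z ∈ Submodule.span B (Set.range y)) :
    ∃ d, Q ≤ box A x y d := by
  obtain ⟨s, rfl⟩ := hQ
  have hs : ∀ z : s, ∃ d, z.1 ∈ box A x y d := fun z =>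
    exists_mem_box x hx y (h z.1 (Submodule.subset_span z.2))
  choose d hd using hs
  refine ⟨⨆ z, d z, Submodule.span_le.2 fun z hz => ?_⟩
  exact box_mono x y (le_ciSup (Finite.bddAbove_range d) ⟨z, hz⟩) (hd ⟨z, hz⟩)

/-- A finite endomorphism `φ` makes `A` the sum of finitely many submodules `φ(A) a`. -/
theorem exists_finite_combination {φ : A →+* A} (hφ : φ.Finite) :
    ∃ (n : ℕ) (a : Fin n → A), ∀ r, ∃ b : Fin n → A, r = ∑ l, φ (b l) * a l := by
  obtain ⟨n, a, ha⟩ := @Module.Finite.exists_fin A A _ _ φ.toAlgebra.toModule hφ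
  refine ⟨n, a, fun r => ?_⟩
  have hr : r ∈ @Submodule.span A A _ _ φ.toAlgebra.toModule (Set.range a) := ha ▸ trivial
  obtain ⟨b, hb⟩ := (@Submodule.mem_span_range_iff_exists_fun (Fin n) A A _ _ _ φ.toAlgebra.toModule
    a r).1 hr
  exact ⟨b, hb.symm⟩

variable {φ : A →+* A} {ψ : B →+* B} {q : ℕ} {κ : N →+ N}

/-- Dividing all exponents by `q`, the operator `κ` contracts the filtration by the submodules
`box A x y d`. -/
theorem exists_map_box_le [Finite J] (hφ : φ.Finite)
    (hψ : ∀ a, ψ (algebraMap A B a) = algebraMap A B (φ a)) (hq : 0 < q) (x : ι → B)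
    (hx : Algebra.adjoin A (Set.range x) = ⊤) (hxq : ∀ i, ψ (x i) = x i ^ q)
    (hκ : ∀ (b : B) (n : N), κ (ψ b • n) = b • κ n) (y : J → N)
    (hy : ∀ z ∈ Submodule.span B (Set.range y), κ z ∈ Submodule.span B (Set.range y)) :
    ∃ c, ∀ d, ∀ z ∈ box A x y d, κ z ∈ box A x y (d / q + c) := by
  obtain ⟨n, a, ha⟩ := exists_finite_combination hφ
  have h1 (t : Fin n × (ι → Fin q) × J) :
      ∃ c, κ (a t.1 • monom x (fun i => (t.2.1 i : ℕ)) • y t.2.2) ∈ box A x y c := by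
    refine exists_mem_box x hx y (hy _ ?_)
    rw [← algebraMap_smul B]
    exact Submodule.smul_mem _ _ (Submodule.smul_mem _ _ (Submodule.subset_span ⟨_, rfl⟩))
  choose c hc using h1
  refine ⟨⨆ t, c t, fun d z hz => ?_⟩
  rw [← one_smul A z]
  generalize (1 : A) = r
  induction hz using Submodule.span_induction generalizing r with
  | mem z hz =>
    obtain ⟨α, hα, j, -, rfl⟩ := hz
    obtain ⟨b, rfl⟩ := ha r
    -- Division with remainder of the exponents: `x ^ α = ψ (x ^ (α / q)) * x ^ (α % q)`, and
    -- finitely many remainders occur.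
    have e1 : monom x α = ψ (monom x fun i => α i / q) * monom x fun i => α i % q := by
      have e2 : ψ (monom x fun i => α i / q) = monom x fun i => q * (α i / q) := by
        simp [monom, hxq, pow_mul]
      rw [e2, ← monom_add]
      congr 1
      funext i
      exact (Nat.div_add_mod _ _).symm
    rw [Finset.sum_smul, map_sum]
    refine sum_mem fun l _ => ?_
    have e3 : (φ (b l) * a l) • monom x α • y j = ψ (algebraMap A B (b l) * monom x fun i => α i / q) •
        (a l • monom x (fun i => α i % q) • y j) := by
      rw [e1, map_mul, hψ, mul_smul, mul_smul, mul_smul, algebraMap_smul, smul_comm (a l)]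
    rw [e3, hκ, mul_smul, algebraMap_smul]
    refine Submodule.smul_mem _ _ (monom_smul_mem_box x y (fun i => Nat.div_le_div_right (hα i)) ?_)
    exact box_mono x y (le_ciSup (Finite.bddAbove_range c) (l, fun i => ⟨α i % q, Nat.mod_lt _ hq⟩, j))
      (hc (l, fun i => ⟨α i % q, Nat.mod_lt _ hq⟩, j))
  | zero => rw [smul_zero, map_zero]; exact zero_mem _
  | add u v _ _ hu hv => rw [smul_add, map_add]; exact add_mem (hu r) (hv r)
  | smul s u _ hu => rw [smul_smul]; exact hu _

/-- A finitely generated `κ`-stable `B`-submodule is exhausted by finitely generated `κ`-stable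
`A`-submodules, each of which is mapped into a fixed one by some power of `κ`. -/
theorem exists_stable_box [Finite J] (hφ : φ.Finite)
    (hψ : ∀ a, ψ (algebraMap A B a) = algebraMap A B (φ a)) (hq : 2 ≤ q) (x : ι → B)
    (hx : Algebra.adjoin A (Set.range x) = ⊤) (hxq : ∀ i, ψ (x i) = x i ^ q)
    (hκ : ∀ (b : B) (n : N), κ (ψ b • n) = b • κ n) (y : J → N)
    (hy : ∀ z ∈ Submodule.span B (Set.range y), κ z ∈ Submodule.span B (Set.range y)) :
    ∃ e, (∀ d ≥ e, ∀ z ∈ box A x y d, κ z ∈ box A x y d) ∧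
      ∀ d, ∃ m : ℕ, ∀ z ∈ box A x y d, κ^[m] z ∈ box A x y e := by
  obtain ⟨c, hc⟩ := exists_map_box_le hφ hψ (by omega) x hx hxq hκ y hy
  have h2 (d : ℕ) : d / q ≤ d / 2 := Nat.div_le_div_left hq (by omega)
  -- For `d ≥ 2 c` we have `d / q + c ≤ d`, and the inequality is strict for `d > 2 c`.
  refine ⟨2 * c, fun d hd z hz => box_mono x y (by have := h2 d; omega) (hc d z hz), fun d => ?_⟩
  induction d using Nat.strong_induction_on with
  | _ d ih =>
    by_cases hd : d ≤ 2 * c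
    · exact ⟨0, fun z hz => box_mono x y hd hz⟩
    · obtain ⟨m, hm⟩ := ih (d / q + c) (by have := h2 d; omega)
      exact ⟨m + 1, fun z hz => hm _ (hc d z hz)⟩

/-- Nil-coherence descends along an algebra of finite type generated by elements `x` with
`ψ x = x ^ q`. -/
theorem IsNilCoherent.restrictScalars [IsNoetherianRing A] (hφ : φ.Finite)
    (hψ : ∀ a, ψ (algebraMap A B a) = algebraMap A B (φ a)) (hq : 2 ≤ q) (x : ι → B)
    (hx : Algebra.adjoin A (Set.range x) = ⊤) (hxq : ∀ i, ψ (x i) = x i ^ q)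
    (hκ : ∀ (b : B) (n : N), κ (ψ b • n) = b • κ n) (h : IsNilCoherent B κ) :
    IsNilCoherent A κ := by
  have h1 (z : N) : ∃ P : Submodule A N, P.FG ∧ (∀ y ∈ P, κ y ∈ P) ∧ z ∈ P := by
    obtain ⟨P, ⟨s, rfl⟩, hP, hz⟩ := h.exists_mem z
    have hs : (s : Set N) = Set.range (Subtype.val : s → N) := Subtype.range_coe.symm
    rw [hs] at hP hz
    obtain ⟨e, he, -⟩ := exists_stable_box hφ hψ hq x hx hxq hκ _ hP
    obtain ⟨d, hd⟩ := exists_mem_box x hx _ hz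
    exact ⟨box A x _ (d ⊔ e), box_fg _ _ _, he _ le_sup_right, box_mono _ _ le_sup_left hd⟩
  refine ⟨h1, ?_⟩
  obtain ⟨L, ⟨s, rfl⟩, hL, hL'⟩ := h.exists_iterate
  have hs : (s : Set N) = Set.range (Subtype.val : s → N) := Subtype.range_coe.symm
  rw [hs] at hL hL'
  obtain ⟨e, he, he'⟩ := exists_stable_box hφ hψ hq x hx hxq hκ _ hL
  refine ⟨box A x _ e, box_fg _ _ _, he _ le_rfl, fun z => ?_⟩
  obtain ⟨Q, hQ, hQs, hz⟩ := h1 z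
  obtain ⟨m, hm⟩ := exists_iterate_mem_of_fg (A := A)
    (L := (Submodule.span B (Set.range (Subtype.val : s → N))).restrictScalars A) hL (fun x => by
      obtain ⟨m, hm⟩ := hL' x
      exact ⟨m, fun a => by
        rw [← algebraMap_smul B]
        exact hm _⟩) hQ
  -- The part of `Q` in the `B`-span of `L` is finitely generated, since `A` is Noetherian.
  have : IsNoetherian A Q := isNoetherian_of_fg_of_noetherian _ hQ
  obtain ⟨d, hd⟩ := exists_le_box x hx _ (Q := Q ⊓
      (Submodule.span B (Set.range (Subtype.val : s → N))).restrictScalars A)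
    (Submodule.FG.of_le hQ inf_le_left) fun z hz => hz.2
  obtain ⟨n, hn⟩ := he' d
  refine ⟨n + m, fun a => ?_⟩
  rw [Function.iterate_add_apply]
  refine hn _ (hd ⟨?_, hm _ (Submodule.smul_mem _ a hz)⟩)
  exact iterate_mem_of_le hQs (Nat.zero_le _) (Submodule.smul_mem _ a hz)

end Box

end CartierSheaves

/-! ### Sheaves of finite type -/

namespace CartierSheaves

section FiniteType

variable {X : Scheme.{u}} {M N : X.Modules}

/-- The sections `s j` over `U` generate `M` over `U`: every section is locally a linear combination
of them. -/
def Generates (M : X.Modules) {U : X.Opens} {J : Type*} [Fintype J] (s : J → Γ(M, U)) : Prop :=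
  ∀ (V : X.Opens) (h : V ≤ U) (t : Γ(M, V)), ∀ y ∈ V, ∃ (W : X.Opens) (hW : W ≤ V), y ∈ W ∧
    ∃ c : J → Γ(X, W), res M hW t = ∑ j, c j • res M (hW.trans h) (s j)

/-- The subsheaf generated by finitely many global sections. -/
def spanSubsheaf {J : Type*} [Fintype J] (s : J → Γ(M, (⊤ : X.Opens))) : Subsheaf M where
  obj U :=
    { carrier := {t | ∀ x ∈ U, ∃ (V : X.Opens) (h : V ≤ U), x ∈ V ∧
        ∃ c : J → Γ(X, V), res M h t = ∑ j, c j • res M le_top (s j)}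
      add_mem' := fun {a b} ha hb x hx => by
        obtain ⟨V, hV, hxV, y, hy⟩ := ha x hx
        obtain ⟨W, hW, hxW, z, hz⟩ := hb x hx
        refine ⟨V ⊓ W, inf_le_left.trans hV, ⟨hxV, hxW⟩,
          fun j => resO inf_le_left (y j) + resO inf_le_right (z j), ?_⟩
        rw [map_add, ← res_res M hV inf_le_left, hy, ← res_res M hW inf_le_right, hz, map_sum,
          map_sum, ← Finset.sum_add_distrib]
        simp only [res_smul, res_res, add_smul]
      zero_mem' x hx := ⟨U, le_rfl, hx, 0, by simp⟩
      smul_mem' r t ht x hx := by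
        obtain ⟨V, hV, hxV, y, hy⟩ := ht x hx
        exact ⟨V, hV, hxV, fun j => resO hV r * y j, by
          simp only [res_smul, hy, Finset.smul_sum, mul_smul]⟩ }
  res_mem {U V} h {t} ht x hx := by
    obtain ⟨W, hW, hxW, y, hy⟩ := ht x (h hx)
    refine ⟨V ⊓ W, inf_le_left, ⟨hx, hxW⟩, fun j => resO inf_le_right (y j), ?_⟩
    rw [res_res, ← res_res M hW inf_le_right, hy, map_sum]
    simp only [res_smul, res_res]
  mem_of_local {U} t ht x hx := by
    obtain ⟨V, hV, hxV, h⟩ := ht x hx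
    obtain ⟨W, hW, hxW, y, hy⟩ := h x hxV
    exact ⟨W, hW.trans hV, hxW, y, by rw [← hy, res_res]⟩

theorem hom_eq_of_generates {J : Type*} [Fintype J] {s : J → Γ(M, (⊤ : X.Opens))}
    (h : Generates M s) (φ ψ : M ⟶ N) (e : ∀ j, φ.app ⊤ (s j) = ψ.app ⊤ (s j)) : φ = ψ := by
  refine hom_ext_apply fun V t => res_ext' N fun y hy => ?_
  obtain ⟨W, hW, hyW, c, hc⟩ := h V le_top t y hy
  refine ⟨W, hW, hyW, ?_⟩
  rw [← app_res, ← app_res, hc, map_sum, map_sum]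
  refine Finset.sum_congr rfl fun j _ => ?_
  rw [Scheme.Modules.Hom.app_smul, Scheme.Modules.Hom.app_smul, app_res, app_res, e]

/-- Global sections generate a sheaf in the sense of Mathlib, i.e., define an epimorphism from a
free sheaf, if and only if every section is locally a linear combination of them. -/
theorem epi_iff_generates {J : Type u} [Fintype J]
    (s : J → SheafOfModules.sections (R := X.ringCatSheaf) M) :
    Epi ((SheafOfModules.freeHomEquiv (R := X.ringCatSheaf) M).symm s) ↔
      Generates M (U := ⊤) fun j => (s j).eval (op ⊤) := by
  set g : J → Γ(M, (⊤ : X.Opens)) := fun j => (s j).eval (op ⊤) with hg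
  have hs (j : J) (U : X.Opens) : (s j).eval (op U) = res M le_top (g j) :=
    (PresheafOfModules.sections_property (s j) (homOfLE (le_top : U ≤ ⊤)).op).symm
  constructor
  · intro h
    let S := spanSubsheaf g
    have hgS (j : J) (U : X.Opens) : res M le_top (g j) ∈ S.obj U := fun x hx => by
      classical
      exact ⟨U, le_rfl, hx, Pi.single j 1, by simp [Pi.single_apply]⟩
    let s' (j : J) : SheafOfModules.sections (R := X.ringCatSheaf) S.toModules :=
      PresheafOfModules.sectionsMk (fun U => S.toSection (res M le_top (g j)) (hgS j U.unop))
        fun U V i => S.ι_injective V.unop (res_res M le_top (leOfHom i.unop) (g j))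
    have e : (SheafOfModules.freeHomEquiv (R := X.ringCatSheaf) M).symm s =
        (SheafOfModules.freeHomEquiv (R := X.ringCatSheaf) S.toModules).symm s' ≫ S.ι := by
      have := SheafOfModules.freeHomEquiv_symm_comp (R := X.ringCatSheaf) (M := S.toModules)
        (N := M) s' S.ι
      refine Eq.trans (congrArg _ ?_) this.symm
      funext j
      exact PresheafOfModules.sections_ext _ _ fun U => hs j U.unop
    have hepi : Epi (C := SheafOfModules X.ringCatSheaf) S.ι := by
      rw [e] at h
      exact @epi_of_epi (SheafOfModules X.ringCatSheaf) _ _ _ _ _ _ h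
    have hepi' : Epi S.ι := hepi
    have := isIso_of_mono_of_epi S.ι
    intro V _ t
    obtain ⟨w, rfl⟩ := (app_bijective_of_isIso S.ι V).2 t
    exact S.ι_mem w
  · intro h
    refine ⟨fun {N} f f' hff' => ?_⟩
    have e1 := SheafOfModules.freeHomEquiv_symm_comp (R := X.ringCatSheaf) (M := M) (N := N) s f
    have e2 := SheafOfModules.freeHomEquiv_symm_comp (R := X.ringCatSheaf) (M := M) (N := N) s f'
    have e := (SheafOfModules.freeHomEquiv (R := X.ringCatSheaf) N).symm.injective
      (e1.symm.trans (hff'.trans e2))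
    exact hom_eq_of_generates (M := M) (N := N) h f f' fun j =>
      congrArg (fun σ => PresheafOfModules.sections.eval σ (op ⊤)) (congrFun e j)

/-- Sections of the restriction of `M` to the open subscheme `U` are sections of `M`. -/
def restrictSections (M : X.Modules) {U : X.Opens} (W : U.toScheme.Opens) :
    Γ(M.restrict U.ι, W) ≃+ Γ(M, U.ι ''ᵁ W) := AddEquiv.refl _

theorem restrictSections_res {U : X.Opens} {W W' : U.toScheme.Opens} (h : W' ≤ W)
    (t : Γ(M.restrict U.ι, W)) : restrictSections M W' (res _ h t) =
      res M (U.ι.image_mono h) (restrictSections M W t) := rfl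

theorem restrictSections_smul {U : X.Opens} {W : U.toScheme.Opens} (a : Γ(X, U.ι ''ᵁ W))
    (t : Γ(M.restrict U.ι, W)) : restrictSections M W ((show Γ(U.toScheme, W) from a) • t) =
      a • restrictSections M W t := by
  change @HSMul.hSMul Γ(X, U.ι ''ᵁ W) Γ(M, U.ι ''ᵁ W) Γ(M, U.ι ''ᵁ W) instHSMul
    ((U.ι.appIso _).inv a) (restrictSections M W t) = _
  rw [Scheme.Opens.ι_appIso]
  rfl

/-- The restriction of a section over `U` to the open subscheme `U`. -/
def toRestrict (M : X.Modules) (U : X.Opens) (s : Γ(M, U)) : Γ(M.restrict U.ι, ⊤) :=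
  (restrictSections M _).symm (res M U.ι_image_top.le s)

theorem toRestrict_bijective (M : X.Modules) (U : X.Opens) :
    Function.Bijective (toRestrict M U) :=
  (restrictSections M _).symm.bijective.comp
    (res_bijective_of_eq M U.ι_image_top.le U.ι_image_top.symm)

theorem restrictSections_toRestrict {U : X.Opens} {W : U.toScheme.Opens} (s : Γ(M, U))
    (h : U.ι ''ᵁ W ≤ U) :
    restrictSections M W (res _ le_top (toRestrict M U s)) = res M h s := by
  rw [restrictSections_res, toRestrict, AddEquiv.apply_symm_apply, res_res]

theorem restrictSections_sum {U : X.Opens} {J : Type*} [Fintype J] {s : J → Γ(M, U)}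
    {W : U.toScheme.Opens} (h : U.ι ''ᵁ W ≤ U) (c : J → Γ(X, U.ι ''ᵁ W)) :
    restrictSections M W (∑ j, (show Γ(U.toScheme, W) from c j) •
      res (M.restrict U.ι) le_top (toRestrict M U (s j))) = ∑ j, c j • res M h (s j) := by
  rw [map_sum]
  refine Finset.sum_congr rfl fun j _ => ?_
  rw [restrictSections_smul, restrictSections_toRestrict]

theorem generates_of_restrict {U : X.Opens} {J : Type*} [Fintype J] {s : J → Γ(M, U)}
    (H : Generates (M.restrict U.ι) (fun j => toRestrict M U (s j))) : Generates M s := by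
  intro V hV t y hy
  have hcap : U.ι ''ᵁ U.ι ⁻¹ᵁ V ≤ V := cap_le U V
  obtain ⟨W, hW, hyW, c, hc⟩ := H (U.ι ⁻¹ᵁ V) le_top
    ((restrictSections M _).symm (res M hcap t)) ⟨y, hV hy⟩ hy
  have h : U.ι ''ᵁ W ≤ V := (U.ι.image_mono hW).trans hcap
  refine ⟨U.ι ''ᵁ W, h, ⟨⟨y, hV hy⟩, hyW, rfl⟩, c, ?_⟩
  have h2 := (congrArg (restrictSections M W) hc).trans (restrictSections_sum (h.trans hV) c)
  rw [restrictSections_res, AddEquiv.apply_symm_apply, res_res] at h2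
  exact h2

theorem generates_restrict {U : X.Opens} {J : Type*} [Fintype J] {s : J → Γ(M, U)}
    (H : Generates M s) : Generates (M.restrict U.ι) (fun j => toRestrict M U (s j)) := by
  intro V _ t y hy
  have hVU : U.ι ''ᵁ V ≤ U := (U.ι.image_mono le_top).trans U.ι_image_top.le
  obtain ⟨W, hW, hyW, c, hc⟩ := H (U.ι ''ᵁ V) hVU (restrictSections M _ t) y.1 ⟨y, hy, rfl⟩
  have h : U.ι ⁻¹ᵁ W ≤ V := (U.ι.preimage_mono hW).trans (U.ι.preimage_image_eq V).le
  refine ⟨U.ι ⁻¹ᵁ W, h, hyW, fun j => resO (cap_le U W) (c j), ?_⟩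
  apply (restrictSections M _).injective
  refine Eq.trans ?_ (restrictSections_sum ((cap_le U W).trans (hW.trans hVU))
    fun j => resO (cap_le U W) (c j)).symm
  rw [restrictSections_res]
  refine (res_res M hW (cap_le U W) _).symm.trans ?_
  rw [hc, map_sum]
  refine Finset.sum_congr rfl fun j _ => ?_
  rw [res_smul, res_res]
  rfl

/-- Transport of generating sections along an isomorphism. -/
def genOfIso (e : M ≅ N) (G : SheafOfModules.GeneratingSections (R := X.ringCatSheaf) M) :
    SheafOfModules.GeneratingSections (R := X.ringCatSheaf) N :=
  @SheafOfModules.GeneratingSections.ofEpi _ _ _ X.ringCatSheaf _ _ M N G e.hom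
    (IsIso.epi_of_iso (C := X.Modules) e.hom)

/-- A sheaf of modules is of finite type if it is locally generated by finitely many sections. -/
theorem isFiniteType_of_generates (M : X.Modules) (h : ∀ x : X, ∃ (U : X.Opens) (J : Type u)
    (_ : Fintype J) (s : J → Γ(M, U)), x ∈ U ∧ Generates M s) : M.IsFiniteType := by
  choose U J hJ s hx hs using h
  have hg (x : X) : Nonempty {G : (M.over (U x)).GeneratingSections // G.IsFiniteType} := by
    have h1 := generates_restrict (hs x)
    let t (j : J x) :
        SheafOfModules.sections (R := (U x).toScheme.ringCatSheaf) (M.restrict (U x).ι) :=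
      PresheafOfModules.sectionsMk
        (fun V => res (M.restrict (U x).ι) le_top (toRestrict M (U x) (s x j)))
        fun V W i => res_res (M.restrict (U x).ι) le_top (leOfHom i.unop) _
    let G : SheafOfModules.GeneratingSections (R := (U x).toScheme.ringCatSheaf)
        (M.restrict (U x).ι) := ⟨_, t, (epi_iff_generates t).2 (by
          have : (fun j => (t j).eval (op ⊤)) = fun j => toRestrict M (U x) (s x j) :=
            funext fun j => res_self _ _ _
          exact this ▸ h1)⟩
    have hG : G.IsFiniteType := ⟨inferInstanceAs (Finite (J x))⟩
    let E := (U x).sheafOfModulesEquivOver X.ringCatSheaf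
    have : PreservesColimitsOfSize.{u, u} E.inverse :=
      E.symm.toAdjunction.leftAdjoint_preservesColimits
    let e : M.restrict (U x).ι ≅ (Scheme.Modules.overEquiv (U x)).functor.obj (M.over (U x)) :=
      (Scheme.Modules.overFunctorEquiv (U x)).symm.app M
    let G2 : SheafOfModules.GeneratingSections (R := (U x).sheafRestrict.obj X.ringCatSheaf)
        (E.functor.obj (M.over (U x))) := genOfIso e G
    let G3 := G2.map E.inverse
      ((U x).sheafOfModulesEquivOverInverseUnit X.ringCatSheaf).symm
    exact ⟨G3.ofEpi (E.unitIso.inv.app (M.over (U x))), ⟨inferInstanceAs (Finite (J x))⟩⟩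
  let σ : SheafOfModules.LocalGeneratorsData.{u} (R := X.ringCatSheaf) M :=
    { I := X
      X := U
      coversTop := by
        rw [Opens.coversTop_iff]
        exact eq_top_iff.2 fun x _ => Opens.mem_iSup.2 ⟨x, hx x⟩
      generators := fun x => (hg x).some.1 }
  have hσ : σ.IsFiniteType := { isFiniteType := fun x => (hg x).some.2 }
  exact SheafOfModules.IsFiniteType.mk (R := X.ringCatSheaf) (M := M) ⟨σ, hσ⟩

/-- A sheaf of finite type is locally generated by finitely many sections. -/
theorem exists_generates (M : X.Modules) [h : M.IsFiniteType] (x : X) : ∃ (U : X.Opens) (J : Type u)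
    (_ : Fintype J) (s : J → Γ(M, U)), x ∈ U ∧ Generates M s := by
  obtain ⟨σ, hσ⟩ := h
  have hc := σ.coversTop
  rw [Opens.coversTop_iff] at hc
  obtain ⟨i, hi⟩ := Opens.mem_iSup.1 ((show iSup σ.X = ⊤ from hc).ge (Opens.mem_top x))
  let G := σ.generators i
  have hG : G.IsFiniteType := hσ.isFiniteType i
  let U : X.Opens := σ.X i
  let E := U.sheafOfModulesEquivOver X.ringCatSheaf
  have : PreservesColimitsOfSize.{u, u} E.functor :=
    E.toAdjunction.leftAdjoint_preservesColimits
  let e : (Scheme.Modules.overEquiv U).functor.obj (M.over U) ≅ M.restrict U.ι := (Scheme.Modules.overFunctorEquiv U).app M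
  let G2 : SheafOfModules.GeneratingSections (R := U.sheafRestrict.obj X.ringCatSheaf)
      (E.functor.obj (M.over U)) := G.map E.functor
        (U.sheafOfModulesEquivOverUnit X.ringCatSheaf).symm
  let G3 : SheafOfModules.GeneratingSections (R := U.toScheme.ringCatSheaf)
      (M.restrict U.ι) := genOfIso e G2
  have : Finite G3.I := inferInstanceAs (Finite G.I)
  have := Fintype.ofFinite G3.I
  have h1 := (epi_iff_generates G3.s).1 G3.epi
  choose s hs using fun j => (toRestrict_bijective M U).2 ((G3.s j).eval (op ⊤))
  refine ⟨U, G3.I, inferInstance, s, hi, generates_of_restrict ?_⟩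
  rw [show (fun j => toRestrict M U (s j)) = fun j => (G3.s j).eval (op ⊤) from funext hs]
  exact h1

end FiniteType

end CartierSheaves

/-! ### Quasi-coherent subsheaves and subsheaves of fractions -/

namespace CartierSheaves

section Fractions

variable {X : Scheme.{u}} {M : X.Modules} {O : X.Opens}

/-- A power of `f` lies in an ideal which contains, for every point of `D(f)`, a function invertible
at this point. -/
theorem exists_pow_mem_of_local (hO : IsAffineOpen O) (I : Ideal Γ(X, O)) (f : Γ(X, O))
    (h : ∀ x ∈ X.basicOpen f, ∃ r ∈ I, x ∈ X.basicOpen r) : ∃ n : ℕ, f ^ n ∈ I := by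
  change f ∈ I.radical
  rw [Ideal.radical_eq_sInf, Ideal.mem_sInf]
  rintro p ⟨hI, hp⟩
  by_contra hf
  have key (a : Γ(X, O)) : hO.fromSpec ⟨p, hp⟩ ∈ X.basicOpen a ↔ a ∉ p := by
    change _ ∈ hO.fromSpec ⁻¹ᵁ X.basicOpen a ↔ _
    rw [hO.fromSpec_preimage_basicOpen]
    rfl
  obtain ⟨r, hr, hx⟩ := h _ ((key f).2 hf)
  exact (key r).1 hx (hI hr)

/-- An element of the sections over an affine open subset which lies in a submodule locally lies in
the submodule. -/
theorem mem_of_local (hO : IsAffineOpen O) (P : Submodule Γ(X, O) Γ(M, O)) (s : Γ(M, O))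
    (h : ∀ x ∈ O, ∃ r : Γ(X, O), x ∈ X.basicOpen r ∧ r • s ∈ P) : s ∈ P := by
  obtain ⟨n, hn⟩ := exists_pow_mem_of_local hO
    (P.comap (LinearMap.toSpanSingleton Γ(X, O) Γ(M, O) s)) 1 fun x hx => by
      obtain ⟨r, hr, hr'⟩ := h x (X.basicOpen_le _ hx)
      exact ⟨r, hr', hr⟩
  simpa using hn

theorem exists_basicOpen (hO : IsAffineOpen O) {U : X.Opens} {x : X} (hx : x ∈ U) (hx' : x ∈ O) :
    ∃ g : Γ(X, O), x ∈ X.basicOpen g ∧ X.basicOpen g ≤ U := by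
  obtain ⟨g, hg, hxg⟩ := hO.exists_basicOpen_le ⟨x, hx⟩ hx'
  exact ⟨g, hxg, hg⟩

theorem isUnit_resO_basicOpen {U : X.Opens} (g : Γ(X, U)) :
    IsUnit (resO (X.basicOpen_le g) g) :=
  X.toRingedSpace.isUnit_res_basicOpen g

theorem isUnit_resO_of_le {U V W : X.Opens} {h : V ≤ U} (h' : W ≤ V) {g : Γ(X, U)}
    (hg : IsUnit (resO h g)) : IsUnit (resO (h'.trans h) g) := by
  rw [← resO_resO h h']
  exact hg.map _

theorem le_basicOpen_of_isUnit {U V : X.Opens} {h : V ≤ U} {g : Γ(X, U)}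
    (hg : IsUnit (resO h g)) : V ≤ X.basicOpen g := by
  have h1 := X.basicOpen_of_isUnit hg
  have h2 : X.basicOpen (resO h g) = V ⊓ X.basicOpen g := Scheme.basicOpen_res _ _ _
  exact inf_eq_left.1 (h2.symm.trans h1)

theorem exists_pow_smul_eq [M.IsQuasicoherent] (hO : IsAffineOpen O) (r : Γ(X, O)) (s t : Γ(M, O))
    (h : res M (X.basicOpen_le r) s = res M (X.basicOpen_le r) t) :
    ∃ n : ℕ, r ^ n • s = r ^ n • t := by
  obtain ⟨n, hn⟩ := (localizes_of_isAffineOpen M hO r).eq_zero (s - t) (by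
    change res M (X.basicOpen_le r) (s - t) = 0
    rw [map_sub, h, sub_self])
  exact ⟨n, by rwa [smul_sub, sub_eq_zero] at hn⟩

theorem exists_res_eq [M.IsQuasicoherent] (hO : IsAffineOpen O) (r : Γ(X, O))
    (s : Γ(M, X.basicOpen r)) : ∃ (n : ℕ) (t : Γ(M, O)),
      res M (X.basicOpen_le r) t = resO (X.basicOpen_le r) r ^ n • s :=
  (localizes_of_isAffineOpen M hO r).surj s

theorem exists_resO_eq (hO : IsAffineOpen O) (r : Γ(X, O)) (s : Γ(X, X.basicOpen r)) :
    ∃ (n : ℕ) (t : Γ(X, O)), resO (X.basicOpen_le r) t = resO (X.basicOpen_le r) r ^ n * s := by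
  have := hO.isLocalization_basicOpen r
  obtain ⟨n, t, ht⟩ := IsLocalization.Away.surj r s
  refine ⟨n, t, ht.symm.trans ?_⟩
  rw [mul_comm]
  rfl

/-- The section `s` of `M` is, near the point `x`, a fraction with numerator in the submodule `P` of
the sections over `O`. -/
def FracMem (P : Submodule Γ(X, O) Γ(M, O)) {U : X.Opens} (s : Γ(M, U)) (x : X) : Prop :=
  ∃ (W : X.Opens) (hU : W ≤ U) (hO : W ≤ O), x ∈ W ∧ ∃ a : Γ(X, O), IsUnit (resO hO a) ∧
    ∃ p ∈ P, res M hO p = resO hO a • res M hU s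

theorem FracMem.mono {P Q : Submodule Γ(X, O) Γ(M, O)} (h : P ≤ Q) {U : X.Opens} {s : Γ(M, U)}
    {x : X} : FracMem P s x → FracMem Q s x := by
  rintro ⟨W, hU, hO, hx, a, ha, p, hp, e⟩
  exact ⟨W, hU, hO, hx, a, ha, p, h hp, e⟩

theorem FracMem.smul (hO : IsAffineOpen O) {P : Submodule Γ(X, O) Γ(M, O)} {U : X.Opens}
    {s : Γ(M, U)} {x : X} (r : Γ(X, U)) : FracMem P s x → FracMem P (r • s) x := by
  rintro ⟨W, hWU, hWO, hx, a, ha, p, hp, e⟩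
  obtain ⟨g, hg, hgW⟩ := exists_basicOpen hO hx (hWO hx)
  obtain ⟨n, b, hb⟩ := exists_resO_eq hO g (resO (hgW.trans hWU) r)
  refine ⟨X.basicOpen g, hgW.trans hWU, X.basicOpen_le g, hg, g ^ n * a, ?_, b • p,
    P.smul_mem _ hp, ?_⟩
  · rw [map_mul, map_pow]
    exact ((isUnit_resO_basicOpen g).pow n).mul (isUnit_resO_of_le hgW ha)
  · rw [res_smul, hb, ← res_res M hWO hgW, e, res_smul, resO_resO, res_res, res_smul, ← mul_smul,
      ← mul_smul, map_mul, map_pow]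
    congr 1
    ring

/-- The subsheaf of sections which are locally fractions with numerators in `P`; outside `O` there
is no condition. -/
def fracSubsheaf (hO : IsAffineOpen O) (P : Submodule Γ(X, O) Γ(M, O)) : Subsheaf M where
  obj U :=
    { carrier := {s | ∀ x ∈ U, x ∈ O → FracMem P s x}
      add_mem' := fun {s t} hs ht x hx hxO => by
        obtain ⟨W, hU, hWO, hxW, a, ha, p, hp, e⟩ := hs x hx hxO
        obtain ⟨W', hU', hWO', hxW', b, hb, p', hp', e'⟩ := ht x hx hxO
        refine ⟨W ⊓ W', inf_le_left.trans hU, inf_le_left.trans hWO, ⟨hxW, hxW'⟩, a * b, ?_,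
          b • p + a • p', P.add_mem (P.smul_mem _ hp) (P.smul_mem _ hp'), ?_⟩
        · rw [map_mul]
          exact (isUnit_resO_of_le inf_le_left ha).mul (isUnit_resO_of_le inf_le_right hb)
        · rw [map_add, map_add, res_smul, res_smul, ← res_res M hWO inf_le_left, e,
            ← res_res M hWO' inf_le_right, e', res_smul, res_smul, resO_resO, resO_resO, res_res,
            res_res, map_mul, smul_add, ← mul_smul, ← mul_smul, mul_comm (resO _ b)]
      zero_mem' x hx hxO := ⟨U ⊓ O, inf_le_left, inf_le_right, ⟨hx, hxO⟩, 1, by simp, 0,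
        P.zero_mem, by simp⟩
      smul_mem' r s hs x hx hxO := (hs x hx hxO).smul hO r }
  res_mem {U V} h {s} hs x hx hxO := by
    obtain ⟨W, hU, hWO, hxW, a, ha, p, hp, e⟩ := hs x (h hx) hxO
    refine ⟨W ⊓ V, inf_le_right, inf_le_left.trans hWO, ⟨hxW, hx⟩, a,
      isUnit_resO_of_le inf_le_left ha, p, hp, ?_⟩
    rw [← res_res M hWO inf_le_left, e, res_smul, resO_resO, res_res, res_res]
  mem_of_local {U} s hs x hx hxO := by
    obtain ⟨V, hV, hxV, h⟩ := hs x hx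
    obtain ⟨W, hU, hWO, hxW, a, ha, p, hp, e⟩ := h x hxV hxO
    exact ⟨W, hU.trans hV, hWO, hxW, a, ha, p, hp, by rw [e, res_res]⟩

variable [M.IsQuasicoherent]

/-- Sections of the subsheaf of fractions over a basic open subset of `O` have a global
denominator. -/
theorem exists_pow_smul_of_fracMem (hO : IsAffineOpen O) (P : Submodule Γ(X, O) Γ(M, O))
    {U : X.Opens} (s : Γ(M, U)) (f : Γ(X, O)) (hf : X.basicOpen f ≤ U)
    (h : ∀ x ∈ X.basicOpen f, FracMem P s x) : ∃ n : ℕ, ∃ p ∈ P,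
      res M (X.basicOpen_le f) p = resO (X.basicOpen_le f) f ^ n • res M hf s := by
  obtain ⟨n, t, ht⟩ := exists_res_eq hO f (res M hf s)
  obtain ⟨k, hk⟩ := exists_pow_mem_of_local hO
    (P.comap (LinearMap.toSpanSingleton Γ(X, O) Γ(M, O) t)) f fun x hx => by
      obtain ⟨W, hWU, hWO, hxW, a, ha, p, hp, e⟩ := h x hx
      obtain ⟨g, hg, hgW⟩ := exists_basicOpen hO (U := W ⊓ X.basicOpen f) ⟨hxW, hx⟩ (hWO hxW)
      have e1 : res M (X.basicOpen_le g) (a • t) = res M (X.basicOpen_le g) (f ^ n • p) := by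
        have hgW' := hgW.trans inf_le_left
        have hgf := hgW.trans inf_le_right
        rw [res_smul, res_smul, ← res_res M (X.basicOpen_le f) hgf, ht, ← res_res M hWO hgW', e,
          res_smul, res_smul, res_res, res_res, resO_resO, map_pow, map_pow, resO_resO, smul_comm]
      obtain ⟨m, hm⟩ := exists_pow_smul_eq hO g _ _ e1
      refine ⟨g ^ (m + 1) * a, ?_, ?_⟩
      · change (g ^ (m + 1) * a) • t ∈ P
        rw [pow_succ', mul_assoc, mul_smul, mul_smul, hm]
        exact P.smul_mem _ (P.smul_mem _ (P.smul_mem _ hp))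
      · rw [Scheme.basicOpen_mul, Scheme.basicOpen_pow _ _ (Nat.succ_pos m)]
        exact ⟨hg, le_basicOpen_of_isUnit ha hxW⟩
  refine ⟨k + n, f ^ k • t, hk, ?_⟩
  rw [res_smul, ht, map_pow, pow_add, mul_smul]

/-- Over `O` itself, forming fractions does not enlarge `P`. -/
theorem mem_of_mem_fracSubsheaf (hO : IsAffineOpen O) (P : Submodule Γ(X, O) Γ(M, O))
    {s : Γ(M, O)} (hs : s ∈ (fracSubsheaf hO P).obj O) : s ∈ P := by
  have h1 : X.basicOpen (1 : Γ(X, O)) = O := X.basicOpen_of_isUnit isUnit_one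
  obtain ⟨n, p, hp, e⟩ := exists_pow_smul_of_fracMem hO P s 1 (X.basicOpen_le _)
    fun x hx => hs x (X.basicOpen_le _ hx) (X.basicOpen_le _ hx)
  rw [map_one, one_pow, one_smul] at e
  rw [← (res_bijective_of_eq M (X.basicOpen_le (1 : Γ(X, O))) h1.symm).1 e]
  exact hp

/-- A subsheaf of a quasi-coherent sheaf is quasi-coherent if sections over affine open subsets which
belong to it over the locus where `r` is invertible do so after multiplication by a power of `r`. -/
def Subsheaf.IsQC {X : Scheme.{u}} {M : X.Modules} (S : Subsheaf M) : Prop :=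
  ∀ (U : X.Opens) (_ : IsAffineOpen U) (r : Γ(X, U)) (s : Γ(M, U)),
    res M (X.basicOpen_le r) s ∈ S.obj (X.basicOpen r) → ∃ n : ℕ, r ^ n • s ∈ S.obj U

theorem Subsheaf.IsQC.isQuasicoherent {S : Subsheaf M} (hS : S.IsQC) :
    S.toModules.IsQuasicoherent := by
  refine isQuasicoherent_of_localizes _ fun U hU r => ⟨fun t ht => ?_, fun s => ?_⟩
  · obtain ⟨n, hn⟩ := (localizes_of_isAffineOpen M hU r).eq_zero (S.ι.app U t)
      ((app_res S.ι (X.basicOpen_le r) t).symm.trans ((congrArg _ ht).trans (map_zero _)))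
    exact ⟨n, S.ι_injective U (by rw [S.ι.app_smul, hn, map_zero])⟩
  · obtain ⟨n, t, ht⟩ := exists_res_eq hU r (S.ι.app _ s)
    obtain ⟨m, hm⟩ := hS U hU r t (by
      rw [ht]
      exact Submodule.smul_mem _ _ (S.ι_mem s))
    refine ⟨m + n, S.toSection _ hm, S.ι_injective _ ?_⟩
    change S.ι.app _ (res S.toModules (X.basicOpen_le r) _) =
      S.ι.app _ (resO (X.basicOpen_le r) r ^ (m + n) • s)
    rw [app_res, S.ι.app_smul, Subsheaf.ι_toSection, res_smul, ht, map_pow, pow_add, mul_smul]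

omit [M.IsQuasicoherent] in
/-- The intersection of two subsheaves. -/
def Subsheaf.inf {X : Scheme.{u}} {M : X.Modules} (S T : Subsheaf M) : Subsheaf M where
  obj U := S.obj U ⊓ T.obj U
  res_mem h _ hs := ⟨S.res_mem h hs.1, T.res_mem h hs.2⟩
  mem_of_local s hs := ⟨S.mem_of_local s fun x hx => by
      obtain ⟨V, hV, hxV, h⟩ := hs x hx
      exact ⟨V, hV, hxV, h.1⟩, T.mem_of_local s fun x hx => by
      obtain ⟨V, hV, hxV, h⟩ := hs x hx
      exact ⟨V, hV, hxV, h.2⟩⟩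

omit [M.IsQuasicoherent] in
theorem Subsheaf.IsQC.inf {S T : Subsheaf M} (hS : S.IsQC) (hT : T.IsQC) : (S.inf T).IsQC := by
  intro U hU r s hs
  obtain ⟨n, hn⟩ := hS U hU r s hs.1
  obtain ⟨m, hm⟩ := hT U hU r s hs.2
  refine ⟨n + m, ?_, ?_⟩
  · rw [add_comm, pow_add, mul_smul]
    exact Submodule.smul_mem _ _ hn
  · rw [pow_add, mul_smul]
    exact Submodule.smul_mem _ _ hm

/-- The local step for `isQC_fracSubsheaf`: denominators are controlled on a basic open subset of
`O`. -/
theorem exists_fracMem_pow_smul (hO : IsAffineOpen O) (P : Submodule Γ(X, O) Γ(M, O))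
    {U : X.Opens} (r : Γ(X, U)) (s : Γ(M, U))
    (hs : res M (X.basicOpen_le r) s ∈ (fracSubsheaf hO P).obj (X.basicOpen r)) (g : Γ(X, O))
    (hg : X.basicOpen g ≤ U) : ∃ n : ℕ, ∀ y ∈ X.basicOpen g, FracMem P (r ^ n • s) y := by
  obtain ⟨a, r', hr'⟩ := exists_resO_eq hO g (resO hg r)
  have hgO := X.basicOpen_le g
  have h1 : X.basicOpen (r' * g) ≤ X.basicOpen g := by
    rw [Scheme.basicOpen_mul]
    exact inf_le_right
  have h2 : X.basicOpen (r' * g) ≤ X.basicOpen r := by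
    refine le_basicOpen_of_isUnit (h := h1.trans hg) ?_
    have hu := isUnit_resO_basicOpen (r' * g)
    rw [map_mul] at hu
    have := isUnit_of_mul_isUnit_left hu
    rw [← resO_resO hgO h1, hr', map_mul, resO_resO] at this
    exact isUnit_of_mul_isUnit_right this
  obtain ⟨N, p, hp, e⟩ := exists_pow_smul_of_fracMem hO P (res M (X.basicOpen_le r) s) (r' * g) h2
    fun x hx => hs x (h2 hx) (X.basicOpen_le _ hx)
  obtain ⟨b, t, ht⟩ := exists_res_eq hO g (res M hg s)
  obtain ⟨m, hm⟩ := exists_pow_smul_eq hO (r' * g) ((r' * g) ^ N • t) (g ^ b • p) (by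
    rw [res_smul, res_smul, e, ← res_res M hgO h1, ht, res_smul, res_res, res_res, map_pow, map_pow,
      map_pow, resO_resO, smul_comm])
  refine ⟨m + N, fun y hy => ⟨X.basicOpen g, hg, hgO, hy, g ^ ((a + 1) * (m + N) + b), ?_,
    (r' * g) ^ m • (r' * g) ^ N • t, ?_, ?_⟩⟩
  · rw [map_pow]
    exact (isUnit_resO_basicOpen g).pow _
  · rw [hm]
    exact P.smul_mem _ (P.smul_mem _ hp)
  · rw [← mul_smul, ← pow_add, res_smul, ht, res_smul, map_pow, map_mul, hr', map_pow, map_pow,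
      ← mul_smul, ← mul_smul]
    congr 1
    ring

/-- The subsheaf of fractions is quasi-coherent: it is the preimage of the quasi-coherent subsheaf
`P~` of `j_* j^* M`, where `j` is the inclusion of `O`. -/
theorem isQC_fracSubsheaf [X.IsSeparated] (hO : IsAffineOpen O)
    (P : Submodule Γ(X, O) Γ(M, O)) : (fracSubsheaf hO P).IsQC := by
  intro U hU r s hs
  have hc : IsCompact ((U ⊓ O : X.Opens) : Set X) := (hU.inf hO).isCompact
  suffices h : ∃ n : ℕ, ∀ x ∈ ((U ⊓ O : X.Opens) : Set X), FracMem P (r ^ n • s) x by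
    obtain ⟨n, hn⟩ := h
    exact ⟨n, fun x hx hxO => hn x ⟨hx, hxO⟩⟩
  refine hc.induction_on (p := fun S => ∃ n : ℕ, ∀ x ∈ S, FracMem P (r ^ n • s) x)
    ⟨0, by simp⟩ ?_ ?_ ?_
  · rintro S T hST ⟨n, hn⟩
    exact ⟨n, fun x hx => hn x (hST hx)⟩
  · rintro S T ⟨n, hn⟩ ⟨m, hm⟩
    refine ⟨n + m, fun x hx => ?_⟩
    rcases hx with hx | hx
    · rw [add_comm, pow_add, mul_smul]
      exact (hn x hx).smul hO _
    · rw [pow_add, mul_smul]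
      exact (hm x hx).smul hO _
  · rintro x ⟨hxU, hxO⟩
    obtain ⟨g, hg, hgU⟩ := exists_basicOpen hO hxU hxO
    exact ⟨X.basicOpen g, mem_nhdsWithin_of_mem_nhds ((X.basicOpen g).isOpen.mem_nhds hg),
      exists_fracMem_pow_smul hO P r s hs g hgU⟩

/-- A section of a quasi-coherent subsheaf is locally on `O` a fraction with numerators in a finitely
generated module of sections over `O`. -/
theorem exists_fg_fracMem [X.IsSeparated] (hO : IsAffineOpen O) {S : Subsheaf M} (hS : S.IsQC)
    {U : X.Opens} (hU : IsAffineOpen U) (s : Γ(M, U)) (hs : s ∈ S.obj U) :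
    ∃ Q : Submodule Γ(X, O) Γ(M, O), Q.FG ∧ Q ≤ S.obj O ∧ s ∈ (fracSubsheaf hO Q).obj U := by
  have hc : IsCompact ((U ⊓ O : X.Opens) : Set X) := (hU.inf hO).isCompact
  suffices h : ∃ Q : Submodule Γ(X, O) Γ(M, O), Q.FG ∧ Q ≤ S.obj O ∧
      ∀ x ∈ ((U ⊓ O : X.Opens) : Set X), FracMem Q s x by
    obtain ⟨Q, hQ, hQ', hn⟩ := h
    exact ⟨Q, hQ, hQ', fun x hx hxO => hn x ⟨hx, hxO⟩⟩
  refine hc.induction_on (p := fun T => ∃ Q : Submodule Γ(X, O) Γ(M, O), Q.FG ∧ Q ≤ S.obj O ∧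
      ∀ x ∈ T, FracMem Q s x) ⟨⊥, Submodule.fg_bot, bot_le, by simp⟩ ?_ ?_ ?_
  · rintro T T' hT ⟨Q, hQ, hQ', hn⟩
    exact ⟨Q, hQ, hQ', fun x hx => hn x (hT hx)⟩
  · rintro T T' ⟨Q, hQ, hQS, hn⟩ ⟨Q', hQ', hQS', hn'⟩
    refine ⟨Q ⊔ Q', hQ.sup hQ', sup_le hQS hQS', fun x hx => ?_⟩
    rcases hx with hx | hx
    · exact (hn x hx).mono le_sup_left
    · exact (hn' x hx).mono le_sup_right
  · rintro x ⟨hxU, hxO⟩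
    obtain ⟨g, hg, hgU⟩ := exists_basicOpen hO hxU hxO
    obtain ⟨n, t, ht⟩ := exists_res_eq hO g (res M hgU s)
    obtain ⟨m, hm⟩ := hS O hO g t (by
      rw [ht]
      exact Submodule.smul_mem _ _ (S.res_mem hgU hs))
    refine ⟨X.basicOpen g, mem_nhdsWithin_of_mem_nhds ((X.basicOpen g).isOpen.mem_nhds hg),
      Submodule.span _ {g ^ m • t}, Submodule.fg_span_singleton _, ?_, fun y hy => ?_⟩
    · rw [Submodule.span_singleton_le_iff_mem]
      exact hm
    · refine ⟨X.basicOpen g, hgU, X.basicOpen_le g, hy, g ^ (m + n), ?_, _,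
        Submodule.mem_span_singleton_self _, ?_⟩
      · rw [map_pow]
        exact (isUnit_resO_basicOpen g).pow _
      · rw [res_smul, ht, ← mul_smul, map_pow, map_pow, pow_add]

theorem generates_of_fg (hO : IsAffineOpen O) {J : Type*} [Fintype J] (s : J → Γ(M, O))
    (hs : Submodule.span Γ(X, O) (Set.range s) = ⊤) : Generates M s := by
  intro V hV t y hy
  obtain ⟨g, hg, hgV⟩ := exists_basicOpen hO hy (hV hy)
  obtain ⟨n, t', ht'⟩ := exists_res_eq hO g (res M hgV t)
  obtain ⟨c, rfl⟩ := (Submodule.mem_span_range_iff_exists_fun Γ(X, O)).1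
    (hs.ge (Submodule.mem_top (x := t')))
  obtain ⟨w, hw⟩ := (isUnit_resO_basicOpen g).pow n
  refine ⟨X.basicOpen g, hgV, hg, fun j => ↑w⁻¹ * resO (X.basicOpen_le g) (c j), ?_⟩
  rw [← hw, map_sum] at ht'
  rw [← one_smul Γ(X, X.basicOpen g) (res M hgV t), ← w.inv_mul, mul_smul, ← ht', Finset.smul_sum]
  refine Finset.sum_congr rfl fun j _ => ?_
  rw [res_smul, ← mul_smul]

/-- The sections of a quasi-coherent sheaf of finite type over an affine open subset form a finitely
generated module. -/
theorem fg_of_isFiniteType [M.IsFiniteType] (hO : IsAffineOpen O) :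
    (⊤ : Submodule Γ(X, O) Γ(M, O)).FG := by
  suffices h : ∃ Q : Submodule Γ(X, O) Γ(M, O), Q.FG ∧ ∀ x ∈ (O : Set X), ∀ s : Γ(M, O),
      FracMem Q s x by
    obtain ⟨Q, hQ, hn⟩ := h
    convert hQ
    exact (eq_top_iff.2 fun s _ => mem_of_mem_fracSubsheaf hO Q fun x hx _ => hn x hx s).symm
  refine hO.isCompact.induction_on (p := fun T => ∃ Q : Submodule Γ(X, O) Γ(M, O), Q.FG ∧
      ∀ x ∈ T, ∀ s : Γ(M, O), FracMem Q s x) ⟨⊥, Submodule.fg_bot, by simp⟩ ?_ ?_ ?_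
  · rintro T T' hT ⟨Q, hQ, hn⟩
    exact ⟨Q, hQ, fun x hx => hn x (hT hx)⟩
  · rintro T T' ⟨Q, hQ, hn⟩ ⟨Q', hQ', hn'⟩
    refine ⟨Q ⊔ Q', hQ.sup hQ', fun x hx s => ?_⟩
    rcases hx with hx | hx
    · exact (hn x hx s).mono le_sup_left
    · exact (hn' x hx s).mono le_sup_right
  · intro x hxO
    obtain ⟨U, J, _, s, hxU, hs⟩ := exists_generates M x
    obtain ⟨g, hg, hgU⟩ := exists_basicOpen hO hxU hxO
    choose n t ht using fun j => exists_res_eq hO g (res M hgU (s j))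
    refine ⟨X.basicOpen g, mem_nhdsWithin_of_mem_nhds ((X.basicOpen g).isOpen.mem_nhds hg),
      Submodule.span _ (Set.range t), Submodule.fg_span (Set.finite_range t), fun y hy v => ?_⟩
    obtain ⟨W, hW, hyW, c, hc⟩ := hs (X.basicOpen g) hgU (res M (X.basicOpen_le g) v) y hy
    let F := fracSubsheaf hO (Submodule.span _ (Set.range t))
    have h1 (j : J) : res M hgU (s j) ∈ F.obj (X.basicOpen g) := fun z hz _ => by
      refine ⟨X.basicOpen g, le_rfl, X.basicOpen_le g, hz, g ^ n j, ?_, t j,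
        Submodule.subset_span ⟨j, rfl⟩, ?_⟩
      · rw [map_pow]
        exact (isUnit_resO_basicOpen g).pow _
      · rw [ht, res_self, map_pow]
    have h2 : res M (hW.trans (X.basicOpen_le g)) v ∈ F.obj W := by
      rw [← res_res M (X.basicOpen_le g) hW, hc]
      refine Submodule.sum_mem _ fun j _ => Submodule.smul_mem _ _ ?_
      rw [← res_res M hgU hW]
      exact F.res_mem hW (h1 j)
    obtain ⟨W', hWW', hWO', hy', a, ha, p, hp, e⟩ := h2 y hyW (X.basicOpen_le g hy)
    exact ⟨W', hWW'.trans (hW.trans (X.basicOpen_le g)), hWO', hy', a, ha, p, hp, by rw [e, res_res]⟩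

end Fractions

end CartierSheaves

/-! ### Coherent `κ`-subsheaves -/

namespace CartierSheaves

variable {k : Type u} [Field k] [Finite k] {Λ : Type u} [CommRing Λ] [Algebra k Λ]
  {X : Over (Spec (.of k))}

section Stable

/-- An open subset of `X × C` is stable if it equals its preimage under `σ × id`. -/
def IsStable (O : (prod Λ X).Opens) : Prop := prodFrob Λ X ⁻¹ᵁ O = O

theorem isStable_prodOpen (U : X.left.Opens) : IsStable (prodOpen Λ U) :=
  prodFrob_preimage_prodOpen U

/-- The endomorphism of the functions on a stable open subset defined by `σ × id`. -/
def frobOn {O : (prod Λ X).Opens} (h : IsStable O) : Γ(prod Λ X, O) →+* Γ(prod Λ X, O) :=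
  (resO h.ge).comp ((prodFrob Λ X).app O).hom

theorem resO_self {Z : Scheme.{u}} {U : Z.Opens} (h : U ≤ U) (s : Γ(Z, U)) : resO h s = s :=
  congr($(Z.presheaf.map_id _) s)

theorem resO_frobOn {O D : (prod Λ X).Opens} (h : IsStable O) (hD : D ≤ O)
    (hD' : prodFrob Λ X ⁻¹ᵁ D ≤ O) (g : Γ(prod Λ X, O)) :
    resO hD' (frobOn h g) = (prodFrob Λ X).app D (resO hD g) := by
  rw [← CartierSheaf.resO_app]
  exact resO_resO _ _ _

theorem basicOpen_frobOn {O : (prod Λ X).Opens} (h : IsStable O) (g : Γ(prod Λ X, O)) :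
    (prod Λ X).basicOpen (frobOn h g) = prodFrob Λ X ⁻¹ᵁ (prod Λ X).basicOpen g := by
  have h1 : (prod Λ X).basicOpen (frobOn h g) =
      O ⊓ (prod Λ X).basicOpen ((prodFrob Λ X).app O g) := Scheme.basicOpen_res _ _ _
  rw [h1, ← Scheme.preimage_basicOpen, inf_eq_right]
  exact (Scheme.Hom.preimage_mono _ (Scheme.basicOpen_le _ g)).trans h.le

end Stable

namespace CartierSheaf

variable (V : CartierSheaf Λ X)

/-- The endomorphism `κ` of the sections over a stable open subset. -/
def kapOn {O : (prod Λ X).Opens} (h : IsStable O) : Γ(V.sheaf, O) →+ Γ(V.sheaf, O) :=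
  (V.kap O).comp (res V.sheaf h.le)

theorem kapOn_smul {O : (prod Λ X).Opens} (h : IsStable O) (r : Γ(prod Λ X, O))
    (s : Γ(V.sheaf, O)) : V.kapOn h (frobOn h r • s) = r • V.kapOn h s := by
  change V.kap O (res V.sheaf h.le (frobOn h r • s)) = _
  rw [res_smul, resO_frobOn h le_rfl h.le, resO_self, kap_smul]
  rfl

theorem res_kapOn {O D : (prod Λ X).Opens} (h : IsStable O) (hD : D ≤ O)
    (hD' : prodFrob Λ X ⁻¹ᵁ D ≤ O) (s : Γ(V.sheaf, O)) :
    res V.sheaf hD (V.kapOn h s) = V.kap D (res V.sheaf hD' s) := by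
  change res V.sheaf hD (V.kap O (res V.sheaf h.le s)) = _
  rw [← kap_res, res_res]

theorem preimage_basicOpen_le {O : (prod Λ X).Opens} (h : IsStable O) (g : Γ(prod Λ X, O)) :
    prodFrob Λ X ⁻¹ᵁ (prod Λ X).basicOpen g ≤ O :=
  (Scheme.Hom.preimage_mono _ (Scheme.basicOpen_le _ g)).trans h.le

variable {V} in
theorem semiconj_kapOn {W : CartierSheaf Λ X} (φ : V ⟶ W) {O : (prod Λ X).Opens} (h : IsStable O) :
    Function.Semiconj (φ.hom.app O) (V.kapOn h) (W.kapOn h) := fun s => by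
  change φ.hom.app O (V.kap O (res V.sheaf h.le s)) = W.kap O (res W.sheaf h.le _)
  rw [← hom_kap, app_res]

/-- A subsheaf is `κ`-stable if `κ` maps its sections to sections of the subsheaf. -/
def IsKapStable (S : Subsheaf V.sheaf) : Prop :=
  ∀ (O : (prod Λ X).Opens) (s : Γ(V.sheaf, prodFrob Λ X ⁻¹ᵁ O)),
    s ∈ S.obj (prodFrob Λ X ⁻¹ᵁ O) → V.kap O s ∈ S.obj O

variable {V} in
theorem IsKapStable.kapOn_mem {S : Subsheaf V.sheaf} (hS : V.IsKapStable S) {O : (prod Λ X).Opens}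
    (h : IsStable O) {s : Γ(V.sheaf, O)} (hs : s ∈ S.obj O) : V.kapOn h s ∈ S.obj O :=
  hS O _ (S.res_mem h.le hs)

variable {V} in
theorem IsKapStable.inf {S T : Subsheaf V.sheaf} (hS : V.IsKapStable S) (hT : V.IsKapStable T) :
    V.IsKapStable (S.inf T) :=
  fun O s hs => ⟨hS O s hs.1, hT O s hs.2⟩

/-- The subsheaf of fractions with numerators in a `κ`-stable submodule is `κ`-stable. A section
over `(σ × id)⁻¹ D(g)` has a denominator of the form `σ(g)^n`, and `κ` maps `p / σ(g)^n` to
`κ(p) / g^n`. -/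
theorem isKapStable_fracSubsheaf {O : (prod Λ X).Opens} (h : IsStable O) (hO : IsAffineOpen O)
    (P : Submodule Γ(prod Λ X, O) Γ(V.sheaf, O)) (hP : ∀ y ∈ P, V.kapOn h y ∈ P) :
    V.IsKapStable (fracSubsheaf hO P) := by
  have := V.isQuasicoherent
  intro U s hs x hx hxO
  obtain ⟨g, hg, hgU⟩ := exists_basicOpen hO hx hxO
  have hgO := Scheme.basicOpen_le _ g
  have hg' := preimage_basicOpen_le h g
  have hgU' := Scheme.Hom.preimage_mono (prodFrob Λ X) hgU
  have e := basicOpen_frobOn h g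
  obtain ⟨n, p, hp, hn⟩ := exists_pow_smul_of_fracMem hO P s (frobOn h g) (e.le.trans hgU')
    fun y hy => hs y (hgU' (e.le hy)) (Scheme.basicOpen_le _ _ hy)
  refine ⟨_, hgU, hgO, hg, g ^ n, ?_, _, hP p hp, ?_⟩
  · rw [map_pow]
    exact (isUnit_resO_basicOpen g).pow n
  · have h2 : res V.sheaf hg' p = (prodFrob Λ X).app _ (resO hgO g ^ n) • res V.sheaf hgU' s := by
      have h3 := congrArg (res V.sheaf e.ge) hn
      rw [res_res, res_smul, res_res, map_pow, resO_resO, resO_frobOn h hgO hg', ← map_pow] at h3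
      exact h3
    rw [res_kapOn V h hgO hg', h2, kap_smul, kap_res, map_pow]

/-- The `κ`-sheaf defined by a quasi-coherent `κ`-stable subsheaf. -/
def sub (S : Subsheaf V.sheaf) (hS : S.IsQC) (hκ : V.IsKapStable S) : CartierSheaf Λ X where
  sheaf := S.toModules
  isQuasicoherent :=
    have := V.isQuasicoherent
    hS.isQuasicoherent
  κ := mkκ S.toModules
    (fun O => AddMonoidHom.mk' (fun s => S.toSection (V.kap O (S.ι.app _ s)) (hκ O _ (S.ι_mem s)))
      fun a b => S.ι_injective O (by simp))
    (fun O O' h s => S.ι_injective O' (by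
      change V.kap O' (S.ι.app _ (res S.toModules _ s)) = S.ι.app O' (res S.toModules h _)
      rw [app_res, app_res, kap_res]
      rfl))
    fun O r s => S.ι_injective O (by
      change V.kap O (S.ι.app _ ((prodFrob Λ X).app O r • s)) = S.ι.app O (r • _)
      rw [S.ι.app_smul, S.ι.app_smul, kap_smul]
      rfl)

/-- The inclusion of the `κ`-sheaf defined by a subsheaf. -/
def subι (S : Subsheaf V.sheaf) (hS : S.IsQC) (hκ : V.IsKapStable S) : V.sub S hS hκ ⟶ V :=
  homOfKap (V := V.sub S hS hκ) S.ι fun _ _ => rfl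

end CartierSheaf

theorem exists_stable_ge {A N : Type*} [CommRing A] [AddCommGroup N] [Module A N] {κ : N →+ N}
    (h : ∀ x : N, ∃ P : Submodule A N, P.FG ∧ (∀ y ∈ P, κ y ∈ P) ∧ x ∈ P) {Q : Submodule A N}
    (hQ : Q.FG) : ∃ P : Submodule A N, P.FG ∧ (∀ y ∈ P, κ y ∈ P) ∧ Q ≤ P := by
  obtain ⟨T, rfl⟩ := hQ
  choose P hP hPs hx using h
  refine ⟨⨆ t : T, P t, Submodule.fg_iSup _ fun t => hP t, fun y hy => ?_, Submodule.span_le.2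
    fun t ht => Submodule.mem_iSup_of_mem ⟨t, ht⟩ (hx t)⟩
  induction hy using Submodule.iSup_induction' with
  | mem t y hy => exact Submodule.mem_iSup_of_mem t (hPs t y hy)
  | zero => rw [map_zero]; exact zero_mem _
  | add y z _ _ hy hz => rw [map_add]; exact add_mem hy hz

namespace CartierSheaf

variable (V : CartierSheaf Λ X) [IsSeparated X.hom]

/-- A quasi-coherent `κ`-stable subsheaf can be shrunk, keeping finitely many given sections, such
that its sections over a given stable affine open subset become finitely generated. -/
theorem exists_subsheaf_fg_obj {O : (prod Λ X).Opens} (h : IsStable O) (hO : IsAffineOpen O)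
    [IsNoetherianRing Γ(prod Λ X, O)]
    (hV : ∀ s, ∃ P : Submodule Γ(prod Λ X, O) Γ(V.sheaf, O), P.FG ∧ (∀ y ∈ P, V.kapOn h y ∈ P) ∧
      s ∈ P) {S : Subsheaf V.sheaf} (hS : S.IsQC) (hκ : V.IsKapStable S)
    {H : Set (Σ U, Γ(V.sheaf, U))} (hH : H.Finite) (hHU : ∀ p ∈ H, IsAffineOpen p.1)
    (hHS : ∀ p ∈ H, p.2 ∈ S.obj p.1) :
    ∃ S' : Subsheaf V.sheaf, S'.IsQC ∧ V.IsKapStable S' ∧ (∀ U, S'.obj U ≤ S.obj U) ∧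
      (∀ p ∈ H, p.2 ∈ S'.obj p.1) ∧ (S'.obj O).FG := by
  have := V.isQuasicoherent
  have hHfin := hH.to_subtype
  choose Q hQ hQS hQf using fun p : H => exists_fg_fracMem hO hS (hHU p p.2) p.1.2 (hHS p p.2)
  obtain ⟨P, hP, hPs, hQP⟩ := exists_stable_ge hV (Submodule.fg_iSup Q hQ)
  -- `S` is intersected with the fractions with numerators in `P ⊓ S(O)`, where the `κ`-stable
  -- module `P` contains numerators of the given sections.
  have hP' : (P ⊓ S.obj O).FG := Submodule.FG.of_le hP inf_le_left
  have hQP' : ∀ p, Q p ≤ P ⊓ S.obj O := fun p => le_inf ((le_iSup Q p).trans hQP) (hQS p)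
  have hPs' : ∀ y ∈ P ⊓ S.obj O, V.kapOn h y ∈ P ⊓ S.obj O :=
    fun y hy => ⟨hPs y hy.1, hκ.kapOn_mem h hy.2⟩
  refine ⟨S.inf (fracSubsheaf hO (P ⊓ S.obj O)), hS.inf (isQC_fracSubsheaf hO _),
    hκ.inf (V.isKapStable_fracSubsheaf h hO _ hPs'), fun U => inf_le_left, fun p hp => ?_, ?_⟩
  · exact ⟨hHS p hp, fun x hx hxO => (hQf ⟨p, hp⟩ x hx hxO).mono (hQP' ⟨p, hp⟩)⟩
  · exact Submodule.FG.of_le hP' fun s hs => mem_of_mem_fracSubsheaf hO _ hs.2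

/-- Finitely many sections of a `κ`-sheaf are contained in a `κ`-stable subsheaf with finitely
generated sections over finitely many given stable affine open subsets. -/
theorem exists_subsheaf_fg {ι : Type*} {O : ι → (prod Λ X).Opens} (h : ∀ i, IsStable (O i))
    (hO : ∀ i, IsAffineOpen (O i)) [∀ i, IsNoetherianRing Γ(prod Λ X, O i)]
    (hV : ∀ i s, ∃ P : Submodule Γ(prod Λ X, O i) Γ(V.sheaf, O i), P.FG ∧
      (∀ y ∈ P, V.kapOn (h i) y ∈ P) ∧ s ∈ P) (l : List ι) {S : Subsheaf V.sheaf} (hS : S.IsQC)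
    (hκ : V.IsKapStable S) {H : Set (Σ U, Γ(V.sheaf, U))} (hH : H.Finite)
    (hHU : ∀ p ∈ H, IsAffineOpen p.1) (hHS : ∀ p ∈ H, p.2 ∈ S.obj p.1) :
    ∃ S' : Subsheaf V.sheaf, S'.IsQC ∧ V.IsKapStable S' ∧ (∀ U, S'.obj U ≤ S.obj U) ∧
      (∀ p ∈ H, p.2 ∈ S'.obj p.1) ∧ ∀ i ∈ l, (S'.obj (O i)).FG := by
  induction l generalizing S H with
  | nil => exact ⟨S, hS, hκ, fun _ => le_rfl, hHS, by simp⟩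
  | cons i l ih =>
    obtain ⟨S₁, hS₁, hκ₁, hle₁, hH₁, T, hT⟩ :=
      V.exists_subsheaf_fg_obj (h i) (hO i) (hV i) hS hκ hH hHU hHS
    -- The generators `T` of the sections over `O i` are kept in the subsequent steps, so that these
    -- sections stay finitely generated without any assumption on `O i ∩ O j`.
    obtain ⟨S₂, hS₂, hκ₂, hle₂, hH₂, hfg⟩ := ih hS₁ hκ₁
      (H := H ∪ (fun t => (⟨O i, t⟩ : Σ U, Γ(V.sheaf, U))) '' (T : Set _))
      (hH.union (T.finite_toSet.image _)) (by
        rintro p (hp | ⟨t, ht, rfl⟩)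
        · exact hHU p hp
        · exact hO i) (by
        rintro p (hp | ⟨t, ht, rfl⟩)
        · exact hH₁ p hp
        · exact hT.le (Submodule.subset_span ht))
    refine ⟨S₂, hS₂, hκ₂, fun U => (hle₂ U).trans (hle₁ U), fun p hp => hH₂ p (Or.inl hp), ?_⟩
    intro j hj
    rcases List.mem_cons.1 hj with rfl | hj
    · refine ⟨T, le_antisymm (Submodule.span_le.2 fun t ht => hH₂ ⟨O j, t⟩ (Or.inr ⟨t, ht, rfl⟩)) ?_⟩
      rw [hT]
      exact hle₂ _
    · exact hfg j hj

omit [IsSeparated X.hom] [Finite k] in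
theorem isFiniteType_of_fg {Z : Scheme.{u}} {M : Z.Modules} [M.IsQuasicoherent] {ι : Type*}
    {O : ι → Z.Opens} (hO : ∀ i, IsAffineOpen (O i)) (hc : ∀ x, ∃ i, x ∈ O i)
    (h : ∀ i, (⊤ : Submodule Γ(Z, O i) Γ(M, O i)).FG) : M.IsFiniteType := by
  refine isFiniteType_of_generates M fun x => ?_
  obtain ⟨i, hi⟩ := hc x
  obtain ⟨T, hT⟩ := h i
  exact ⟨O i, T, inferInstance, Subtype.val, hi, generates_of_fg (hO i) _ (by
    rw [← hT]
    congr 1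
    exact Subtype.range_coe)⟩

omit [IsSeparated X.hom] [Finite k] in
theorem _root_.CartierSheaves.Subsheaf.top_fg {Z : Scheme.{u}} {M : Z.Modules} {S : Subsheaf M}
    {O : Z.Opens} (h : (S.obj O).FG) : (⊤ : Submodule Γ(Z, O) Γ(S.toModules, O)).FG :=
  (Submodule.fg_top (S.obj O)).2 h

/-- The whole sheaf as a subsheaf. -/
def _root_.CartierSheaves.Subsheaf.top {Z : Scheme.{u}} (M : Z.Modules) : Subsheaf M where
  obj _ := ⊤
  res_mem _ _ _ := trivial
  mem_of_local _ _ := trivial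

/-- Finitely many sections of a `κ`-sheaf over affine open subsets are contained in a coherent
`κ`-subsheaf if sections over the members of a finite stable affine covering are contained in finitely
generated `κ`-stable submodules. -/
theorem exists_coherent {ι : Type*} [Finite ι] {O : ι → (prod Λ X).Opens}
    (h : ∀ i, IsStable (O i)) (hO : ∀ i, IsAffineOpen (O i)) (hc : ∀ x, ∃ i, x ∈ O i)
    [∀ i, IsNoetherianRing Γ(prod Λ X, O i)]
    (hV : ∀ i s, ∃ P : Submodule Γ(prod Λ X, O i) Γ(V.sheaf, O i), P.FG ∧
      (∀ y ∈ P, V.kapOn (h i) y ∈ P) ∧ s ∈ P) {H : Set (Σ U, Γ(V.sheaf, U))} (hH : H.Finite)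
    (hHU : ∀ p ∈ H, IsAffineOpen p.1) :
    ∃ (L : CartierSheaf Λ X) (i : L ⟶ V), Mono i.hom ∧ isCoherent Λ X L ∧
      ∀ p ∈ H, ∃ y, i.hom.app p.1 y = p.2 := by
  have := Fintype.ofFinite ι
  obtain ⟨S, hS, hκ, -, hHS, hfg⟩ := V.exists_subsheaf_fg h hO hV Finset.univ.toList
    (S := Subsheaf.top V.sheaf) (fun U _ r s _ => ⟨0, trivial⟩) (fun _ _ _ => trivial) hH hHU
    fun _ _ => trivial
  refine ⟨V.sub S hS hκ, V.subι S hS hκ, inferInstanceAs (Mono S.ι), ?_,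
    fun p hp => ⟨S.toSection p.2 (hHS p hp), rfl⟩⟩
  have := (V.sub S hS hκ).isQuasicoherent
  exact isFiniteType_of_fg (M := (V.sub S hS hκ).sheaf) hO hc fun i =>
    Subsheaf.top_fg (hfg i (by simp))

theorem isIndCoherent_of_exists {ι : Type*} [Finite ι] {O : ι → (prod Λ X).Opens}
    (h : ∀ i, IsStable (O i)) (hO : ∀ i, IsAffineOpen (O i)) (hc : ∀ x, ∃ i, x ∈ O i)
    [∀ i, IsNoetherianRing Γ(prod Λ X, O i)]
    (hV : ∀ i s, ∃ P : Submodule Γ(prod Λ X, O i) Γ(V.sheaf, O i), P.FG ∧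
      (∀ y ∈ P, V.kapOn (h i) y ∈ P) ∧ s ∈ P) : isIndCoherent Λ X V := by
  intro U m x hx
  obtain ⟨W, hW, hxW, hWU⟩ := exists_isAffineOpen_mem_and_subset (U := U) hx
  obtain ⟨L, i, hi, hL, hy⟩ := V.exists_coherent h hO hc hV
    (H := {⟨W, res V.sheaf hWU m⟩}) (Set.finite_singleton _) (by rintro _ rfl; exact hW)
  exact ⟨W, hWU, hxW, L, i, hi, hL, hy _ rfl⟩

end CartierSheaf

end CartierSheaves

/-! ### Quotients, images and iterates of `κ`-sheaves -/

namespace CartierSheaves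

section Cokernel

variable {X : Scheme.{u}} {M N : X.Modules}

theorem isQuasicoherent_of_isIso_fromTildeΓ (M : X.Modules)
    (h : ∀ (U : X.Opens) (hU : IsAffineOpen U), IsIso (M.restrict hU.fromSpec).fromTildeΓ) :
    M.IsQuasicoherent := by
  have h2 (U : X.affineOpens) : (M.over U.1).IsQuasicoherent :=
    (presOver M U.1 (pres1 M U.2 (h U.1 U.2))).isQuasicoherent
  exact SheafOfModules.IsQuasicoherent.of_coversTop M (fun U : X.affineOpens => U.1) (by
    rw [Opens.coversTop_iff]
    exact iSup_affineOpens_eq_top X)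

/-- On an affine open subset, a morphism of quasi-coherent sheaves comes from a homomorphism of
modules, whose cokernel defines the cokernel of sheaves. -/
theorem isQuasicoherent_cokernel (φ : M ⟶ N) [M.IsQuasicoherent] [N.IsQuasicoherent] :
    (cokernel φ).IsQuasicoherent := by
  refine isQuasicoherent_of_isIso_fromTildeΓ _ fun U hU => ?_
  let R := Scheme.Modules.restrictFunctor hU.fromSpec
  have hM : (M.restrict hU.fromSpec).IsQuasicoherent := inferInstance
  have hN : (N.restrict hU.fromSpec).IsQuasicoherent := inferInstance
  rw [isQuasicoherent_iff_isIso_fromTildeΓ, isIso_fromTildeΓ_iff] at hM hN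
  obtain ⟨A, ⟨eA⟩⟩ := hM
  obtain ⟨B, ⟨eB⟩⟩ := hN
  rw [isIso_fromTildeΓ_iff]
  let F := tilde.functor Γ(X, U)
  let g : A ⟶ B := F.preimage (eA.hom ≫ R.map φ ≫ eB.inv)
  have hg : F.map g ≫ eB.hom = eA.hom ≫ R.map φ := by
    rw [F.map_preimage, Category.assoc, Category.assoc, eB.inv_hom_id, Category.comp_id]
  exact ⟨cokernel g, ⟨PreservesCokernel.iso F g ≪≫ cokernel.mapIso _ _ eA eB hg ≪≫
    (PreservesCokernel.iso R φ).symm⟩⟩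

theorem epi_iff_sections (φ : M ⟶ N) : Epi φ ↔ ∀ (U : X.Opens) (z : Γ(N, U)), ∀ x ∈ U,
    ∃ (V : X.Opens) (h : V ≤ U), x ∈ V ∧ ∃ y, φ.app V y = res N h z := by
  rw [← ShortComplex.exact_iff_epi (ShortComplex.mk φ (0 : N ⟶ N) comp_zero) rfl,
    exact_iff_sections]
  exact ⟨fun h U z => h U z rfl, fun h U z _ => h U z⟩

theorem app_surjective_of_epi (φ : M ⟶ N) [Epi φ] [M.IsQuasicoherent] [N.IsQuasicoherent]
    {U : X.Opens} (hU : IsAffineOpen U) : Function.Surjective (φ.app U) := fun z =>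
  exact_of_isAffineOpen φ hU z ((epi_iff_sections φ).1 inferInstance U z)

/-- Pushforward along an affine morphism preserves short exact sequences of quasi-coherent sheaves. -/
theorem exact_pushforward {Y : Scheme.{u}} (f : X ⟶ Y) [IsAffineHom f] (S : ShortComplex X.Modules)
    (hS : S.Exact) [S.X₁.IsQuasicoherent] [S.X₂.IsQuasicoherent] :
    (S.map (Scheme.Modules.pushforward f)).Exact := by
  rw [exact_iff_sections] at hS ⊢
  intro U z hz x hx
  obtain ⟨W, hW, hxW, hWU'⟩ := exists_isAffineOpen_mem_and_subset (U := U) hx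
  have hWU : W ≤ U := hWU'
  have h0 : S.g.app (f ⁻¹ᵁ W) (res S.X₂ (f.preimage_mono hWU) z) = 0 :=
    (app_res S.g (f.preimage_mono hWU) z).trans ((congrArg _ hz).trans (map_zero _))
  obtain ⟨y, hy⟩ := exact_of_isAffineOpen S.f (hW.preimage f) _ (hS _ _ h0)
  exact ⟨W, hWU, hxW, y, hy⟩

theorem epi_pushforward {Y : Scheme.{u}} (f : X ⟶ Y) [IsAffineHom f] (φ : M ⟶ N) [Epi φ]
    [M.IsQuasicoherent] [N.IsQuasicoherent] : Epi ((Scheme.Modules.pushforward f).map φ) := by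
  rw [epi_iff_sections]
  intro U z x hx
  obtain ⟨W, hW, hxW, hWU⟩ := exists_isAffineOpen_mem_and_subset (U := U) hx
  obtain ⟨y, hy⟩ := app_surjective_of_epi φ (hW.preimage f) (res N (f.preimage_mono hWU) z)
  exact ⟨W, hWU, hxW, y, hy⟩

/-- A morphism of quasi-coherent sheaves vanishes if it does so on the sections over the members of
an affine covering. -/
theorem hom_eq_zero_of_affine [M.IsQuasicoherent] (φ : M ⟶ N) {ι : Type*} {O : ι → X.Opens}
    (hO : ∀ i, IsAffineOpen (O i)) (hc : ∀ x, ∃ i, x ∈ O i) (h : ∀ i s, φ.app (O i) s = 0) :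
    φ = 0 := by
  refine hom_ext_apply fun U s => res_ext' N fun x hx => ?_
  obtain ⟨i, hi⟩ := hc x
  obtain ⟨g, hg, hgU⟩ := exists_basicOpen (hO i) hx hi
  obtain ⟨n, t, ht⟩ := exists_res_eq (hO i) g (res M hgU s)
  refine ⟨_, hgU, hg, ?_⟩
  have h1 : resO (X.basicOpen_le g) g ^ n • res N hgU (φ.app U s) = 0 := by
    rw [← app_res, ← φ.app_smul, ← ht, app_res, h, map_zero]
  rw [app_zero_apply, map_zero]
  exact (((isUnit_resO_basicOpen g).pow n).smul_eq_zero).1 h1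

theorem isQC_imageSubsheaf (φ : M ⟶ N) [M.IsQuasicoherent] [N.IsQuasicoherent] :
    (imageSubsheaf φ).IsQC := by
  intro U hU r s hs
  obtain ⟨y, hy⟩ := exact_of_isAffineOpen φ
    (hU.basicOpen r) (res N (X.basicOpen_le r) s) hs
  obtain ⟨n, t, ht⟩ := exists_res_eq hU r y
  obtain ⟨m, hm⟩ := exists_pow_smul_eq hU r (φ.app U t) (r ^ n • s) (by
    rw [← app_res, ht, φ.app_smul, hy, res_smul, map_pow])
  refine ⟨m + n, fun x hx => ⟨U, le_rfl, hx, r ^ m • t, ?_⟩⟩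
  rw [φ.app_smul, hm, res_self, ← mul_smul, pow_add]

end Cokernel

variable {k : Type u} [Field k] [Finite k] {Λ : Type u} [CommRing Λ] [Algebra k Λ]
  {X : Over (Spec (.of k))}

instance isAffineHom_prodFrob [IsFinite (frob X).left] : IsAffineHom (prodFrob Λ X) :=
  MorphismProperty.of_isPullback (isPullback_prodMap Λ (frob X)) inferInstance

namespace CartierSheaf

section Quotient

variable [IsFinite (frob X).left] {L V : CartierSheaf Λ X} (i : L ⟶ V)

omit [IsFinite (frob X).left] in
theorem exact_cokernel : (ShortComplex.mk i.hom (cokernel.π i.hom) (cokernel.condition _)).Exact :=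
  ShortComplex.exact_cokernel i.hom

omit [IsFinite (frob X).left] in
theorem pushforward_map_comp_κ_comp_cokernel :
    (Scheme.Modules.pushforward (prodFrob Λ X)).map i.hom ≫ V.κ ≫ cokernel.π i.hom = 0 := by
  have h : (Scheme.Modules.pushforward (prodFrob Λ X)).map i.hom ≫ V.κ = L.κ ≫ i.hom := i.comm
  exact (Category.assoc ((Scheme.Modules.pushforward (prodFrob Λ X)).map i.hom) V.κ
    (cokernel.π i.hom)).symm.trans ((congrArg (· ≫ cokernel.π i.hom) h).trans
    ((Category.assoc L.κ i.hom (cokernel.π i.hom)).trans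
      ((congrArg (L.κ ≫ ·) (cokernel.condition i.hom)).trans comp_zero)))

/-- The quotient of a `κ`-sheaf by the image of a morphism. -/
def quotient : CartierSheaf Λ X :=
  have := L.isQuasicoherent
  have := V.isQuasicoherent
  have hqc := isQuasicoherent_cokernel i.hom
  let S := (ShortComplex.mk i.hom (cokernel.π i.hom) (cokernel.condition _)).map
    (Scheme.Modules.pushforward (prodFrob Λ X))
  have hS : S.Exact := @exact_pushforward _ _ (prodFrob Λ X) _
    (ShortComplex.mk i.hom (cokernel.π i.hom) (cokernel.condition _)) (exact_cokernel i) ‹_› ‹_›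
  have : Epi S.g := epi_pushforward (prodFrob Λ X) (cokernel.π i.hom)
  { sheaf := cokernel i.hom
    isQuasicoherent := hqc
    κ := hS.desc (V.κ ≫ cokernel.π i.hom) (pushforward_map_comp_κ_comp_cokernel i) }

/-- The projection to the quotient `κ`-sheaf. -/
def quotientπ : V ⟶ quotient i where
  hom := cokernel.π i.hom
  comm := by
    have := L.isQuasicoherent
    have := V.isQuasicoherent
    have hqc := isQuasicoherent_cokernel i.hom
    let S := (ShortComplex.mk i.hom (cokernel.π i.hom) (cokernel.condition _)).map
      (Scheme.Modules.pushforward (prodFrob Λ X))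
    have hS : S.Exact := @exact_pushforward _ _ (prodFrob Λ X) _
      (ShortComplex.mk i.hom (cokernel.π i.hom) (cokernel.condition _)) (exact_cokernel i) ‹_› ‹_›
    have : Epi S.g := epi_pushforward (prodFrob Λ X) (cokernel.π i.hom)
    exact hS.g_desc _ _

theorem comp_quotientπ : i ≫ quotientπ i = 0 := hom_ext (cokernel.condition i.hom)

theorem shortExact_quotient [Mono i.hom] :
    ((ShortComplex.mk i (quotientπ i) (comp_quotientπ i)).map forget).ShortExact where
  exact := exact_cokernel i
  mono_f := ‹Mono i.hom›
  epi_g := inferInstanceAs (Epi (cokernel.π i.hom))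

end Quotient

section Iterate

variable (V : CartierSheaf Λ X)

/-- Over a stable open subset, sections of the source of `κ^n` are sections of `V`. -/
def iterSection {O : (prod Λ X).Opens} (h : IsStable O) :
    (n : ℕ) → Γ(V.sheaf, O) →+ Γ(V.iterSource n, O)
  | 0 => AddMonoidHom.id _
  | n + 1 => (res (V.iterSource n) h.le).comp (iterSection h n)

theorem iterSection_bijective {O : (prod Λ X).Opens} (h : IsStable O) (n : ℕ) :
    Function.Bijective (V.iterSection h n) := by
  induction n with
  | zero => exact Function.bijective_id
  | succ n ih => exact (res_bijective_of_eq (V.iterSource n) h.le h.symm).comp ih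

theorem iterκ_iterSection {O : (prod Λ X).Opens} (h : IsStable O) (n : ℕ) (s : Γ(V.sheaf, O)) :
    (V.iterκ n).app O (V.iterSection h n s) = (V.kapOn h)^[n] s := by
  induction n with
  | zero => rfl
  | succ n ih =>
    rw [Function.iterate_succ_apply', ← ih]
    exact congrArg (V.kap O) (app_res (V.iterκ n) h.le (V.iterSection h n s))

theorem iterate_kapOn_eq_zero {O : (prod Λ X).Opens} (h : IsStable O) {n : ℕ} (hn : V.iterκ n = 0)
    (s : Γ(V.sheaf, O)) : (V.kapOn h)^[n] s = 0 := by
  rw [← iterκ_iterSection, hn]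
  rfl

theorem isQuasicoherent_iterSource [QuasiCompact (prodFrob Λ X)] [QuasiSeparated (prodFrob Λ X)]
    (n : ℕ) : (V.iterSource n).IsQuasicoherent := by
  induction n with
  | zero => exact V.isQuasicoherent
  | succ n ih => exact isQuasicoherent_pushforward (prodFrob Λ X) (V.iterSource n)

/-- Nilpotence of `κ` can be checked on sections over the members of a stable affine covering. -/
theorem iterκ_eq_zero [IsFinite (frob X).left] {ι : Type*} {O : ι → (prod Λ X).Opens}
    (h : ∀ i, IsStable (O i)) (hO : ∀ i, IsAffineOpen (O i)) (hc : ∀ x, ∃ i, x ∈ O i) {n : ℕ}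
    (hn : ∀ i s, (V.kapOn (h i))^[n] s = 0) : V.iterκ n = 0 := by
  have := V.isQuasicoherent_iterSource n
  refine hom_eq_zero_of_affine _ hO hc fun i s => ?_
  obtain ⟨t, rfl⟩ := (V.iterSection_bijective (h i) n).2 s
  rw [iterκ_iterSection, hn]

end Iterate

section Image

variable {L V : CartierSheaf Λ X} (φ : L ⟶ V)

/-- Sections of the image over the preimage of an affine open subset under `σ × id`, which is affine, lift
globally. -/
theorem isKapStable_imageSubsheaf [IsFinite (frob X).left] :
    V.IsKapStable (imageSubsheaf φ.hom) := by
  have := L.isQuasicoherent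
  have := V.isQuasicoherent
  intro U s hs x hx
  obtain ⟨W, hW, hxW, hWU'⟩ := exists_isAffineOpen_mem_and_subset (U := U) hx
  have hWU : W ≤ U := hWU'
  obtain ⟨y, hy⟩ := exact_of_isAffineOpen φ.hom (hW.preimage (prodFrob Λ X))
    (res V.sheaf (Scheme.Hom.preimage_mono _ hWU) s)
    ((imageSubsheaf φ.hom).res_mem (Scheme.Hom.preimage_mono _ hWU) hs)
  refine ⟨W, hWU, hxW, L.kap W y, ?_⟩
  exact (hom_kap φ W y).symm.trans ((congrArg (V.kap W) hy).trans (kap_res V hWU s))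

end Image

end CartierSheaf

end CartierSheaves

/-! ### Locally nil-coherent `κ`-sheaves on affine open subsets -/

namespace CartierSheaves

/-- A morphism of sheaves on sections, as a linear map. -/
def appLin {Z : Scheme.{u}} {M N : Z.Modules} (φ : M ⟶ N) (U : Z.Opens) :
    Γ(M, U) →ₗ[Γ(Z, U)] Γ(N, U) where
  toFun s := φ.app U s
  map_add' s t := map_add _ s t
  map_smul' r s := φ.app_smul r s

variable {k : Type u} [Field k] [Finite k] {Λ : Type u} [CommRing Λ] [Algebra k Λ]
  {X : Over (Spec (.of k))}

namespace CartierSheaf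

variable {V : CartierSheaf Λ X} {O : (prod Λ X).Opens}

/-- Up to a multiple, a section over an affine open subset comes from one of the subsheaves forming
a union. -/
theorem exists_app_eq_smul_of_isUnionOf {P : ObjectProperty (CartierSheaf Λ X)}
    (hV : isUnionOf P V) (hO : IsAffineOpen O) (s : Γ(V.sheaf, O)) {x : prod Λ X} (hx : x ∈ O) :
    ∃ (L : CartierSheaf Λ X) (j : L ⟶ V), P L ∧ ∃ r : Γ(prod Λ X, O), x ∈ (prod Λ X).basicOpen r ∧
      ∃ y, j.hom.app O y = r • s := by
  have := V.isQuasicoherent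
  obtain ⟨U, hU, hxU, L, j, -, hL, y, hy⟩ := hV O s x hx
  have hy' : j.hom.app U y = res V.sheaf hU s := hy
  have := L.isQuasicoherent
  obtain ⟨g, hg, hgU⟩ := exists_basicOpen hO hxU hx
  obtain ⟨n, t, ht⟩ := exists_res_eq hO g (res L.sheaf hgU y)
  obtain ⟨m, hm⟩ := exists_pow_smul_eq hO g (j.hom.app O t) (g ^ n • s) (by
    rw [← app_res, ht, j.hom.app_smul, app_res, hy', res_smul, res_res, map_pow])
  refine ⟨L, j, hL, g ^ (m + n + 1), ?_, g ^ (m + 1) • t, ?_⟩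
  · rwa [Scheme.basicOpen_pow _ _ (Nat.succ_pos _)]
  · rw [j.hom.app_smul, pow_succ', mul_smul, hm, ← mul_smul, ← mul_smul]
    congr 1
    ring

/-- The sections of an ind-coherent `κ`-sheaf over a stable affine open subset: finitely many
coherent `κ`-subsheaves suffice locally, by quasi-compactness. -/
theorem exists_fg_stable (hV : isIndCoherent Λ X V) (h : IsStable O) (hO : IsAffineOpen O)
    (s : Γ(V.sheaf, O)) : ∃ P : Submodule Γ(prod Λ X, O) Γ(V.sheaf, O), P.FG ∧
      (∀ y ∈ P, V.kapOn h y ∈ P) ∧ s ∈ P := by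
  obtain ⟨P, hP, hP', hs⟩ : ∃ P : Submodule Γ(prod Λ X, O) Γ(V.sheaf, O), P.FG ∧
      (∀ y ∈ P, V.kapOn h y ∈ P) ∧
        ∀ x ∈ (O : Set (prod Λ X)), ∃ r : Γ(prod Λ X, O), x ∈ (prod Λ X).basicOpen r ∧ r • s ∈ P := by
    refine IsCompact.induction_on (p := fun T => ∃ P : Submodule Γ(prod Λ X, O) Γ(V.sheaf, O), P.FG ∧
      (∀ y ∈ P, V.kapOn h y ∈ P) ∧
        ∀ x ∈ T, ∃ r : Γ(prod Λ X, O), x ∈ (prod Λ X).basicOpen r ∧ r • s ∈ P)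
      hO.isCompact ?_ ?_ ?_ ?_
    · exact ⟨⊥, Submodule.fg_bot, by simp, by simp⟩
    · rintro T T' hT ⟨P, hP, hP', h1⟩
      exact ⟨P, hP, hP', fun x hx => h1 x (hT hx)⟩
    · rintro T T' ⟨P, hP, hP', h1⟩ ⟨Q, hQ, hQ', h2⟩
      refine ⟨P ⊔ Q, hP.sup hQ, sup_stable hP' hQ', ?_⟩
      rintro x (hx | hx)
      · obtain ⟨r, hr, hr'⟩ := h1 x hx
        exact ⟨r, hr, Submodule.mem_sup_left hr'⟩
      · obtain ⟨r, hr, hr'⟩ := h2 x hx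
        exact ⟨r, hr, Submodule.mem_sup_right hr'⟩
    · intro x hx
      obtain ⟨L, j, hL, r, hr, y, hy⟩ := exists_app_eq_smul_of_isUnionOf hV hO s hx
      have : L.sheaf.IsFiniteType := hL
      have := L.isQuasicoherent
      exact ⟨(prod Λ X).basicOpen r, mem_nhdsWithin_of_mem_nhds
        (((prod Λ X).basicOpen r).isOpen.mem_nhds hr), (⊤ : Submodule _ _).map (appLin j.hom O),
        (fg_of_isFiniteType hO).map _,
        map_stable (A := Γ(prod Λ X, O)) (f := appLin _ O) (κ := L.kapOn h) (semiconj_kapOn j h) fun _ _ => trivial,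
        fun x' hx' => ⟨r, hx', y, trivial, hy⟩⟩
  exact ⟨P, hP, hP', mem_of_local hO P s hs⟩

/-- The elements all of whose multiples are annihilated by `κ^m` form a submodule, although
`κ^m` is not linear. -/
theorem iterate_map_smul_zero_submodule {A N : Type*} [CommRing A] [AddCommGroup N] [Module A N]
    (κ : N →+ N) (m : ℕ) : ∃ P : Submodule A N, ∀ y, y ∈ P ↔ ∀ a : A, κ^[m] (a • y) = 0 :=
  ⟨{  carrier := {y | ∀ a : A, κ^[m] (a • y) = 0}
      add_mem' := fun {y z} hy hz a => by
        rw [smul_add, iterate_map_add, hy a, hz a, add_zero]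
      zero_mem' := fun a => by rw [smul_zero, iterate_map_zero]
      smul_mem' := fun b y hy a => by rw [smul_smul]; exact hy _ }, fun _ => Iff.rfl⟩

/-- The analogue of `exists_fg_stable` for locally nilpotent `κ`-sheaves. -/
theorem exists_iterate_eq_zero (hV : isLocallyNilpotent Λ X V) (h : IsStable O)
    (hO : IsAffineOpen O) (s : Γ(V.sheaf, O)) :
    ∃ m : ℕ, ∀ a : Γ(prod Λ X, O), (V.kapOn h)^[m] (a • s) = 0 := by
  have hmono {m n : ℕ} (hmn : m ≤ n) {y : Γ(V.sheaf, O)} (hy : (V.kapOn h)^[m] y = 0) :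
      (V.kapOn h)^[n] y = 0 :=
    (Submodule.mem_bot Γ(prod Λ X, O)).1 (iterate_mem_of_le (L := ⊥) (by simp) hmn (by simpa using hy))
  obtain ⟨m, hm⟩ : ∃ m : ℕ, ∀ x ∈ (O : Set (prod Λ X)), ∃ r : Γ(prod Λ X, O),
      x ∈ (prod Λ X).basicOpen r ∧ ∀ a : Γ(prod Λ X, O), (V.kapOn h)^[m] (a • r • s) = 0 := by
    refine IsCompact.induction_on (p := fun T => ∃ m : ℕ, ∀ x ∈ T, ∃ r : Γ(prod Λ X, O),
      x ∈ (prod Λ X).basicOpen r ∧ ∀ a : Γ(prod Λ X, O), (V.kapOn h)^[m] (a • r • s) = 0)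
      hO.isCompact ?_ ?_ ?_ ?_
    · exact ⟨0, by simp⟩
    · rintro T T' hT ⟨m, h1⟩
      exact ⟨m, fun x hx => h1 x (hT hx)⟩
    · rintro T T' ⟨m, h1⟩ ⟨n, h2⟩
      refine ⟨max m n, ?_⟩
      rintro x (hx | hx)
      · obtain ⟨r, hr, hr'⟩ := h1 x hx
        exact ⟨r, hr, fun a => hmono (le_max_left _ _) (hr' a)⟩
      · obtain ⟨r, hr, hr'⟩ := h2 x hx
        exact ⟨r, hr, fun a => hmono (le_max_right _ _) (hr' a)⟩
    · intro x hx
      obtain ⟨L, j, ⟨m, hm⟩, r, hr, y, hy⟩ := exists_app_eq_smul_of_isUnionOf hV hO s hx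
      refine ⟨(prod Λ X).basicOpen r, mem_nhdsWithin_of_mem_nhds
        (((prod Λ X).basicOpen r).isOpen.mem_nhds hr), m, fun x' hx' => ⟨r, hx', fun a => ?_⟩⟩
      rw [← hy, ← j.hom.app_smul, ← ((semiconj_kapOn j h).iterate_right m).eq,
        iterate_kapOn_eq_zero L h hm, map_zero]
  obtain ⟨P, hP⟩ := iterate_map_smul_zero_submodule (A := Γ(prod Λ X, O)) (V.kapOn h) m
  refine ⟨m, (hP s).1 (mem_of_local hO P s fun x hx => ?_)⟩
  obtain ⟨r, hr, hr'⟩ := hm x hx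
  exact ⟨r, hr, (hP _).2 hr'⟩

/-- The sections of a locally nil-coherent `κ`-sheaf over a stable affine open subset. -/
theorem isNilCoherent_of_isLocallyNilCoherent (hV : isLocallyNilCoherent Λ X V) (h : IsStable O)
    (hO : IsAffineOpen O) : IsNilCoherent Γ(prod Λ X, O) (V.kapOn h) := by
  obtain ⟨hV, L, N, i, p, w, hS, hL, hN⟩ := hV
  refine ⟨exists_fg_stable hV h hO, (⊤ : Submodule _ _).map (appLin i.hom O), ?_,
    map_stable (A := Γ(prod Λ X, O)) (f := appLin _ O) (κ := L.kapOn h) (semiconj_kapOn i h) fun _ _ => trivial, fun s => ?_⟩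
  · have : L.sheaf.IsFiniteType := hL
    have := L.isQuasicoherent
    exact (fg_of_isFiniteType hO).map _
  · obtain ⟨m, hm⟩ := exists_iterate_eq_zero hN h hO (p.hom.app O s)
    refine ⟨m, fun a => ?_⟩
    have := L.isQuasicoherent
    have := V.isQuasicoherent
    have h1 := (exact_iff_sections _).1 hS.exact O ((V.kapOn h)^[m] (a • s)) (by
      change p.hom.app O _ = 0
      rw [((semiconj_kapOn p h).iterate_right m).eq, p.hom.app_smul, hm])
    obtain ⟨y, hy⟩ := exact_of_isAffineOpen i.hom hO _ h1
    exact ⟨y, trivial, hy⟩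

variable [IsSeparated X.hom] [IsFinite (frob X).left] {ι : Type*} [Finite ι]
  {O : ι → (prod Λ X).Opens} (h : ∀ i, IsStable (O i)) (hO : ∀ i, IsAffineOpen (O i))
  (hc : ∀ x, ∃ i, x ∈ O i)

omit [IsSeparated X.hom] [Finite ι] [IsFinite (frob X).left] in
theorem smul_mem_imageSubsheaf {N F : CartierSheaf Λ X} (ψ : F ⟶ N) (i : ι) {g : Γ(prod Λ X, O i)}
    (z : Γ(N.sheaf, (prod Λ X).basicOpen g)) {n : ℕ} (y : Γ(F.sheaf, O i))
    (hy : res N.sheaf (Scheme.basicOpen_le _ g) (ψ.hom.app (O i) y) =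
      resO (Scheme.basicOpen_le _ g) g ^ n • z) :
    z ∈ (imageSubsheaf ψ.hom).obj ((prod Λ X).basicOpen g) := by
  obtain ⟨b, hb⟩ := ((isUnit_resO_basicOpen g).pow n).exists_left_inv
  intro x hx
  refine ⟨_, le_rfl, hx, b • res F.sheaf (Scheme.basicOpen_le _ g) y, ?_⟩
  rw [ψ.hom.app_smul, app_res, hy, ← mul_smul, hb, one_smul, res_self]

omit [IsSeparated X.hom] in
include hO hc in
/-- If on each member of a covering some power of `κ` maps the sections of `F` to zero in `N`, then
the image of `F` in `N` is nilpotent. -/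
theorem exists_isNilpotent_image {N F : CartierSheaf Λ X} (ψ : F ⟶ N)
    (hψ : ∀ i, ∃ m : ℕ, ∀ y, (N.kapOn (h i))^[m] (ψ.hom.app (O i) y) = 0) :
    ∃ (I : CartierSheaf Λ X) (j : I ⟶ N), Mono j.hom ∧ isNilpotent Λ X I ∧
      ∀ U, ∀ s ∈ (imageSubsheaf ψ.hom).obj U, ∃ y, j.hom.app U y = s := by
  have := N.isQuasicoherent
  have := F.isQuasicoherent
  let S := imageSubsheaf ψ.hom
  have hS : S.IsQC := isQC_imageSubsheaf ψ.hom
  have hκ : N.IsKapStable S := isKapStable_imageSubsheaf ψ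
  refine ⟨N.sub S hS hκ, N.subι S hS hκ, inferInstanceAs (Mono S.ι), ?_,
    fun U s hs => ⟨S.toSection s hs, rfl⟩⟩
  choose m hm using hψ
  refine ⟨⨆ i, m i, iterκ_eq_zero _ h hO hc fun i s => S.ι_injective (O i) ?_⟩
  obtain ⟨y, hy⟩ := exact_of_isAffineOpen ψ.hom (hO i) (S.ι.app (O i) s) (S.ι_mem s)
  have h1 : (N.kapOn (h i))^[⨆ i, m i] (S.ι.app (O i) s) = 0 := by
    rw [← hy]
    exact (Submodule.mem_bot Γ(prod Λ X, O i)).1 (iterate_mem_of_le (L := ⊥) (by simp)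
      (le_ciSup (Finite.bddAbove_range m) i) (by simpa using hm i y))
  refine Eq.trans ?_ (h1.trans (map_zero _).symm)
  exact ((semiconj_kapOn (N.subι S hS hκ) (h i)).iterate_right _).eq s

include hO hc in
/-- A `κ`-sheaf is locally nil-coherent if its sections over the members of a finite stable affine
covering are nil-coherent. -/
theorem isLocallyNilCoherent_of_isNilCoherent [∀ i, IsNoetherianRing Γ(prod Λ X, O i)]
    (hV : ∀ i, IsNilCoherent Γ(prod Λ X, O i) (V.kapOn (h i))) : isLocallyNilCoherent Λ X V := by
  have hV1 (i) := (hV i).exists_mem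
  refine ⟨V.isIndCoherent_of_exists h hO hc hV1, ?_⟩
  choose P hP hP' hPm using fun i => (hV i).exists_iterate
  choose T hT using hP
  -- The coherent `κ`-subsheaf `L` contains the modules `P i`, into which powers of `κ` map
  -- everything.
  obtain ⟨L, j, hj, hL, hjT⟩ := V.exists_coherent h hO hc hV1
    (H := ⋃ i, (fun t => ⟨O i, t⟩) '' (T i : Set Γ(V.sheaf, O i)))
    (Set.finite_iUnion fun i => (T i).finite_toSet.image _) (by
      rintro _ ⟨_, ⟨i, rfl⟩, t, -, rfl⟩
      exact hO i)
  have hPj (i) : P i ≤ LinearMap.range (appLin j.hom (O i)) := by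
    rw [← hT i, Submodule.span_le]
    exact fun t ht => hjT ⟨O i, t⟩ (Set.mem_iUnion.2 ⟨i, t, ht, rfl⟩)
  refine ⟨L, quotient j, j, quotientπ j, comp_quotientπ j, shortExact_quotient j, hL, ?_⟩
  intro U z x hx
  obtain ⟨i, hi⟩ := hc x
  obtain ⟨g, hg, hgU⟩ := exists_basicOpen (hO i) hx hi
  have := V.isQuasicoherent
  have := (quotient j).isQuasicoherent
  have : Epi (quotientπ j).hom := inferInstanceAs (Epi (cokernel.π j.hom))
  obtain ⟨v, hv⟩ := app_surjective_of_epi (quotientπ j).hom ((hO i).basicOpen g)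
    (res (quotient j).sheaf hgU z)
  obtain ⟨n, v₀, hv₀⟩ := exists_res_eq (hO i) g v
  -- A local section of the quotient lifts, up to a denominator, to a section over `O i`, which lies
  -- in a coherent `κ`-subsheaf `F`. The image of `F` in the quotient is nilpotent.
  obtain ⟨F, a, -, hF, ha⟩ := V.exists_coherent h hO hc hV1 (H := {⟨O i, v₀⟩})
    (Set.finite_singleton _) (by rintro _ rfl; exact hO i)
  obtain ⟨y, hy⟩ := ha _ rfl
  obtain ⟨I, b, hb, hI, hIb⟩ := exists_isNilpotent_image h hO hc (a ≫ quotientπ j) fun i => by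
    have : F.sheaf.IsFiniteType := hF
    have := F.isQuasicoherent
    obtain ⟨m, hm⟩ := exists_iterate_mem_of_fg (hP' i) (hPm i)
      ((fg_of_isFiniteType (M := F.sheaf) (hO i)).map (appLin a.hom (O i)))
    refine ⟨m, fun y => ?_⟩
    obtain ⟨w, hw⟩ := hPj i (hm _ ⟨y, trivial, rfl⟩)
    have h0 : (quotientπ j).hom.app (O i) (j.hom.app (O i) w) = 0 :=
      congr(($(comp_quotientπ j).hom).app (O i) w)
    refine (((semiconj_kapOn (quotientπ j) (h i)).iterate_right m).eq (a.hom.app (O i) y)).symm.trans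
      ((congrArg _ hw.symm).trans h0)
  refine ⟨_, hgU, hg, I, b, hb, hI, hIb _ _ ?_⟩
  refine smul_mem_imageSubsheaf (a ≫ quotientπ j) i _ (n := n) y ?_
  have h2 : (quotientπ j).hom.app (O i) v₀ = (a ≫ quotientπ j).hom.app (O i) y :=
    (congrArg ((quotientπ j).hom.app (O i)) hy).symm
  rw [← h2, ← app_res, hv₀, Scheme.Modules.Hom.app_smul, hv]
  rfl

end CartierSheaf

end CartierSheaves

/-! ### Rings of functions on `X × C` -/

namespace CartierSheaves

section Rings

/-- A pushout of commutative rings is generated by the images of the two rings. -/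
theorem eq_top_of_isPushout {R R' A B : CommRingCat.{u}} {a : R ⟶ R'} {b : R ⟶ A} {c : R' ⟶ B}
    {d : A ⟶ B} (H : IsPushout a b c d) (T : Subring B) (hc : ∀ x, c x ∈ T) (hd : ∀ x, d x ∈ T) :
    T = ⊤ := by
  let c' : R' ⟶ CommRingCat.of T := CommRingCat.ofHom (c.hom.codRestrict T hc)
  let d' : A ⟶ CommRingCat.of T := CommRingCat.ofHom (d.hom.codRestrict T hd)
  have hw : a ≫ c' = b ≫ d' := by
    ext x
    exact congr($(H.w) x)
  have h : H.desc c' d' hw ≫ CommRingCat.ofHom T.subtype = 𝟙 B := by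
    apply H.hom_ext
    · rw [H.inl_desc_assoc, Category.comp_id]
      rfl
    · rw [H.inr_desc_assoc, Category.comp_id]
      rfl
  refine Subring.eq_top_iff' _ |>.2 fun x => ?_
  rw [← show (H.desc c' d' hw ≫ CommRingCat.ofHom T.subtype) x = x from congr($h x)]
  exact (H.desc c' d' hw x : T).2

theorem exists_adjoin_eq_top_of_isPushout {R R' A B : CommRingCat.{u}} {a : R ⟶ R'} {b : R ⟶ A}
    {c : R' ⟶ B} {d : A ⟶ B} (H : IsPushout a b c d) (ha : a.hom.FiniteType) :
    ∃ s : Finset R', letI := d.hom.toAlgebra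
      Algebra.adjoin A (Set.range fun t : s => c t.1) = ⊤ := by
  let := a.hom.toAlgebra
  obtain ⟨s, hs⟩ := (ha : Algebra.FiniteType R R').out
  let := d.hom.toAlgebra
  refine ⟨s, ?_⟩
  set T := Algebra.adjoin A (Set.range fun t : s => c t.1) with hT
  have hd : ∀ x, d x ∈ T.toSubring := T.algebraMap_mem
  suffices T.toSubring = ⊤ from eq_top_iff.2 fun x _ => this.ge (Subring.mem_top x)
  refine eq_top_of_isPushout H _ (fun x => ?_) hd
  have hx : x ∈ Algebra.adjoin R (s : Set R') := hs ▸ trivial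
  induction hx using Algebra.adjoin_induction with
  | mem x hx => exact Algebra.subset_adjoin ⟨⟨x, hx⟩, rfl⟩
  | algebraMap r =>
    have h1 : c (algebraMap R R' r) = d (b r) := congr($(H.w) r)
    rw [h1]
    exact hd _
  | add x y _ _ hx hy => rw [map_add]; exact add_mem hx hy
  | mul x y _ _ hx hy => rw [map_mul]; exact mul_mem hx hy

theorem essFiniteType_of_isPushout {R R' A B : CommRingCat.{u}} {a : R ⟶ R'} {b : R ⟶ A}
    {c : R' ⟶ B} {d : A ⟶ B} (H : IsPushout a b c d) (ha : a.hom.EssFiniteType) :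
    d.hom.EssFiniteType := by
  have := RingHom.isStableUnderCobaseChange_toMorphismProperty_iff.2
    RingHom.EssFiniteType.isStableUnderBaseChange
  exact MorphismProperty.of_isPushout (P := RingHom.toMorphismProperty RingHom.EssFiniteType) H.flip ha

end Rings

variable {k : Type u} [Field k] {Λ : Type u} [CommRing Λ] [Algebra k Λ]
  {X Y : Over (Spec (.of k))}

theorem isSeparated_left [IsSeparated X.hom] : X.left.IsSeparated := by
  refine ⟨?_⟩
  have : IsSeparated (X.hom ≫ terminal.from _) := inferInstance
  rwa [terminal.comp_from] at this

theorem essFiniteType_appLE_spec [Algebra.EssFiniteType k Λ]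
    (h : ⊤ ≤ Spec.map (CommRingCat.ofHom (algebraMap k Λ)) ⁻¹ᵁ ⊤) :
    ((Spec.map (CommRingCat.ofHom (algebraMap k Λ))).appLE ⊤ ⊤ h).hom.EssFiniteType := by
  have h1 : (algebraMap k Λ).EssFiniteType := by
    rw [RingHom.essFiniteType_algebraMap]
    infer_instance
  have h2 : (Spec.map (CommRingCat.ofHom (algebraMap k Λ))).appLE ⊤ ⊤ h =
      (Scheme.ΓSpecIso _).hom ≫ CommRingCat.ofHom (algebraMap k Λ) ≫ (Scheme.ΓSpecIso _).inv := by
    rw [Scheme.ΓSpecIso_inv_naturality, Iso.hom_inv_id_assoc, Scheme.Hom.appLE]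
    exact (congrArg (_ ≫ ·) ((Spec (.of Λ)).presheaf.map_id _)).trans (Category.comp_id _)
  rw [h2]
  have := RingHom.toMorphismProperty_respectsIso_iff.1 RingHom.EssFiniteType.respectsIso
  exact ((RingHom.toMorphismProperty RingHom.EssFiniteType).cancel_left_of_respectsIso _ _).2
    (((RingHom.toMorphismProperty RingHom.EssFiniteType).cancel_right_of_respectsIso _ _).2 h1)

variable (Λ) in
theorem prodOpen_le (U : X.left.Opens) : prodOpen Λ U ≤ prodFst Λ X ⁻¹ᵁ U := le_rfl

/-- `U × C` is Noetherian since `Γ(U, 𝒪) ⊗ Λ` is essentially of finite type over `Γ(U, 𝒪)`. -/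
theorem isNoetherianRing_prodOpen [Algebra.EssFiniteType k Λ] [IsLocallyNoetherian X.left]
    {U : X.left.Opens} (hU : IsAffineOpen U) : IsNoetherianRing Γ(prod Λ X, prodOpen Λ U) := by
  have H := (IsPullback.of_hasPullback X.hom (Spec.map (CommRingCat.ofHom (algebraMap k Λ))))
  have h1 := (isIso_pushoutSection_iff H (US := ⊤) (UT := ⊤) le_top le_top
    (UY := prodOpen Λ U) (by rw [prodOpen]; simp)).1
      (isIso_pushoutSection_of_isAffineOpen H (US := ⊤) (UT := ⊤) le_top le_top (UY := prodOpen Λ U)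
      (by rw [prodOpen]; simp) (isAffineOpen_top _) (isAffineOpen_top _) hU)
  have h2 := essFiniteType_of_isPushout h1.flip (essFiniteType_appLE_spec _)
  have := IsLocallyNoetherian.component_noetherian (X := X.left) ⟨U, hU⟩
  let := ((prodFst Λ X).appLE U (prodOpen Λ U) (prodOpen_le Λ U)).hom.toAlgebra
  have : Algebra.EssFiniteType Γ(X.left, U) Γ(prod Λ X, prodOpen Λ U) := h2
  exact Algebra.EssFiniteType.isNoetherianRing Γ(X.left, U) Γ(prod Λ X, prodOpen Λ U)

/-- The homomorphism on functions defined by `f × id`. -/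
def prodHom (f : Y ⟶ X) {U : X.left.Opens} {U' : Y.left.Opens} (h : U' ≤ f.left ⁻¹ᵁ U) :
    Γ(prod Λ X, prodOpen Λ U) →+* Γ(prod Λ Y, prodOpen Λ U') :=
  ((prodMap Λ f).appLE (prodOpen Λ U) (prodOpen Λ U') (by
    rw [prodMap_preimage_prodOpen]
    exact prodOpen_mono h)).hom

/-- The homomorphism on functions defined by the projection `U × C ⟶ U`. -/
def fstHom (U : X.left.Opens) : Γ(X.left, U) →+* Γ(prod Λ X, prodOpen Λ U) :=
  ((prodFst Λ X).appLE U (prodOpen Λ U) (prodOpen_le Λ U)).hom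

/-- The functions on `U' × C` are generated, over the functions on `U × C`, by finitely many
functions pulled back from `U'`. -/
theorem exists_adjoin_eq_top (f : Y ⟶ X) [LocallyOfFiniteType f.left] {U : X.left.Opens}
    {U' : Y.left.Opens} (h : U' ≤ f.left ⁻¹ᵁ U) (hU : IsAffineOpen U) (hU' : IsAffineOpen U') :
    ∃ s : Finset Γ(Y.left, U'), letI := (prodHom (Λ := Λ) f h).toAlgebra
      Algebra.adjoin Γ(prod Λ X, prodOpen Λ U)
        (Set.range fun t : s => fstHom (Λ := Λ) U' t.1) = ⊤ := by
  have H := isPullback_prodMap Λ f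
  have hUY : prodOpen Λ U' = prodFst Λ Y ⁻¹ᵁ U' ⊓ prodMap Λ f ⁻¹ᵁ prodOpen Λ U := by
    rw [prodMap_preimage_prodOpen]
    exact (inf_eq_left.2 (prodOpen_mono h)).symm
  have h1 := (isIso_pushoutSection_iff H (UT := prodOpen Λ U) le_rfl h hUY).1
    (isIso_pushoutSection_of_isAffineOpen H (UT := prodOpen Λ U) le_rfl h hUY hU
      (isAffineOpen_prodOpen hU) hU')
  exact exists_adjoin_eq_top_of_isPushout h1 (f.left.finiteType_appLE hU hU' h)

variable [Finite k]

theorem frobOn_prodHom (f : Y ⟶ X) {U : X.left.Opens} {U' : Y.left.Opens}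
    (h : U' ≤ f.left ⁻¹ᵁ U) (r : Γ(prod Λ X, prodOpen Λ U)) :
    frobOn (isStable_prodOpen U') (prodHom f h r) =
      prodHom f h (frobOn (isStable_prodOpen U) r) := by
  have h1 : (prodMap Λ f).appLE (prodOpen Λ U) (prodOpen Λ U') (by
      rw [prodMap_preimage_prodOpen]
      exact prodOpen_mono h) ≫ (prodFrob Λ Y).appLE (prodOpen Λ U') (prodOpen Λ U')
        (isStable_prodOpen U').ge =
      (prodFrob Λ X).appLE (prodOpen Λ U) (prodOpen Λ U) (isStable_prodOpen U).ge ≫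
        (prodMap Λ f).appLE (prodOpen Λ U) (prodOpen Λ U') (by
      rw [prodMap_preimage_prodOpen]
      exact prodOpen_mono h) := by
    rw [Scheme.Hom.appLE_comp_appLE, Scheme.Hom.appLE_comp_appLE]
    simp only [prodMap_frob]
  exact congr($h1 r)

/-- On functions pulled back from `X`, the endomorphism `σ × id` is the `q`-power map. On general
functions on `X × C` it is not. -/
theorem frobOn_fstHom (U : X.left.Opens) (t : Γ(X.left, U)) :
    frobOn (isStable_prodOpen U) (fstHom (Λ := Λ) U t) = fstHom U t ^ Nat.card k := by
  have h0 : U ≤ (frob X).left ⁻¹ᵁ U := le_rfl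
  have h1 : (prodFst Λ X).appLE U (prodOpen Λ U) (prodOpen_le Λ U) ≫
      (prodFrob Λ X).appLE (prodOpen Λ U) (prodOpen Λ U) (isStable_prodOpen U).ge =
      (frob X).left.appLE U U h0 ≫ (prodFst Λ X).appLE U (prodOpen Λ U) (prodOpen_le Λ U) := by
    rw [Scheme.Hom.appLE_comp_appLE, Scheme.Hom.appLE_comp_appLE]
    simp only [prodMap_fst]
  have h2 : (frob X).left.appLE U U h0 t = t ^ Nat.card k :=
    resO_self le_rfl (t ^ Nat.card k)
  refine congr($h1 t).trans ?_
  change fstHom U ((frob X).left.appLE U U h0 t) = _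
  rw [h2, map_pow]

instance isFinite_prodFrob [IsFinite (frob X).left] : IsFinite (prodFrob Λ X) :=
  MorphismProperty.of_isPullback (isPullback_prodMap Λ (frob X)) inferInstance

/-- The endomorphism `σ × id` of the functions on a stable affine open subset is finite. -/
theorem finite_frobOn [IsFinite (frob X).left] {O : (prod Λ X).Opens} (h : IsStable O)
    (hO : IsAffineOpen O) : (frobOn h).Finite := by
  refine RingHom.Finite.comp (RingHom.Finite.of_surjective _ fun s => ⟨resO h.le s, ?_⟩)
    ((prodFrob Λ X).finite_app O hO)
  rw [resO_resO, resO_self]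

end CartierSheaves

/-! ### Pushforward of locally nil-coherent `κ`-sheaves -/

namespace CartierSheaves

/-- Descent of nil-coherence along a ring homomorphism of finite type, for a module which is only
identified with a module over the larger ring. -/
theorem IsNilCoherent.of_bijective {A B M N ι : Type*} [CommRing A] [CommRing B] [AddCommGroup M]
    [AddCommGroup N] [Module A M] [Module B N] {φ : A →+* A} {ψ : B →+* B} {q : ℕ} {κM : M →+ M}
    {κN : N →+ N} [IsNoetherianRing A] [Fintype ι] (ρ : A →+* B) (hφ : φ.Finite)
    (hψ : ∀ a, ψ (ρ a) = ρ (φ a)) (hq : 2 ≤ q) (x : ι → B)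
    (hx : letI := ρ.toAlgebra; Algebra.adjoin A (Set.range x) = ⊤) (hxq : ∀ i, ψ (x i) = x i ^ q)
    (hκ : ∀ b n, κN (ψ b • n) = b • κN n) (h : IsNilCoherent B κN) (g : M →+ N)
    (hg : Function.Bijective g) (hgρ : ∀ a m, g (a • m) = ρ a • g m)
    (hgκ : Function.Semiconj g κM κN) : IsNilCoherent A κM := by
  let := ρ.toAlgebra
  let := Module.compHom N ρ
  have : IsScalarTower A B N := IsScalarTower.of_algebraMap_smul fun _ _ => rfl
  have h1 : IsNilCoherent A κN := h.restrictScalars hφ hψ hq x hx hxq hκ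
  let e : M ≃ₗ[A] N := LinearEquiv.ofBijective
    { toFun := g, map_add' := map_add g, map_smul' := hgρ : M →ₗ[A] N } hg
  refine h1.of_equiv e.symm fun n => e.injective ?_
  have h2 : g (e.symm n) = n := e.apply_symm_apply n
  rw [e.apply_symm_apply]
  exact ((hgκ (e.symm n)).trans (congrArg κN h2)).symm

variable {k : Type u} [Field k] [Finite k] {Λ : Type u} [CommRing Λ] [Algebra k Λ]
  {X Y : Over (Spec (.of k))}

namespace CartierSheaf

/-- The sections over `U × C` are nil-coherent, for every affine open subset `U`. -/
def isNilCoherentOnAffines : ObjectProperty (CartierSheaf Λ X) := fun V =>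
  ∀ U : X.left.Opens, IsAffineOpen U → IsNilCoherent Γ(prod Λ X, prodOpen Λ U)
    (V.kapOn (isStable_prodOpen U))

theorem closedUnderSums_isNilCoherentOnAffines :
    ClosedUnderSums (isNilCoherentOnAffines (Λ := Λ) (X := X)) := by
  intro V W Z p i q j h hV hW U hU
  exact (hV U hU).sum (hW U hU) (p := appLin p.hom _) (i := appLin i.hom _) (q := appLin q.hom _)
    (j := appLin j.hom _) (fun z => congr(($(congrArg Hom.hom h)).app (prodOpen Λ U) z))
    (semiconj_kapOn i _) (semiconj_kapOn j _)

theorem isNilCoherentOnAffines_of_isZero {V : CartierSheaf Λ X} (h : IsZero V) :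
    isNilCoherentOnAffines V := by
  intro U hU
  have : Subsingleton Γ(V.sheaf, prodOpen Λ U) := subsingleton_of_forall_eq 0 fun s =>
    congr(($(congrArg Hom.hom (h.eq_of_src (𝟙 V) 0))).app (prodOpen Λ U) s)
  exact isNilCoherent_of_subsingleton _

/-- A `κ`-sheaf is locally nil-coherent if and only if its sections over all `U × C` with `U` affine
are nil-coherent. -/
theorem isNilCoherentOnAffines_iff [Algebra.EssFiniteType k Λ] [IsNoetherian X.left]
    [IsSeparated X.hom] [IsFinite (frob X).left] (V : CartierSheaf Λ X) :
    isNilCoherentOnAffines V ↔ isLocallyNilCoherent Λ X V := by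
  refine ⟨fun hV => ?_, fun hV U hU =>
    isNilCoherent_of_isLocallyNilCoherent hV _ (isAffineOpen_prodOpen hU)⟩
  obtain ⟨ι, hι, U, hU, hc⟩ := exists_affine_cover (U := (⊤ : X.left.Opens)) isCompact_univ
  have (i : ι) := isNoetherianRing_prodOpen (Λ := Λ) (hU i)
  refine isLocallyNilCoherent_of_isNilCoherent (O := fun i => prodOpen Λ (U i))
    (fun i => isStable_prodOpen (U i)) (fun i => isAffineOpen_prodOpen (hU i)) (fun x => ?_)
    fun i => hV _ (hU i)
  obtain ⟨i, hi⟩ := Opens.mem_iSup.1 (hc.le (Opens.mem_top (prodFst Λ X x)))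
  exact ⟨i, hi⟩

section Extend

variable [IsNoetherian Y.left] (U : Y.left.Opens) (W : CartierSheaf Λ Y)
  {O D : (prod Λ Y).Opens}

/-- Sections of the extension by `j_*` over `O`, as sections over `D = (U × C) ∩ O`. -/
def extendRes (h : D ≤ cap (prodOpen Λ U) O) : Γ((extendObj U W).sheaf, O) →+ Γ(W.sheaf, D) :=
  (res W.sheaf h).comp (extendSections (Ω := prodOpen Λ U) (M := W.sheaf) (O := O)).toAddMonoidHom

theorem extendRes_bijective (h : D ≤ cap (prodOpen Λ U) O) (e : cap (prodOpen Λ U) O = D) :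
    Function.Bijective (extendRes U W h) :=
  (res_bijective_of_eq W.sheaf h e).comp extendSections.bijective

theorem extendRes_smul (h : D ≤ cap (prodOpen Λ U) O) (r : Γ(prod Λ Y, O))
    (s : Γ((extendObj U W).sheaf, O)) :
    extendRes U W h (r • s) = resO (h.trans (cap_le _ _)) r • extendRes U W h s := by
  refine (congrArg (res W.sheaf h) (extendSections_smul r s)).trans ?_
  rw [res_smul, resO_resO]
  rfl

theorem semiconj_extendRes (h : D ≤ cap (prodOpen Λ U) O) (hO : IsStable O) (hD : IsStable D) :
    Function.Semiconj (extendRes U W h) ((extendObj U W).kapOn hO) (W.kapOn hD) := by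
  intro s
  have h1 : extendSections (Ω := prodOpen Λ U) (M := W.sheaf) ((extendObj U W).kapOn hO s) =
      W.kap (cap (prodOpen Λ U) O) (res W.sheaf (cap_prodFrob_preimage U O).ge
        (res W.sheaf (cap_mono _ hO.le) (extendSections s))) :=
    extendSections_extendKap U W O (res _ hO.le s)
  refine (congrArg (res W.sheaf h) h1).trans ?_
  rw [← kap_res, res_res, res_res]
  refine congrArg (W.kap D) ?_
  exact (res_res W.sheaf h hD.le (extendSections s)).symm

end Extend

section Pushforward

variable (f : Y ⟶ X) [QuasiCompact f.left] [QuasiSeparated f.left]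

omit [QuasiCompact f.left] [QuasiSeparated f.left] in
theorem isStable_preimage {O : (prod Λ X).Opens} (h : IsStable O) :
    IsStable (prodMap Λ f ⁻¹ᵁ O) :=
  (prodFrob_preimage_prodMap_preimage f O).trans (congrArg (prodMap Λ f ⁻¹ᵁ ·) h)

/-- Sections of `f_* W` over `O`, as sections of `W` over the preimage of `O`. -/
def pushforwardSections (W : CartierSheaf Λ Y) (O : (prod Λ X).Opens) :
    Γ(((pushforward Λ f).obj W).sheaf, O) ≃+ Γ(W.sheaf, prodMap Λ f ⁻¹ᵁ O) := AddEquiv.refl _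

theorem pushforwardSections_smul (W : CartierSheaf Λ Y) {O : (prod Λ X).Opens}
    (r : Γ(prod Λ X, O)) (s : Γ(((pushforward Λ f).obj W).sheaf, O)) :
    pushforwardSections f W O (r • s) = (prodMap Λ f).app O r • pushforwardSections f W O s := rfl

theorem semiconj_pushforwardSections (W : CartierSheaf Λ Y) {O : (prod Λ X).Opens}
    (h : IsStable O) : Function.Semiconj (pushforwardSections f W O)
      (((pushforward Λ f).obj W).kapOn h) (W.kapOn (isStable_preimage f h)) := by
  intro s
  refine (pushforward_kap f W O (res W.sheaf (Scheme.Hom.preimage_mono _ h.le) s)).trans ?_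
  exact congrArg (W.kap (prodMap Λ f ⁻¹ᵁ O)) (res_res W.sheaf
    (Scheme.Hom.preimage_mono (prodMap Λ f) h.le) (prodFrob_preimage_prodMap_preimage f O).le
    (pushforwardSections f W O s))

end Pushforward

omit [Finite k] in
theorem prodHom_id {U U' : Y.left.Opens} (h : U' ≤ (𝟙 Y : Y ⟶ Y).left ⁻¹ᵁ U)
    (h' : prodOpen Λ U' ≤ prodOpen Λ U) (r : Γ(prod Λ Y, prodOpen Λ U)) :
    prodHom (𝟙 Y) h r = resO h' r := by
  have key (g : prod Λ Y ⟶ prod Λ Y) (hg : g = 𝟙 _) {O D : (prod Λ Y).Opens} (e : D ≤ g ⁻¹ᵁ O)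
      (e' : D ≤ O) (r : Γ(prod Λ Y, O)) : g.appLE O D e r = resO e' r := by
    subst hg
    rfl
  refine key (prodMap Λ (𝟙 Y)) (pullback.hom_ext ?_ ?_) _ h' r
  · rw [prodMap_fst, Category.id_comp]
    exact Category.comp_id _
  · rw [prodMap_snd, Category.id_comp]

section Descent

variable [Algebra.EssFiniteType k Λ] [IsNoetherian X.left] [IsNoetherian Y.left]
  [IsFinite (frob X).left] (f : Y ⟶ X) [LocallyOfFiniteType f.left]

omit [AlgebraicGeometry.IsNoetherian Y.left] in
/-- Nil-coherence of the sections of `W` over `U' × C` implies nil-coherence of the same sections over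
the functions on `U × C`, if `f` maps `U'` to `U`. -/
theorem isNilCoherent_of_bijective {W : CartierSheaf Λ Y} {V : CartierSheaf Λ X}
    {U : X.left.Opens} {U' : Y.left.Opens} (h : U' ≤ f.left ⁻¹ᵁ U) (hU : IsAffineOpen U)
    (hU' : IsAffineOpen U') (hW : isNilCoherentOnAffines W)
    (g : Γ(V.sheaf, prodOpen Λ U) →+ Γ(W.sheaf, prodOpen Λ U')) (hg : Function.Bijective g)
    (hgs : ∀ r s, g (r • s) = prodHom (Λ := Λ) f h r • g s)
    (hgκ : Function.Semiconj g (V.kapOn (isStable_prodOpen U)) (W.kapOn (isStable_prodOpen U'))) :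
    IsNilCoherent Γ(prod Λ X, prodOpen Λ U) (V.kapOn (isStable_prodOpen U)) := by
  have := isNoetherianRing_prodOpen (Λ := Λ) hU
  obtain ⟨s, hs⟩ := exists_adjoin_eq_top (Λ := Λ) f h hU hU'
  have hq : 2 ≤ Nat.card k := Finite.one_lt_card
  exact (hW U' hU').of_bijective (prodHom f h)
    (finite_frobOn (isStable_prodOpen U) (isAffineOpen_prodOpen hU)) (frobOn_prodHom f h) hq
    (fun t : s => fstHom U' t.1) hs (fun t => frobOn_fstHom U' t.1)
    (W.kapOn_smul (isStable_prodOpen U')) g hg hgs hgκ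

/-- The sections of `f_* j_* j^* W` over `O × C` are those of `W` over `U' × C`, where
`U' = U ∩ f⁻¹ O` is affine and of finite type over `O`. -/
theorem isNilCoherentOnAffines_pushforward_extendObj [X.left.IsSeparated] [QuasiCompact f.left]
    [QuasiSeparated f.left] {W : CartierSheaf Λ Y} (hW : isNilCoherentOnAffines W)
    {U : Y.left.Opens} (hU : IsAffineOpen U) :
    isNilCoherentOnAffines ((pushforward Λ f).obj (extendObj U W)) := by
  intro O hO
  let U' : Y.left.Opens := U ⊓ f.left ⁻¹ᵁ O
  have hU' : IsAffineOpen U' := by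
    have := isAffineOpen_cap_preimage f.left hU hO
    rwa [cap_eq] at this
  have e : cap (prodOpen Λ U) (prodMap Λ f ⁻¹ᵁ prodOpen Λ O) = prodOpen Λ U' := by
    rw [cap_eq, prodMap_preimage_prodOpen]
    rfl
  have hle : U' ≤ f.left ⁻¹ᵁ O := inf_le_right
  refine isNilCoherent_of_bijective f hle hO hU' hW ((extendRes U W e.ge).comp
    (pushforwardSections f (extendObj U W) (prodOpen Λ O)).toAddMonoidHom) ?_ (fun r s => ?_) ?_
  · exact (extendRes_bijective U W e.ge e).comp (pushforwardSections f (extendObj U W) _).bijective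
  · exact (congrArg (extendRes U W e.ge) (pushforwardSections_smul f (extendObj U W) r s)).trans
      (extendRes_smul U W e.ge ((prodMap Λ f).app _ r) _)
  · exact (semiconj_extendRes U W e.ge _ (isStable_prodOpen U')).comp_left
      (semiconj_pushforwardSections f (extendObj U W) (isStable_prodOpen O))

/-- For the identity of `Y`: the sections of `j_* j^* W` over `O × C` are those of `W` over
`(U ∩ O) × C`. -/
theorem isNilCoherentOnAffines_extendObj [Y.left.IsSeparated] [IsFinite (frob Y).left]
    {W : CartierSheaf Λ Y} (hW : isNilCoherentOnAffines W) {U : Y.left.Opens}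
    (hU : IsAffineOpen U) : isNilCoherentOnAffines (extendObj U W) := by
  intro O hO
  let U' : Y.left.Opens := U ⊓ O
  have hU' : IsAffineOpen U' := hU.inf hO
  have e : cap (prodOpen Λ U) (prodOpen Λ O) = prodOpen Λ U' := cap_eq _ _
  have hid : LocallyOfFiniteType (𝟙 Y : Y ⟶ Y).left :=
    inferInstanceAs (LocallyOfFiniteType (𝟙 Y.left))
  have hle : U' ≤ (𝟙 Y : Y ⟶ Y).left ⁻¹ᵁ O := (inf_le_right : U' ≤ O)
  refine isNilCoherent_of_bijective (W := W) (𝟙 Y) hle hO hU' hW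
    (extendRes U W e.ge) (extendRes_bijective U W e.ge e) (fun r s => ?_)
    (semiconj_extendRes U W e.ge _ _)
  rw [extendRes_smul, prodHom_id]

/-- The pushforward of the Čech complex of an affine covering consists of locally nil-coherent
`κ`-sheaves. -/
theorem isLocallyNilCoherent_pushforward_sheafCech [IsSeparated X.hom] [IsSeparated Y.hom]
    [IsFinite (frob Y).left] [QuasiCompact f.left] [QuasiSeparated f.left] {ι : Type*}
    {U : ι → Y.left.Opens} (hU : ∀ i, IsAffineOpen (U i)) (l : List ι)
    {K : CochainComplex (CartierSheaf Λ Y) ℤ} (hK : ∀ n, isLocallyNilCoherent Λ Y (K.X n)) (n : ℤ) :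
    isLocallyNilCoherent Λ X ((pushforward Λ f).obj (((sheafCech Λ U l).ρ.obj K).X n)) := by
  have : X.left.IsSeparated := isSeparated_left
  have : Y.left.IsSeparated := isSeparated_left
  rw [← isNilCoherentOnAffines_iff]
  have hQ : ClosedUnderSums fun W : CartierSheaf Λ Y =>
      isNilCoherentOnAffines ((pushforward Λ f).obj W) := by
    intro V W Z p i q j h
    refine closedUnderSums_isNilCoherentOnAffines ((pushforward Λ f).map p)
      ((pushforward Λ f).map i) ((pushforward Λ f).map q) ((pushforward Λ f).map j) ?_
    rw [← Functor.map_comp, ← Functor.map_comp, ← Functor.map_add, h, CategoryTheory.Functor.map_id]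
  have hQT (i : ι) (W : CartierSheaf Λ Y) (hW : isNilCoherentOnAffines W) :
      isNilCoherentOnAffines ((pushforward Λ f).obj ((extendFunctor (U i)).obj W)) :=
    isNilCoherentOnAffines_pushforward_extendObj f hW (hU i)
  have hPT (i : ι) (W : CartierSheaf Λ Y) (hW : isNilCoherentOnAffines W) :
      isNilCoherentOnAffines ((extendFunctor (U i)).obj W) :=
    isNilCoherentOnAffines_extendObj hW (hU i)
  exact (cech_property closedUnderSums_isNilCoherentOnAffines hQ
    (fun _ h => isNilCoherentOnAffines_of_isZero h)
    (fun _ h => isNilCoherentOnAffines_of_isZero ((pushforward Λ f).map_isZero h)) hPT hQT l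
    (fun n => (isNilCoherentOnAffines_iff _).2 (hK n)) n).2

end Descent

end CartierSheaf

section Bounded

variable [IsNoetherian Y.left] (f : Y ⟶ X) [QuasiCompact f.left] [QuasiSeparated f.left]

/-- The Čech complex of a finite covering is bounded as the original complex is. -/
theorem boundedness_pushforward_sheafCech {ι : Type*} (U : ι → Y.left.Opens) (l : List ι)
    {K : CochainComplex (CartierSheaf Λ Y) ℤ} {b : Boundedness} (hK : b.Holds K) :
    b.Holds ((CartierSheaf.pushforwardComplexes f).obj ((CartierSheaf.sheafCech Λ U l).ρ.obj K)) := by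
  have hb (h : ∃ n : ℤ, ∀ i < n, IsZero (K.X i)) : ∃ n : ℤ, ∀ i < n, IsZero
      (((CartierSheaf.pushforwardComplexes f).obj ((CartierSheaf.sheafCech Λ U l).ρ.obj K)).X i) := by
    obtain ⟨n, hn⟩ := h
    exact ⟨n, fun i hi => (pushforward Λ f).map_isZero (cech_isZero_below hn l i hi)⟩
  have ha (h : ∃ n : ℤ, ∀ i > n, IsZero (K.X i)) : ∃ n : ℤ, ∀ i > n, IsZero
      (((CartierSheaf.pushforwardComplexes f).obj ((CartierSheaf.sheafCech Λ U l).ρ.obj K)).X i) := by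
    obtain ⟨n, hn⟩ := h
    exact ⟨n + l.length, fun i hi => (pushforward Λ f).map_isZero (cech_isZero_above hn l i hi)⟩
  cases b with
  | bounded => exact ⟨hb hK.1, ha hK.2⟩
  | below => exact hb hK
  | above => exact ha hK
  | unbounded => trivial

end Bounded

end CartierSheaves

end

theorem theorem3p2p14 {k : Type u} [Field k] [Finite k]
    {Λ : Type u} [CommRing Λ] [Algebra k Λ] [Algebra.EssFiniteType k Λ]
    {X Y : Over (Spec (CommRingCat.of k))}
    [IsNoetherian X.left] [IsNoetherian Y.left] [IsSeparated X.hom] [IsSeparated Y.hom]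
    [IsFinite (CartierSheaves.frob X).left] [IsFinite (CartierSheaves.frob Y).left]
    (f : Y ⟶ X) [LocallyOfFiniteType f.left] :
    ∃ _ : (CartierSheaves.pushforwardDerived Λ f).HasRightDerivedFunctor
        (CartierSheaves.quasiIso Λ Y),
      ∀ (b : CartierSheaves.Boundedness) (V : CartierSheaves.Derived Λ Y),
        CartierSheaves.derivedLocallyNilCoherent Λ b Y V →
          CartierSheaves.derivedLocallyNilCoherent Λ b X
            ((CartierSheaves.rightDerivedPushforward Λ f).obj V) := by
  obtain ⟨ι, hι, U, hU, hc⟩ := CartierSheaves.exists_affine_cover (U := (⊤ : Y.left.Opens)) isCompact_univ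
  have := Fintype.ofFinite ι
  obtain ⟨hR, ⟨e⟩⟩ := CartierSheaves.CartierSheaf.exists_hasRightDerivedFunctor (Λ := Λ) f hU
    (Finset.univ : Finset ι).toList (fun x => by
      obtain ⟨i, hi⟩ := Opens.mem_iSup.1 (hc.le (Opens.mem_top x))
      exact ⟨i, by simp, hi⟩)
  refine ⟨hR, ?_⟩
  rintro b V ⟨K, hb, hK, ⟨eV⟩⟩
  exact ⟨_, CartierSheaves.boundedness_pushforward_sheafCech f U (Finset.univ : Finset ι).toList hb,
    CartierSheaves.CartierSheaf.isLocallyNilCoherent_pushforward_sheafCech f hU _ hK,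
    ⟨(CartierSheaves.rightDerivedPushforward Λ f).mapIso eV ≪≫ e.app K⟩⟩
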